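/- **Setting.** Let $n\ge 2$, $\gamma\ge 0$, $N=2^n$, $-1\le a<b\le 1$, $\Delta x=(b-a)/(N-1)$, and assume $\sum_{\kappa=0}^{N-1}(a+\kappa\Delta x)^2=1$. Let $\hat x=\mathrm{diag}(a,a+\Delta x,\dots,b)$ and let $\hat p$ be the $N\times N$ matrix $\hat p_{ij}=-\frac{i}{2\Delta x}\bigl([j\equiv i+1]-[i\equiv j+1]\bigr)$, congruences modulo $N$ (the $i$ in the prefactor is the imaginary unit). For $k=0,\dots,2^\gamma-1$ let $\alpha_k\in\mathbb C$ (not all zero), $q_k,m_k\in\mathbb N$, and let $P_{q_k}$ be a real polynomial of degree $q_k$ that contains only monomials of the parity of $q_k$ and satisfies $|P_{q_k}(x)|<1$ for $x\in[-1,1]$. Put $$\hat H=\sum_{k=0}^{2^\gamma-1}\left(\alpha_kP_{q_k}(\hat x)\hat p^{m_k}+\alpha_k^*\,\hat p^{m_k}P_{q_k}(\hat x)\right).$$ Let $l_k=\lceil\log_2(m_k+1)\rceil$, $l_{\max}=\max_kl_k$, $q=\max_kq_k$, let $\mathcal N_{p^{m_k}}\ge\max_{i,j}|(\hat p^{m_k})_{ij}|^2$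 be any real constants, and $$\mathcal N_H=2\sum_{k=0}^{2^\gamma-1}|\alpha_k|\sqrt{2^{l_k}\mathcal N_{p^{m_k}}}.$$ For a matrix $M$ and $c\in\mathbb C$, an operator $A$ on a flag register, an $n$-qubit row register and an $n$-qubit column register *encodes $M$ with factor $c$* if for all $\sigma_0,\dots,\sigma_{N-1}\in\mathbb C$ $$A\sum_{j}\sigma_j|0\rangle|0\rangle^n|j\rangle^n=c\sum_{i,j}M_{ij}\,\sigma_j|0\rangle|i\rangle^n|j\rangle^n+|\bot\rangle ,$$ where $|\bot\rangle$ is orthogonal to all $|0\rangle|i\rangle^n|j\rangle^n$. A *one-term auxiliary* $A_{P_{q_k}p^{m_k}}$ (resp. $A_{p^{m_k}P_{q_k}}$) is a unitary with a 3-qubit flag register that encodes $P_{q_k}(\hat x)\hat p^{m_k}$ (resp. $\hat p^{m_k}P_{q_k}(\hat x)$) with factor $(-i)^{m_k}/\sqrt{2^{l_k}\mathcal N_{p^{m_k}}}$. A *coefficient-preparation unitary* $U^H_\alpha$ is a $(\gamma+1)$-qubit unitary with $$U_\alpha^H|0\rangle^{\gamma+1}=\frac1{\sqrt{\mathcal N_H}}\sum_{k=0}^{2^\gamma-1}\left(2^{l_k}\mathcal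 N_{p^{m_k}}\right)^{1/4}\left[\sqrt{i^{m_k}\alpha_k}\,|k\rangle+\sqrt{i^{m_k}\alpha_k^*}\,|k+2^\gamma\rangle\right]$$ (principal square roots). $C^b_U$ denotes the multi-control operator that applies $U$ if the control register is in the state $|b\rangle$ and the identity otherwise. Given such unitaries put $$A_H=\left({U^H_\alpha}^T\otimes I\right)\left(\prod_{k=0}^{2^\gamma-1}C^{k+2^\gamma}_{A_{p^{m_k}P_{q_k}}}\right)\left(\prod_{k=0}^{2^\gamma-1}C^{k}_{A_{P_{q_k}p^{m_k}}}\right)\left(U^H_\alpha\otimes I\right),$$ an operator on $2n+\gamma+4$ qubits whose flag register consists of the $\gamma+1$ control qubits and the 3 flag qubits of the auxiliaries. **Statement.** 1. For every choice of a coefficient-preparation unitary and of one-term auxiliaries, $A_H$ is unitary and encodes $\hat H$ with factor $1/\mathcal N_H$; that is, with $|\bot\rangle$ orthogonal to $|0\rangle^{\gamma+4}|i\rangle^n|j\rangle^n$ for all $i,j$, $$A_H\sum_j\sigma_j|0\rangle^{\gamma+4}|0\rangle^n|j\rangle^n=\frac1{\mathcal N_H}\sum_{i,j}\hat H_{ij}\,\sigma_j|0\rangle^{\gamma+4}|i\rangle^n|j\rangle^n+|\bot\rangle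 .$$ 2. The coefficient-preparation unitary and the one-term auxiliaries exist and can be chosen such that $A_H$ is implemented exactly by a circuit of one-qubit unitaries and C-NOTs with no more than * $2^{\gamma+2}\left[9760n^2q+33\cdot2^{l_{\max}+2}n+160n+8\gamma-4504nq-476q-115\cdot 2^{l_{\max}}-239\right]$ one-qubit operations, * $2^{\gamma+1}\left[15792n^2q+107\cdot 2^{l_{\max}+1}n+256n+12\gamma-7288nq-768q-49\cdot 2^{l_{\max}+1}-382\right]$ C-NOTs, * $2n+\gamma-1$ pure ancillas, i.e. auxiliary qubits such that for every state $|\psi\rangle$ of the $2n+\gamma+4$ qubits the circuit maps $|0\rangle|\psi\rangle$ to $|0\rangle A_H|\psi\rangle$. -/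

import Mathlib

open Matrix
open scoped Kronecker

noncomputable section

namespace QBlock

/-! ### Gates and circuits -/

/-- The elementary gates on a set `Q` of qubits: an arbitrary one-qubit unitary on the qubit `t`,
and a C-NOT with control `c` and target `t`. -/
inductive Gate (Q : Type) : Type
  | single (t : Q) (u : Matrix.unitaryGroup (Fin 2) ℂ) : Gate Q
  | cnot (c t : Q) (h : c ≠ t) : Gate Q

variable {Q : Type} [Fintype Q] [DecidableEq Q]

/-- The matrix of a gate in the computational basis `Q → Fin 2`
(addition in `Fin 2` is exclusive or). -/
def Gate.mat : Gate Q → Matrix (Q → Fin 2) (Q → Fin 2) ℂ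
  | .single t u => Matrix.of fun x y =>
      if ∀ s, s ≠ t → x s = y s then (u : Matrix (Fin 2) (Fin 2) ℂ) (x t) (y t) else 0
  | .cnot c t _ => Matrix.of fun x y =>
      if x = Function.update y t (y t + y c) then 1 else 0

/-- A circuit is a list of gates; the head of the list acts first. -/
abbrev Circuit (Q : Type) : Type := List (Gate Q)

/-- The unitary of a circuit. -/
def evalCircuit : Circuit Q → Matrix (Q → Fin 2) (Q → Fin 2) ℂ
  | [] => 1
  | g :: C => evalCircuit C * g.mat

/-- The number of one-qubit operations of a circuit. -/
def oneQubitCount {Q : Type} : Circuit Q → ℕ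
  | [] => 0
  | .single _ _ :: C => oneQubitCount C + 1
  | .cnot _ _ _ :: C => oneQubitCount C

/-- The number of C-NOTs of a circuit. -/
def cnotCount {Q : Type} : Circuit Q → ℕ
  | [] => 0
  | .single _ _ :: C => cnotCount C
  | .cnot _ _ _ :: C => cnotCount C + 1

/-- The state `|0⟩^r ⊗ |ψ⟩`. -/
def withZeroAncillas (r : ℕ) (ψ : (Q → Fin 2) → ℂ) : (Fin r ⊕ Q → Fin 2) → ℂ :=
  fun z => if ∀ s, z (Sum.inl s) = 0 then ψ (fun s => z (Sum.inr s)) else 0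

/-- The circuit `C` implements `U` with `r` pure ancillas: for every `ψ`, it maps
`|0⟩^r ⊗ |ψ⟩` to `|0⟩^r ⊗ U|ψ⟩`. -/
def Implements {r : ℕ} (C : Circuit (Fin r ⊕ Q)) (U : Matrix (Q → Fin 2) (Q → Fin 2) ℂ) : Prop :=
  ∀ ψ : (Q → Fin 2) → ℂ,
    evalCircuit C *ᵥ withZeroAncillas r ψ = withZeroAncillas r (U *ᵥ ψ)

/-! ### The discretised Hamiltonian -/

/-- The grid step: `2 ^ n` equidistant points on `[a, b]`, end points included. -/
def gridStep (n : ℕ) (a b : ℝ) : ℝ := (b - a) / (2 ^ n - 1)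

/-- The `κ`-th grid point `a + κ Δx`. -/
def gridPoint (n : ℕ) (a b : ℝ) (κ : Fin (2 ^ n)) : ℝ := a + (κ : ℕ) * gridStep n a b

/-- The coordinate matrix `x̂`. -/
def xHat (n : ℕ) (a b : ℝ) : Matrix (Fin (2 ^ n)) (Fin (2 ^ n)) ℂ :=
  Matrix.diagonal fun κ => (gridPoint n a b κ : ℂ)

/-- The momentum matrix `p̂`: central differences with periodic boundary conditions. -/
def pHat (n : ℕ) (a b : ℝ) : Matrix (Fin (2 ^ n)) (Fin (2 ^ n)) ℂ :=
  Matrix.of fun i j =>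
    -Complex.I / (2 * (gridStep n a b : ℂ)) *
      ((if ((i : ℕ) + 1) % 2 ^ n = j then 1 else 0) - (if ((j : ℕ) + 1) % 2 ^ n = i then 1 else 0))

/-- `P(x̂) p̂^m`. -/
def termPX (n : ℕ) (a b : ℝ) (P : Polynomial ℝ) (m : ℕ) : Matrix (Fin (2 ^ n)) (Fin (2 ^ n)) ℂ :=
  Polynomial.aeval (xHat n a b) P * pHat n a b ^ m

/-- `p̂^m P(x̂)`. -/
def termXP (n : ℕ) (a b : ℝ) (P : Polynomial ℝ) (m : ℕ) : Matrix (Fin (2 ^ n)) (Fin (2 ^ n)) ℂ :=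
  pHat n a b ^ m * Polynomial.aeval (xHat n a b) P

/-- `Ĥ = ∑ₖ (αₖ Pₖ(x̂) p̂^{mₖ} + αₖ* p̂^{mₖ} Pₖ(x̂))`. -/
def hHat (n γ : ℕ) (a b : ℝ) (α : Fin (2 ^ γ) → ℂ) (P : Fin (2 ^ γ) → Polynomial ℝ)
    (m : Fin (2 ^ γ) → ℕ) : Matrix (Fin (2 ^ n)) (Fin (2 ^ n)) ℂ :=
  ∑ k, (α k • termPX n a b (P k) (m k) + (starRingEnd ℂ) (α k) • termXP n a b (P k) (m k))

/-- `P` has degree `q`, has only monomials of the parity of `q`, and `|P| < 1` on `[-1, 1]`. -/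
def IsAdmissible (q : ℕ) (P : Polynomial ℝ) : Prop :=
  P.natDegree = q ∧ (∀ d, P.coeff d ≠ 0 → d % 2 = q % 2) ∧
    ∀ x ∈ Set.Icc (-1 : ℝ) 1, |P.eval x| < 1

/-- `l = ⌈log₂ (m + 1)⌉`, so that the sparsity `m + 1` of `p̂^m` is at most `2 ^ l`. -/
def logSparsity (m : ℕ) : ℕ := Nat.clog 2 (m + 1)

/-- `𝒩_H = 2 ∑ₖ |αₖ| √(2^{lₖ} 𝒩_{p^{mₖ}})`; here `Np m` is the constant `𝒩_{p^m}`. -/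
def normH (γ : ℕ) (Np : ℕ → ℝ) (α : Fin (2 ^ γ) → ℂ) (m : Fin (2 ^ γ) → ℕ) : ℝ :=
  2 * ∑ k, ‖α k‖ * Real.sqrt (2 ^ logSparsity (m k) * Np (m k))

/-! ### Block-encoding auxiliaries -/

/-- The basis vector `|x⟩`. -/
def ket {ι : Type} [DecidableEq ι] (x : ι) : ι → ℂ := Pi.single x 1

/-- The matrix `A`, acting on a flag register `F`, a row register and a column register, maps
`∑ⱼ σⱼ |0⟩|0⟩|j⟩` to `c ∑ᵢⱼ Mᵢⱼ σⱼ |0⟩|i⟩|j⟩` plus a vector that is orthogonal to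
`|0⟩|i⟩|j⟩` for all `i`, `j`. (Zero entries of `M` do not contribute to the sum.) -/
def EncodesEntries {F : Type} [Fintype F] [DecidableEq F] [Zero F] {n : ℕ} (c : ℂ)
    (M : Matrix (Fin (2 ^ n)) (Fin (2 ^ n)) ℂ)
    (A : Matrix (F × (Fin (2 ^ n) × Fin (2 ^ n))) (F × (Fin (2 ^ n) × Fin (2 ^ n))) ℂ) : Prop :=
  ∀ σ : Fin (2 ^ n) → ℂ, ∃ r : F × (Fin (2 ^ n) × Fin (2 ^ n)) → ℂ,
    (∀ i j, r (0, (i, j)) = 0) ∧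
    A *ᵥ (∑ j, σ j • ket (0, (0, j))) = c • (∑ i, ∑ j, (M i j * σ j) • ket (0, (i, j))) + r

/-- The index set of one flag register of 3 qubits and of the row and column registers. -/
abbrev TermIdx (n : ℕ) : Type := Fin (2 ^ 3) × (Fin (2 ^ n) × Fin (2 ^ n))

/-- `A` is a one-term auxiliary for `M = P(x̂) p̂^m` or `M = p̂^m P(x̂)`: a unitary that encodes the
entries of `M` with the factor `(-i)^m / √(2^l 𝒩_{p^m})`. -/
def IsOneTermAux {n : ℕ} (Np : ℕ → ℝ) (m : ℕ) (M : Matrix (Fin (2 ^ n)) (Fin (2 ^ n)) ℂ)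
    (A : Matrix (TermIdx n) (TermIdx n) ℂ) : Prop :=
  A ∈ Matrix.unitaryGroup (TermIdx n) ℂ ∧
    EncodesEntries ((-Complex.I) ^ m / (Real.sqrt (2 ^ logSparsity m * Np m) : ℂ)) M A

/-- The multi-control operator `C^b_U = |b⟩⟨b| ⊗ U + ∑_{i ≠ b} |i⟩⟨i| ⊗ I`. -/
def multiControl {K ι : Type} [Fintype K] [DecidableEq K] [DecidableEq ι] (b : K)
    (U : Matrix ι ι ℂ) : Matrix (K × ι) (K × ι) ℂ :=
  Matrix.single b b (1 : ℂ) ⊗ₖ U +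
    ∑ i ∈ Finset.univ.erase b, Matrix.single i i (1 : ℂ) ⊗ₖ (1 : Matrix ι ι ℂ)

/-- The index `k` of the coefficient register of `γ + 1` qubits. -/
def lowIdx {γ : ℕ} (k : Fin (2 ^ γ)) : Fin (2 ^ (γ + 1)) :=
  ⟨k, by have := k.2; rw [pow_succ]; omega⟩

/-- The index `k + 2 ^ γ` of the coefficient register of `γ + 1` qubits. -/
def highIdx {γ : ℕ} (k : Fin (2 ^ γ)) : Fin (2 ^ (γ + 1)) :=
  ⟨k + 2 ^ γ, by have := k.2; rw [pow_succ]; omega⟩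

/-- `U` is a coefficient-preparation unitary: it maps `|0⟩` to
`𝒩_H^{-1/2} ∑ₖ (2^{lₖ} 𝒩_{p^{mₖ}})^{1/4} (√(i^{mₖ} αₖ) |k⟩ + √(i^{mₖ} αₖ*) |k + 2^γ⟩)`,
with principal square roots. -/
def IsCoeffPrep (γ : ℕ) (Np : ℕ → ℝ) (α : Fin (2 ^ γ) → ℂ) (m : Fin (2 ^ γ) → ℕ)
    (U : Matrix (Fin (2 ^ (γ + 1))) (Fin (2 ^ (γ + 1))) ℂ) : Prop :=
  U ∈ Matrix.unitaryGroup (Fin (2 ^ (γ + 1))) ℂ ∧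
    U *ᵥ ket 0 = ((1 / Real.sqrt (normH γ Np α m) : ℝ) : ℂ) •
      ∑ k, (((2 ^ logSparsity (m k) * Np (m k)) ^ (1 / 4 : ℝ) : ℝ) : ℂ) •
        (((Complex.I ^ m k * α k) ^ (1 / 2 : ℂ)) • ket (lowIdx k) +
          ((Complex.I ^ m k * (starRingEnd ℂ) (α k)) ^ (1 / 2 : ℂ)) • ket (highIdx k))

/-- The index set of the registers of `A_H`: `γ + 1` coefficient qubits and 3 further qubits
(together the flags), the row register and the column register. -/
abbrev AuxIdx (n γ : ℕ) : Type :=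
  (Fin (2 ^ (γ + 1)) × Fin (2 ^ 3)) × (Fin (2 ^ n) × Fin (2 ^ n))

/-- The linear combination of unitaries
`A_H = (Uᵀ ⊗ I) (∏ₖ C^{k + 2^γ}_{Bₖ}) (∏ₖ C^k_{Aₖ}) (U ⊗ I)`. -/
def lcuAux {n γ : ℕ} (U : Matrix (Fin (2 ^ (γ + 1))) (Fin (2 ^ (γ + 1))) ℂ)
    (A B : Fin (2 ^ γ) → Matrix (TermIdx n) (TermIdx n) ℂ) :
    Matrix (AuxIdx n γ) (AuxIdx n γ) ℂ :=
  ((Uᵀ ⊗ₖ (1 : Matrix (TermIdx n) (TermIdx n) ℂ)) *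
      (List.ofFn fun k => multiControl (highIdx k) (B k)).prod *
      (List.ofFn fun k => multiControl (lowIdx k) (A k)).prod *
      (U ⊗ₖ (1 : Matrix (TermIdx n) (TermIdx n) ℂ))).submatrix
    (Equiv.prodAssoc _ _ _) (Equiv.prodAssoc _ _ _)

/-- The `2n + γ + 4` qubits on which `A_H` acts. -/
abbrev AuxQubits (n γ : ℕ) : Type := (Fin (γ + 1) ⊕ Fin 3) ⊕ (Fin n ⊕ Fin n)

/-- Bit strings on the qubits of `A_H` as (binary) contents of its registers. -/
def decode (n γ : ℕ) : (AuxQubits n γ → Fin 2) ≃ AuxIdx n γ :=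
  (Equiv.sumArrowEquivProdArrow _ _ _).trans
    (Equiv.prodCongr
      ((Equiv.sumArrowEquivProdArrow _ _ _).trans
        (Equiv.prodCongr finFunctionFinEquiv finFunctionFinEquiv))
      ((Equiv.sumArrowEquivProdArrow _ _ _).trans
        (Equiv.prodCongr finFunctionFinEquiv finFunctionFinEquiv)))

end QBlock

end

/-! Encoding. The first column of `U` carries square roots of the coefficients. Because the last
factor is `Uᵀ` and not the adjoint, they get squared: the block of the `k`-th term has weight `√(2^l
Np) i^m α / 𝒩_H`, and the factor `(-i)^m / √(2^l Np)` of the auxiliary turns this into `α / 𝒩_H`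
(`coeff_mul`, `encodesEntries_lcuAux`). Unitarity is inherited from the factors.

One term. The entries of `p̂^m` are `(-i)^m` times a real function of `i - j`, supported on shifts
`u` with `|u| ≤ m` and `u ≡ m` mod 2; these are at most `m + 1 ≤ 2^l` shifts. An auxiliary puts `min
l (n - 1)` row qubits into uniform superposition and rotates a flag so that each pattern has the
amplitude of its shift (`exists_prep`). The pattern is expanded to the shift in two's complement on
the row register (`exists_spread`), and the column index is added to it (`classical_addC`). The
diagonal factor is applied while the upper row qubits are still zero and can serve as workspace. For
`P(x̂) p̂^m` the column register holds the row index during that time (`exists_bandSpec`).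

Polynomials. A grid point is a convex combination of signs, one for each binary digit and two
constant ones. Preparing the weights, applying the signs, unpreparing and reflecting gives a walk
`W` with `W + W⁻¹ = 2x` on states with zero work qubits (`run_walkC_add`). Since `|P| < 1`, the
Fejér–Riesz theorem completes `z^q P((z + 1/z)/2)` to a pair of polynomials of norm one on the unit
circle. Such pairs are products of one-qubit gates and signal steps (`reach_of_norm`), which gives
`W^q P(x)`, and `q` inverse walks remove `W^q` (`exists_signal_gadget`). This needs about `log₂ n`
work qubits. If they are missing, the pattern fills nearly the whole row register, `2^n` is at most
`2 (n + 1) 2^l`, and a rotation multiplexed over the grid is affordable (`exists_gadget`).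

Control. Each term circuit is the identity if its control qubit is off, and it preserves the control
and the carry of the adder. A chain of `γ + 1` ancillas compares the coefficient register with an
index, its last member being the control (`exists_control`). With the carry this makes `γ + 2 ≤ 2n +
γ - 1` ancillas, as `n ≥ 2`. -/

noncomputable section

namespace QBlock

/-! ### The action of circuits on states -/

section Run

variable {Q : Type} [Fintype Q] [DecidableEq Q]

/-- The action of a circuit on a state. -/
def run (C : Circuit Q) (ψ : (Q → Fin 2) → ℂ) : (Q → Fin 2) → ℂ := evalCircuit C *ᵥ ψ

theorem run_nil (ψ : (Q → Fin 2) → ℂ) : run [] ψ = ψ := by simp [run, evalCircuit]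

theorem run_cons (g : Gate Q) (C : Circuit Q) (ψ : (Q → Fin 2) → ℂ) :
    run (g :: C) ψ = run C (g.mat *ᵥ ψ) := by simp [run, evalCircuit]

theorem run_append (C D : Circuit Q) (ψ : (Q → Fin 2) → ℂ) :
    run (C ++ D) ψ = run D (run C ψ) := by
  induction C generalizing ψ with
  | nil => simp [run_nil]
  | cons g C ih => simp [run_cons, ih]

theorem evalCircuit_append (C D : Circuit Q) :
    evalCircuit (C ++ D) = evalCircuit D * evalCircuit C := by
  induction C with
  | nil => simp [evalCircuit]
  | cons g C ih => simp [evalCircuit, ih, mul_assoc]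

theorem run_add (C : Circuit Q) (ψ φ : (Q → Fin 2) → ℂ) :
    run C (ψ + φ) = run C ψ + run C φ := by simp [run, mulVec_add]

theorem run_zero (C : Circuit Q) : run C 0 = 0 := by simp [run]

/-- Only the two strings that agree with `x` off `t` contribute to row `x`. With this and its C-NOT
analogue, circuits are computed pointwise, without matrices. -/
theorem single_mulVec (t : Q) (u : unitaryGroup (Fin 2) ℂ) (ψ : (Q → Fin 2) → ℂ)
    (x : Q → Fin 2) :
    ((Gate.single t u).mat *ᵥ ψ) x =
      (u : Matrix (Fin 2) (Fin 2) ℂ) (x t) 0 * ψ (Function.update x t 0) +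
        (u : Matrix (Fin 2) (Fin 2) ℂ) (x t) 1 * ψ (Function.update x t 1) := by
  have key : ∑ b : Fin 2, (u : Matrix (Fin 2) (Fin 2) ℂ) (x t) b * ψ (Function.update x t b) =
      ((Gate.single t u).mat *ᵥ ψ) x := by
    refine Fintype.sum_of_injective (fun b => Function.update x t b)
      (Function.update_injective x t) _ _ ?_ ?_
    · intro y hy
      have : ¬ ∀ s, s ≠ t → x s = y s := by
        intro h
        apply hy
        refine ⟨y t, ?_⟩
        funext s
        by_cases hs : s = t
        · subst hs; simp
        · simp [hs, h s hs]
      simp [Gate.mat, this]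
    · intro b
      have : ∀ s, s ≠ t → x s = Function.update x t b s := by
        intro s hs; simp [hs]
      simp only [Gate.mat, of_apply]
      rw [if_pos this, Function.update_self]
  rw [← key, Fin.sum_univ_two]

theorem fin2_add_add_cancel (a b : Fin 2) : a + b + b = a := by
  revert a b; decide

theorem cnot_mulVec (c t : Q) (h : c ≠ t) (ψ : (Q → Fin 2) → ℂ) (x : Q → Fin 2) :
    ((Gate.cnot c t h).mat *ᵥ ψ) x = ψ (Function.update x t (x t + x c)) := by
  simp only [Gate.mat, mulVec, dotProduct, of_apply, ite_mul, one_mul, zero_mul]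
  rw [Finset.sum_eq_single (Function.update x t (x t + x c))]
  · rw [if_pos]
    simp [h, fin2_add_add_cancel]
  · intro y _ hy
    rw [if_neg]
    rintro rfl
    apply hy
    simp [h, fin2_add_add_cancel]
  · simp

/-! ### Gate counts -/

theorem oneQubitCount_append {Q : Type} (C D : Circuit Q) :
    oneQubitCount (C ++ D) = oneQubitCount C + oneQubitCount D := by
  induction C with
  | nil => simp [oneQubitCount]
  | cons g C ih => cases g <;> simp [oneQubitCount, ih]; omega

theorem cnotCount_append {Q : Type} (C D : Circuit Q) :
    cnotCount (C ++ D) = cnotCount C + cnotCount D := by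
  induction C with
  | nil => simp [cnotCount]
  | cons g C ih => cases g <;> simp [cnotCount, ih]; omega

/-- The circuit has at most `s` one-qubit gates and at most `c` C-NOTs. -/
def CostLE {Q : Type} (C : Circuit Q) (s c : ℕ) : Prop := oneQubitCount C ≤ s ∧ cnotCount C ≤ c

theorem CostLE.append {Q : Type} {C D : Circuit Q} {s c s' c' : ℕ} (h : CostLE C s c)
    (h' : CostLE D s' c') : CostLE (C ++ D) (s + s') (c + c') := by
  simp only [CostLE, oneQubitCount_append, cnotCount_append] at *
  omega

theorem CostLE.mono {Q : Type} {C : Circuit Q} {s c s' c' : ℕ} (h : CostLE C s c)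
    (hs : s ≤ s') (hc : c ≤ c') : CostLE C s' c' := by
  simp only [CostLE] at *
  omega

theorem CostLE.nil {Q : Type} : CostLE ([] : Circuit Q) 0 0 := ⟨le_rfl, le_rfl⟩

theorem CostLE.single {Q : Type} (t : Q) (u : unitaryGroup (Fin 2) ℂ) :
    CostLE [Gate.single t u] 1 0 := ⟨le_rfl, le_rfl⟩

theorem CostLE.flatMap {Q ι : Type} (L : List ι) (f : ι → Circuit Q) (s c : ℕ)
    (h : ∀ i ∈ L, CostLE (f i) s c) : CostLE (L.flatMap f) (L.length * s) (L.length * c) := by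
  induction L with
  | nil => exact CostLE.nil.mono (by simp) (by simp)
  | cons a L ih =>
    rw [List.flatMap_cons]
    refine ((h a (by simp)).append (ih fun i hi => h i (by simp [hi]))).mono ?_ ?_ <;>
      simp [List.length_cons, add_mul] <;> omega

/-! ### Inverse and transposed circuits -/

/-- The inverse gate. -/
def Gate.inv {Q : Type} : Gate Q → Gate Q
  | .single t u => .single t u⁻¹
  | .cnot c t h => .cnot c t h

/-- The inverse circuit. -/
def invC {Q : Type} (C : Circuit Q) : Circuit Q := (C.map Gate.inv).reverse

theorem invC_append {Q : Type} (C D : Circuit Q) : invC (C ++ D) = invC D ++ invC C := by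
  simp [invC]

theorem invC_cons {Q : Type} (g : Gate Q) (C : Circuit Q) : invC (g :: C) = invC C ++ [g.inv] := by
  simp [invC]

theorem invC_invC {Q : Type} (C : Circuit Q) : invC (invC C) = C := by
  have : ∀ g : Gate Q, g.inv.inv = g := by intro g; cases g <;> simp [Gate.inv]
  simp [invC, Function.comp_def, this]

theorem CostLE.inv {Q : Type} {C : Circuit Q} {s c : ℕ} (h : CostLE C s c) :
    CostLE (invC C) s c := by
  have : ∀ C : Circuit Q, oneQubitCount (invC C) = oneQubitCount C ∧
      cnotCount (invC C) = cnotCount C := by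
    intro C
    induction C with
    | nil => simp [invC]
    | cons g C ih =>
      rw [invC_cons, oneQubitCount_append, cnotCount_append, ih.1, ih.2]
      cases g <;> simp [Gate.inv, oneQubitCount, cnotCount]
  simp only [CostLE, this]
  exact h

theorem Gate.mat_inv (g : Gate Q) : g.inv.mat = star g.mat := by
  cases g with
  | single t u =>
    ext x y
    simp only [Gate.inv, Gate.mat, of_apply, star_apply]
    have : (∀ s, s ≠ t → x s = y s) ↔ (∀ s, s ≠ t → y s = x s) :=
      forall₂_congr fun s _ => eq_comm
    by_cases h : ∀ s, s ≠ t → x s = y s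
    · rw [if_pos h, if_pos (this.1 h)]
      rfl
    · rw [if_neg h, if_neg (fun h' => h (this.2 h')), star_zero]
  | cnot c t h =>
    ext x y
    simp only [Gate.inv, Gate.mat, of_apply, star_apply]
    -- A C-NOT is an involution of the basis states, so its matrix is symmetric.
    have key : ∀ x y : Q → Fin 2, x = Function.update y t (y t + y c) →
        y = Function.update x t (x t + x c) := by
      rintro x y rfl
      simp [h, fin2_add_add_cancel]
    by_cases h1 : x = Function.update y t (y t + y c)
    · rw [if_pos h1, if_pos (key x y h1), star_one]
    · rw [if_neg h1, if_neg (fun h' => h1 (key y x h')), star_zero]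

theorem Gate.inv_mul (g : Gate Q) (ψ : (Q → Fin 2) → ℂ) :
    g.inv.mat *ᵥ (g.mat *ᵥ ψ) = ψ := by
  cases g with
  | single t u =>
    funext x
    rw [Gate.inv, single_mulVec, single_mulVec, single_mulVec]
    have hu : ((u⁻¹ : unitaryGroup (Fin 2) ℂ) : Matrix (Fin 2) (Fin 2) ℂ) *
        (u : Matrix (Fin 2) (Fin 2) ℂ) = 1 := by
      rw [← UnitaryGroup.mul_val, inv_mul_cancel, UnitaryGroup.one_val]
    generalize ((u⁻¹ : unitaryGroup (Fin 2) ℂ) : Matrix (Fin 2) (Fin 2) ℂ) = v at hu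
    have h0 := congrFun (congrFun hu (x t)) 0
    have h1 := congrFun (congrFun hu (x t)) 1
    simp only [mul_apply, Fin.sum_univ_two] at h0 h1
    simp only [Function.update_self, Function.update_idem]
    have : ψ x = (1 : Matrix (Fin 2) (Fin 2) ℂ) (x t) 0 * ψ (Function.update x t 0) +
        (1 : Matrix (Fin 2) (Fin 2) ℂ) (x t) 1 * ψ (Function.update x t 1) := by
      have h2 : x t = 0 ∨ x t = 1 := by generalize x t = b; revert b; decide
      rcases h2 with h2 | h2
      · have : Function.update x t 0 = x := by rw [← h2]; simp
        simp [h2, this, one_apply]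
      · have : Function.update x t 1 = x := by rw [← h2]; simp
        simp [h2, this, one_apply]
    rw [this, ← h0, ← h1]
    ring
  | cnot c t h =>
    funext x
    rw [Gate.inv, cnot_mulVec, cnot_mulVec]
    simp [h, fin2_add_add_cancel]

theorem run_invC_run (C : Circuit Q) (ψ : (Q → Fin 2) → ℂ) : run (invC C) (run C ψ) = ψ := by
  induction C generalizing ψ with
  | nil => simp [invC, run_nil]
  | cons g C ih => rw [invC_cons, run_append, run_cons g C, ih, run_cons, run_nil, Gate.inv_mul]

theorem run_run_invC (C : Circuit Q) (ψ : (Q → Fin 2) → ℂ) : run C (run (invC C) ψ) = ψ := by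
  have := run_invC_run (invC C) ψ
  rwa [invC_invC] at this

theorem evalCircuit_invC (C : Circuit Q) : evalCircuit (invC C) = star (evalCircuit C) := by
  induction C with
  | nil => simp [invC, evalCircuit]
  | cons g C ih => rw [invC_cons, evalCircuit_append]; simp [evalCircuit, ih, Gate.mat_inv]

theorem evalCircuit_mem_unitaryGroup (C : Circuit Q) :
    evalCircuit C ∈ unitaryGroup (Q → Fin 2) ℂ := by
  rw [mem_unitaryGroup_iff', ← evalCircuit_invC]
  apply Matrix.ext_of_mulVec_single
  intro i
  rw [← mulVec_mulVec, one_mulVec]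
  exact run_invC_run C (Pi.single i 1)

theorem transpose_mem_unitaryGroup {ι : Type*} [Fintype ι] [DecidableEq ι] {u : Matrix ι ι ℂ}
    (hu : u ∈ unitaryGroup ι ℂ) : uᵀ ∈ unitaryGroup ι ℂ := by
  have := congrArg transpose (mem_unitaryGroup_iff'.1 hu)
  rw [transpose_mul, transpose_one] at this
  exact mem_unitaryGroup_iff.2 this

/-- The transposed gate. -/
def Gate.tr {Q : Type} : Gate Q → Gate Q
  | .single t u => .single t ⟨(u : Matrix (Fin 2) (Fin 2) ℂ)ᵀ,
      transpose_mem_unitaryGroup u.2⟩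
  | .cnot c t h => .cnot c t h

/-- The transposed circuit. -/
def trC {Q : Type} (C : Circuit Q) : Circuit Q := (C.map Gate.tr).reverse

theorem Gate.mat_tr (g : Gate Q) : g.tr.mat = g.matᵀ := by
  cases g with
  | single t u =>
    ext x y
    simp only [Gate.tr, Gate.mat, of_apply, transpose_apply]
    have : (∀ s, s ≠ t → x s = y s) ↔ (∀ s, s ≠ t → y s = x s) :=
      forall₂_congr fun s _ => eq_comm
    by_cases h : ∀ s, s ≠ t → x s = y s
    · rw [if_pos h, if_pos (this.1 h)]
    · rw [if_neg h, if_neg (fun h' => h (this.2 h'))]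
  | cnot c t h =>
    have := Gate.mat_inv (Gate.cnot c t h)
    have h2 : (Gate.cnot c t h).tr.mat = (Gate.cnot c t h).inv.mat := rfl
    rw [h2, this]
    ext x y
    simp only [Gate.mat, of_apply, star_apply, transpose_apply]
    split_ifs <;> simp

theorem trC_cons {Q : Type} (g : Gate Q) (C : Circuit Q) : trC (g :: C) = trC C ++ [g.tr] := by
  simp [trC]

theorem evalCircuit_trC (C : Circuit Q) : evalCircuit (trC C) = (evalCircuit C)ᵀ := by
  induction C with
  | nil => simp [trC, evalCircuit]
  | cons g C ih => rw [trC_cons, evalCircuit_append]; simp [evalCircuit, ih, Gate.mat_tr]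

theorem CostLE.tr {Q : Type} {C : Circuit Q} {s c : ℕ} (h : CostLE C s c) :
    CostLE (trC C) s c := by
  have : ∀ C : Circuit Q, oneQubitCount (trC C) = oneQubitCount C ∧
      cnotCount (trC C) = cnotCount C := by
    intro C
    induction C with
    | nil => simp [trC]
    | cons g C ih =>
      rw [trC_cons, oneQubitCount_append, cnotCount_append, ih.1, ih.2]
      cases g <;> simp [Gate.tr, oneQubitCount, cnotCount]
  simp only [CostLE, this]
  exact h

/-! ### Relabelling of qubits -/

/-- The gate on relabelled qubits. -/
def Gate.map {Q Q' : Type} (f : Q ↪ Q') : Gate Q → Gate Q'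
  | .single t u => .single (f t) u
  | .cnot c t h => .cnot (f c) (f t) (fun e => h (f.injective e))

/-- The circuit on relabelled qubits. -/
def mapC {Q Q' : Type} (f : Q ↪ Q') (C : Circuit Q) : Circuit Q' := C.map (Gate.map f)

theorem CostLE.map {Q Q' : Type} (f : Q ↪ Q') {C : Circuit Q} {s c : ℕ} (h : CostLE C s c) :
    CostLE (mapC f C) s c := by
  have : ∀ C : Circuit Q, oneQubitCount (mapC f C) = oneQubitCount C ∧
      cnotCount (mapC f C) = cnotCount C := by
    intro C
    induction C with
    | nil => simp [mapC, oneQubitCount, cnotCount]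
    | cons g C ih =>
      rw [mapC] at *
      cases g <;> simp [Gate.map, oneQubitCount, cnotCount, ih.1, ih.2]
  simp only [CostLE, this]
  exact h

theorem extend_update {Q Q' : Type} [DecidableEq Q] [DecidableEq Q'] (f : Q ↪ Q')
    (y : Q → Fin 2) (x : Q' → Fin 2) (t : Q) (b : Fin 2) :
    Function.extend f (Function.update y t b) x =
      Function.update (Function.extend f y x) (f t) b := by
  funext q
  by_cases h : ∃ p, f p = q
  · obtain ⟨p, rfl⟩ := h
    rw [f.injective.extend_apply]
    by_cases hp : p = t
    · subst hp; simp
    · have : f p ≠ f t := fun e => hp (f.injective e)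
      rw [Function.update_of_ne hp, Function.update_of_ne this, f.injective.extend_apply]
  · rw [Function.extend_apply' _ _ _ h, Function.update_of_ne, Function.extend_apply' _ _ _ h]
    rintro rfl
    exact h ⟨t, rfl⟩

/-- Freezing the bits outside the range of `f` to those of `x` gives a slice of the state, and a
relabelled gate acts on each slice separately. -/
theorem run_mapC {Q' : Type} [Fintype Q'] [DecidableEq Q'] (f : Q ↪ Q') (C : Circuit Q)
    (ψ : (Q' → Fin 2) → ℂ) (x : Q' → Fin 2) (y : Q → Fin 2) :
    run (mapC f C) ψ (Function.extend f y x) = run C (fun y => ψ (Function.extend f y x)) y := by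
  induction C generalizing ψ with
  | nil => simp [mapC, run_nil]
  | cons g C ih =>
    have : mapC f (g :: C) = g.map f :: mapC f C := rfl
    rw [this, run_cons, run_cons, ih]
    congr 1
    funext y
    cases g with
    | single t u =>
      rw [Gate.map, single_mulVec, single_mulVec, extend_update, extend_update,
        f.injective.extend_apply]
    | cnot c t h =>
      rw [Gate.map, cnot_mulVec, cnot_mulVec, extend_update,
        f.injective.extend_apply, f.injective.extend_apply]

/-! ### Qubits that a circuit does not change -/

/-- The qubit that a gate may change. -/
def Gate.target {Q : Type} : Gate Q → Q
  | .single t _ => t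
  | .cnot _ t _ => t

/-- All targets of the gates of the circuit satisfy `S`. -/
def TargetsIn {Q : Type} (S : Q → Prop) (C : Circuit Q) : Prop := ∀ g ∈ C, S g.target

theorem TargetsIn.append {Q : Type} {S : Q → Prop} {C D : Circuit Q} (h : TargetsIn S C)
    (h' : TargetsIn S D) : TargetsIn S (C ++ D) := by
  intro g hg
  rcases List.mem_append.1 hg with hg | hg
  · exact h g hg
  · exact h' g hg

theorem TargetsIn.mono {Q : Type} {S S' : Q → Prop} {C : Circuit Q} (h : TargetsIn S C)
    (hS : ∀ q, S q → S' q) : TargetsIn S' C := fun g hg => hS _ (h g hg)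

/-- Qubits outside `S` occur only as controls, so a function of them passes through every gate. -/
theorem run_mul {S : Q → Prop} {C : Circuit Q} (hC : TargetsIn S C) (h : (Q → Fin 2) → ℂ)
    (hh : ∀ t, S t → ∀ x b, h (Function.update x t b) = h x) (ψ : (Q → Fin 2) → ℂ) :
    run C (fun x => h x * ψ x) = fun x => h x * run C ψ x := by
  induction C generalizing ψ with
  | nil => simp [run_nil]
  | cons g C ih =>
    rw [run_cons, run_cons, ← ih (fun g hg => hC g (by simp [hg]))]
    congr 1
    have hg := hh _ (hC g (by simp))
    funext x
    cases g with
    | single t u =>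
      simp only [Gate.target] at hg
      rw [single_mulVec, single_mulVec, hg, hg]
      ring
    | cnot c t h =>
      simp only [Gate.target] at hg
      rw [cnot_mulVec, cnot_mulVec, hg]

/-- The gate does not involve the qubit `q`. -/
def Gate.Avoids {Q : Type} (q : Q) : Gate Q → Prop
  | .single t _ => t ≠ q
  | .cnot c t _ => c ≠ q ∧ t ≠ q

/-- Both slices of the qubit `q` undergo the same evolution. This keeps states independent of the
signal flag under weight preparation. -/
theorem run_update {q : Q} {C : Circuit Q} (hC : ∀ g ∈ C, Gate.Avoids q g) (b : Fin 2)
    (ψ : (Q → Fin 2) → ℂ) :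
    run C (fun x => ψ (Function.update x q b)) = fun x => run C ψ (Function.update x q b) := by
  induction C generalizing ψ with
  | nil => simp [run_nil]
  | cons g C ih =>
    rw [run_cons, run_cons, ← ih (fun g hg => hC g (by simp [hg]))]
    congr 1
    have hg := hC g (by simp)
    funext x
    cases g with
    | single t u =>
      simp only [Gate.Avoids] at hg
      rw [single_mulVec, single_mulVec, Function.update_of_ne hg, Function.update_comm hg,
        Function.update_comm hg]
    | cnot c t h =>
      simp only [Gate.Avoids] at hg
      rw [cnot_mulVec, cnot_mulVec, Function.update_of_ne hg.1, Function.update_of_ne hg.2,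
        Function.update_comm hg.2]

end Run

end QBlock

end

noncomputable section

namespace QBlock

/-! ### Multiplexed rotations and diagonal gates -/

section Primitives

set_option linter.unusedSectionVars false

variable {Q : Type} [Fintype Q] [DecidableEq Q]

theorem fin2_cases (b : Fin 2) : b = 0 ∨ b = 1 := by revert b; decide

/-- The function depends on the bits in `L` only. -/
def BitsIn {Q β : Type} (L : List Q) (f : (Q → Fin 2) → β) : Prop :=
  ∀ x y, (∀ q ∈ L, x q = y q) → f x = f y

theorem BitsIn.update {Q β : Type} [DecidableEq Q] {L : List Q} {f : (Q → Fin 2) → β}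
    (h : BitsIn L f) {t : Q} (ht : t ∉ L) (x : Q → Fin 2) (b : Fin 2) :
    f (Function.update x t b) = f x := by
  apply h
  intro q hq
  rw [Function.update_of_ne]
  rintro rfl
  exact ht hq

/-- The half sums and half differences of the two restrictions are the angles in the recursions that
follow; they no longer depend on `c`. -/
theorem BitsIn.subst {Q β γ : Type} [DecidableEq Q] {c : Q} {L : List Q} {f : (Q → Fin 2) → β}
    (h : BitsIn (c :: L) f) (F : β → β → γ) :
    BitsIn L (fun x => F (f (Function.update x c 0)) (f (Function.update x c 1))) := by
  intro x y hxy
  have : ∀ b, f (Function.update x c b) = f (Function.update y c b) := by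
    intro b
    apply h
    intro q hq
    by_cases hqc : q = c
    · subst hqc; simp
    · rw [Function.update_of_ne hqc, Function.update_of_ne hqc]
      exact hxy q ((List.mem_cons.1 hq).resolve_left hqc)
  simp only [this]

/-- The one-qubit gate `diag(e^{ia}, e^{ib})`. -/
def phaseU (a b : ℝ) : unitaryGroup (Fin 2) ℂ :=
  ⟨diagonal ![Complex.exp (a * Complex.I), Complex.exp (b * Complex.I)], by
    rw [mem_unitaryGroup_iff, star_eq_conjTranspose, diagonal_conjTranspose, diagonal_mul_diagonal,
      ← diagonal_one]
    congr 1
    funext i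
    fin_cases i <;> simp [← Complex.exp_conj, ← Complex.exp_add]⟩

theorem phaseU_mulVec (t : Q) (a b : ℝ) (ψ : (Q → Fin 2) → ℂ) (x : Q → Fin 2) :
    ((Gate.single t (phaseU a b)).mat *ᵥ ψ) x =
      Complex.exp ((if x t = 0 then a else b : ℝ) * Complex.I) * ψ x := by
  rw [single_mulVec]
  rcases fin2_cases (x t) with h | h
  · have : Function.update x t 0 = x := by rw [← h]; simp
    simp [phaseU, h, this]
  · have : Function.update x t 1 = x := by rw [← h]; simp
    simp [phaseU, h, this]

/-- The one-qubit gate `1/√2 (1, 1; -i, i)`. -/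
def kU : unitaryGroup (Fin 2) ℂ :=
  ⟨!![(Real.sqrt (1 / 2) : ℂ), (Real.sqrt (1 / 2) : ℂ);
      -Complex.I * (Real.sqrt (1 / 2) : ℂ), Complex.I * (Real.sqrt (1 / 2) : ℂ)], by
    have h : (Real.sqrt (1 / 2) : ℂ) * (Real.sqrt (1 / 2) : ℂ) = 1 / 2 := by
      rw [← Complex.ofReal_mul, Real.mul_self_sqrt (by norm_num)]; norm_num
    generalize hs : (Real.sqrt (1 / 2) : ℝ) = s at *
    rw [mem_unitaryGroup_iff]
    ext i j
    fin_cases i <;> fin_cases j <;> simp [mul_apply, Fin.sum_univ_two] <;>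
      first
        | linear_combination 2 * h
        | linear_combination 2 * h - 2 * (s : ℂ) * s * Complex.I_mul_I⟩

/-- The Hadamard gate. -/
def hU : unitaryGroup (Fin 2) ℂ :=
  ⟨!![(Real.sqrt (1 / 2) : ℂ), (Real.sqrt (1 / 2) : ℂ);
      (Real.sqrt (1 / 2) : ℂ), -(Real.sqrt (1 / 2) : ℂ)], by
    have h : (Real.sqrt (1 / 2) : ℂ) * (Real.sqrt (1 / 2) : ℂ) = 1 / 2 := by
      rw [← Complex.ofReal_mul, Real.mul_self_sqrt (by norm_num)]; norm_num
    generalize hs : (Real.sqrt (1 / 2) : ℝ) = s at *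
    rw [mem_unitaryGroup_iff]
    ext i j
    fin_cases i <;> fin_cases j <;> simp [mul_apply, Fin.sum_univ_two] <;>
      linear_combination 2 * h⟩

theorem sqrt_half_mul : (Real.sqrt (1 / 2) : ℂ) * (Real.sqrt (1 / 2) : ℂ) = 1 / 2 := by
  rw [← Complex.ofReal_mul, Real.mul_self_sqrt (by norm_num)]; norm_num

/-- A C-NOT if control and target are different. -/
def cx (c t : Q) : Circuit Q := if h : c ≠ t then [Gate.cnot c t h] else []

theorem run_cx {c t : Q} (h : c ≠ t) (ψ : (Q → Fin 2) → ℂ) (x : Q → Fin 2) :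
    run (cx c t) ψ x = ψ (Function.update x t (x t + x c)) := by
  rw [cx, dif_pos h, run_cons, run_nil, cnot_mulVec]

theorem cost_cx (c t : Q) : CostLE (cx c t) 0 1 := by
  rw [cx]; split_ifs <;> simp [CostLE, oneQubitCount, cnotCount]

theorem targets_cx (c t : Q) : TargetsIn (· = t) (cx c t) := by
  intro g hg
  rw [cx] at hg
  split_ifs at hg
  · rw [List.mem_singleton.1 hg]; rfl
  · simp at hg

theorem avoids_cx {c t q : Q} (hc : c ≠ q) (ht : t ≠ q) : ∀ g ∈ cx c t, Gate.Avoids q g := by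
  intro g hg
  rw [cx] at hg
  split_ifs at hg
  · rw [List.mem_singleton.1 hg]; exact ⟨hc, ht⟩
  · simp at hg

/-- The diagonal gate `exp(i θ Z_t)`, with the angle `θ` depending on the qubits in `L`. -/
def muxZ : List Q → Q → ((Q → Fin 2) → ℝ) → Circuit Q
  | [], t, θ => [Gate.single t (phaseU (θ 0) (-θ 0))]
  | c :: L, t, θ =>
    muxZ L t (fun x => (θ (Function.update x c 0) + θ (Function.update x c 1)) / 2) ++
      (cx c t ++ (muxZ L t (fun x => (θ (Function.update x c 0) - θ (Function.update x c 1)) / 2) ++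
        cx c t))

/-- Conjugation by the C-NOT flips the sign of the second angle iff `x c = 1`. So the angles add up
to half sum plus half difference for `x c = 0`, and to half sum minus half difference for `x c = 1`.
-/
theorem run_muxZ {L : List Q} {t : Q} (ht : t ∉ L) {θ : (Q → Fin 2) → ℝ} (hθ : BitsIn L θ)
    (ψ : (Q → Fin 2) → ℂ) (x : Q → Fin 2) :
    run (muxZ L t θ) ψ x = Complex.exp ((if x t = 0 then θ x else -θ x : ℝ) * Complex.I) * ψ x := by
  induction L generalizing θ ψ x with
  | nil =>
    rw [muxZ, run_cons, run_nil, phaseU_mulVec, hθ x 0 (by simp)]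
  | cons c L ih =>
    have htc : c ≠ t := fun e => ht (by simp [e])
    have htL : t ∉ L := fun e => ht (by simp [e])
    have hA := hθ.subst (fun a b => (a + b) / 2)
    have hD := hθ.subst (fun a b => (a - b) / 2)
    have h1 : ∀ ψ x, run (muxZ L t (fun x => (θ (Function.update x c 0) +
      θ (Function.update x c 1)) / 2)) ψ x = _ := fun ψ x => ih htL hA ψ x
    have h2 : ∀ ψ x, run (muxZ L t (fun x => (θ (Function.update x c 0) -
      θ (Function.update x c 1)) / 2)) ψ x = _ := fun ψ x => ih htL hD ψ x
    rw [muxZ, run_append, run_append, run_append, run_cx htc, h2, run_cx htc, h1]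
    have hupd : Function.update (Function.update x t (x t + x c)) t
        (Function.update x t (x t + x c) t + Function.update x t (x t + x c) c) = x := by
      simp [htc, fin2_add_add_cancel]
    rw [hupd, ← mul_assoc, ← Complex.exp_add, ← add_mul, ← Complex.ofReal_add]
    congr 4
    have hu := hD.update htL x (x t + x c)
    simp only [hu, Function.update_self]
    rcases fin2_cases (x c) with hc | hc
    · have hx : Function.update x c 0 = x := by rw [← hc]; simp
      rw [hc, hx, add_zero]
      split_ifs <;> ring
    · have hx : Function.update x c 1 = x := by rw [← hc]; simp
      rw [hc, hx]
      rcases fin2_cases (x t) with h | h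
      · simp [h]; ring
      · simp [h]; ring

theorem cost_muxZ (L : List Q) (t : Q) (θ : (Q → Fin 2) → ℝ) :
    CostLE (muxZ L t θ) (2 ^ L.length) (2 ^ (L.length + 1) - 2) := by
  induction L generalizing θ with
  | nil => exact (CostLE.single _ _).mono (by simp) (by simp)
  | cons c L ih =>
    refine ((ih _).append ((cost_cx c t).append ((ih _).append (cost_cx c t)))).mono ?_ ?_
    · rw [List.length_cons, pow_succ]; omega
    · have := Nat.one_le_two_pow (n := L.length)
      rw [List.length_cons, pow_succ _ (L.length + 1), pow_succ]; omega

theorem targets_muxZ (L : List Q) (t : Q) (θ : (Q → Fin 2) → ℝ) :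
    TargetsIn (· = t) (muxZ L t θ) := by
  induction L generalizing θ with
  | nil =>
    intro g hg
    rw [List.mem_singleton.1 hg]; rfl
  | cons c L ih => exact (ih _).append ((targets_cx c t).append ((ih _).append (targets_cx c t)))

theorem avoids_muxZ {L : List Q} {t q : Q} (hL : q ∉ L) (ht : t ≠ q) (θ : (Q → Fin 2) → ℝ) :
    ∀ g ∈ muxZ L t θ, Gate.Avoids q g := by
  induction L generalizing θ with
  | nil =>
    intro g hg
    rw [List.mem_singleton.1 hg]; exact ht
  | cons c L ih =>
    have h1 : c ≠ q := fun e => hL (by simp [e])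
    have h2 : q ∉ L := fun e => hL (by simp [e])
    intro g hg
    simp only [muxZ, List.mem_append] at hg
    rcases hg with hg | hg | hg | hg
    · exact ih h2 _ g hg
    · exact avoids_cx h1 ht g hg
    · exact ih h2 _ g hg
    · exact avoids_cx h1 ht g hg

/-- The rotation `exp(-i θ Y_t)`, with the angle `θ` depending on the qubits in `L`. -/
def muxY (L : List Q) (t : Q) (θ : (Q → Fin 2) → ℝ) : Circuit Q :=
  Gate.single t kU⁻¹ :: (muxZ L t θ ++ [Gate.single t kU])

/-- The gate `kU` conjugates `Z` to `-Y`, hence `exp(iθZ)` to `exp(-iθY)`, a real rotation. -/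
theorem run_muxY {L : List Q} {t : Q} (ht : t ∉ L) {θ : (Q → Fin 2) → ℝ} (hθ : BitsIn L θ)
    (ψ : (Q → Fin 2) → ℂ) (x : Q → Fin 2) :
    run (muxY L t θ) ψ x =
      if x t = 0 then Real.cos (θ x) * ψ (Function.update x t 0) -
        Real.sin (θ x) * ψ (Function.update x t 1)
      else Real.sin (θ x) * ψ (Function.update x t 0) +
        Real.cos (θ x) * ψ (Function.update x t 1) := by
  have hinv : ((kU⁻¹ : unitaryGroup (Fin 2) ℂ) : Matrix (Fin 2) (Fin 2) ℂ) =
      star (kU : Matrix (Fin 2) (Fin 2) ℂ) := rfl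
  have h := sqrt_half_mul
  rw [muxY, run_cons, run_append, run_cons, run_nil, single_mulVec, run_muxZ ht hθ,
    run_muxZ ht hθ, single_mulVec, single_mulVec, hθ.update ht, hθ.update ht]
  have hk : (kU : Matrix (Fin 2) (Fin 2) ℂ) =
      !![(Real.sqrt (1 / 2) : ℂ), (Real.sqrt (1 / 2) : ℂ);
      -Complex.I * (Real.sqrt (1 / 2) : ℂ), Complex.I * (Real.sqrt (1 / 2) : ℂ)] := rfl
  rw [hinv, hk]
  simp only [star_apply, Function.update_self, Function.update_idem]
  have e1 : Complex.exp ((θ x : ℝ) * Complex.I) =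
      Complex.cos (θ x) + Complex.sin (θ x) * Complex.I := Complex.exp_mul_I _
  have e2 : Complex.exp ((-θ x : ℝ) * Complex.I) =
      Complex.cos (θ x) - Complex.sin (θ x) * Complex.I := by
    rw [Complex.exp_mul_I]; simp; ring
  have hI := Complex.I_mul_I
  generalize hs : (Real.sqrt (1 / 2) : ℝ) = s at *
  rcases fin2_cases (x t) with hx | hx
  · simp [hx] at e1 e2 ⊢
    rw [e1, e2]
    generalize Complex.cos (θ x) = co
    generalize Complex.sin (θ x) = si
    linear_combination (2 * co * ψ (Function.update x t 0) - 2 * si * ψ (Function.update x t 1)) * h +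
      (2 * s * s * si * ψ (Function.update x t 1)) * hI
  · simp [hx] at e1 e2 ⊢
    rw [e1, e2]
    generalize Complex.cos (θ x) = co
    generalize Complex.sin (θ x) = si
    linear_combination (2 * co * ψ (Function.update x t 1) + 2 * si * ψ (Function.update x t 0)) * h -
      (2 * s * s * si * ψ (Function.update x t 0) + 2 * s * s * co * ψ (Function.update x t 1)) * hI

theorem cost_muxY (L : List Q) (t : Q) (θ : (Q → Fin 2) → ℝ) :
    CostLE (muxY L t θ) (2 ^ L.length + 2) (2 ^ (L.length + 1) - 2) := by
  have := (CostLE.single t kU⁻¹).append ((cost_muxZ L t θ).append (CostLE.single t kU))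
  exact this.mono (by omega) (by omega)

theorem targets_muxY (L : List Q) (t : Q) (θ : (Q → Fin 2) → ℝ) :
    TargetsIn (· = t) (muxY L t θ) := by
  intro g hg
  simp only [muxY, List.mem_cons, List.mem_append, List.not_mem_nil, or_false] at hg
  rcases hg with rfl | hg | rfl
  · rfl
  · exact targets_muxZ L t θ g hg
  · rfl

theorem avoids_muxY {L : List Q} {t q : Q} (hL : q ∉ L) (ht : t ≠ q) (θ : (Q → Fin 2) → ℝ) :
    ∀ g ∈ muxY L t θ, Gate.Avoids q g := by
  intro g hg
  simp only [muxY, List.mem_cons, List.mem_append, List.not_mem_nil, or_false] at hg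
  rcases hg with rfl | hg | rfl
  · exact ht
  · exact avoids_muxZ hL ht θ g hg
  · exact ht

/-- The inverse of a multiplexed rotation is the rotation by the opposite angle. -/
theorem run_invC_muxY {L : List Q} {t : Q} (ht : t ∉ L) {θ : (Q → Fin 2) → ℝ} (hθ : BitsIn L θ)
    (ψ : (Q → Fin 2) → ℂ) :
    run (invC (muxY L t θ)) ψ = run (muxY L t (fun x => -θ x)) ψ := by
  have hθ' : BitsIn L (fun x => -θ x) := fun x y h => by simp only [hθ x y h]
  have : run (muxY L t θ) (run (muxY L t (fun x => -θ x)) ψ) = ψ := by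
    funext x
    have hcs := Complex.sin_sq_add_cos_sq (θ x)
    rw [run_muxY ht hθ, run_muxY ht hθ', run_muxY ht hθ', hθ.update ht, hθ.update ht]
    rcases fin2_cases (x t) with hx | hx
    · have hu : Function.update x t 0 = x := by rw [← hx]; simp
      simp [hx, hu]
      linear_combination ψ x * hcs
    · have hu : Function.update x t 1 = x := by rw [← hx]; simp
      simp [hx, hu]
      linear_combination ψ x * hcs
  rw [← run_invC_run (muxY L t θ) (run (muxY L t (fun x => -θ x)) ψ), this]

/-- The diagonal gate with the phases `φ`, which depend on the qubits in `L`. -/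
def diagC (t₀ : Q) : List Q → ((Q → Fin 2) → ℝ) → Circuit Q
  | [], φ => [Gate.single t₀ (phaseU (φ 0) (φ 0))]
  | t :: L, φ =>
    muxZ L t (fun x => (φ (Function.update x t 0) - φ (Function.update x t 1)) / 2) ++
      diagC t₀ L (fun x => (φ (Function.update x t 0) + φ (Function.update x t 1)) / 2)

/-- The phase splits into its mean over the bit `t`, which is left to the recursion, and half the
difference times `Z_t`, a multiplexed rotation. The qubit `t₀` only carries the remaining global
phase. -/
theorem run_diagC (t₀ : Q) {L : List Q} (hL : L.Nodup) {φ : (Q → Fin 2) → ℝ} (hφ : BitsIn L φ)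
    (ψ : (Q → Fin 2) → ℂ) (x : Q → Fin 2) :
    run (diagC t₀ L φ) ψ x = Complex.exp (φ x * Complex.I) * ψ x := by
  induction L generalizing φ ψ with
  | nil =>
    rw [diagC, run_cons, run_nil, phaseU_mulVec, hφ x 0 (by simp), ite_self]
  | cons t L ih =>
    rw [List.nodup_cons] at hL
    rw [diagC, run_append, ih hL.2 (hφ.subst (fun a b => (a + b) / 2)),
      run_muxZ hL.1 (hφ.subst (fun a b => (a - b) / 2)), ← mul_assoc, ← Complex.exp_add,
      ← add_mul, ← Complex.ofReal_add]
    congr 4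
    rcases fin2_cases (x t) with hc | hc
    · have hx : Function.update x t 0 = x := by rw [← hc]; simp
      rw [if_pos hc, hx]; ring
    · have hx : Function.update x t 1 = x := by rw [← hc]; simp
      rw [if_neg (by simp [hc]), hx]; ring

theorem cost_diagC (t₀ : Q) (L : List Q) (φ : (Q → Fin 2) → ℝ) :
    CostLE (diagC t₀ L φ) (2 ^ L.length) (2 ^ (L.length + 1) - 2 - 2 * L.length) := by
  induction L generalizing φ with
  | nil => exact (CostLE.single _ _).mono (by simp) (by simp)
  | cons c L ih =>
    have := Nat.lt_two_pow_self (n := L.length)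
    refine ((cost_muxZ _ _ _).append (ih _)).mono ?_ ?_
    · rw [List.length_cons, pow_succ]; omega
    · rw [List.length_cons, pow_succ _ (L.length + 1), pow_succ]; omega

/-- The Toffoli gate. -/
def tof (a b t : Q) : Circuit Q :=
  Gate.single t hU :: (diagC t [a, b, t]
    (fun x => if x a = 1 ∧ x b = 1 ∧ x t = 1 then Real.pi else 0) ++ [Gate.single t hU])

/-- The phase `-1` on `|111⟩` becomes a flip of `t` when conjugated by the Hadamard gate on `t`. -/
theorem run_tof {a b t : Q} (hab : a ≠ b) (hat : a ≠ t) (hbt : b ≠ t) (ψ : (Q → Fin 2) → ℂ)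
    (x : Q → Fin 2) :
    run (tof a b t) ψ x = ψ (Function.update x t (x t + x a * x b)) := by
  have hb : BitsIn [a, b, t]
      (fun x : Q → Fin 2 => if x a = 1 ∧ x b = 1 ∧ x t = 1 then Real.pi else 0) := by
    intro x y h
    simp only [h a (by simp), h b (by simp), h t (by simp)]
  have hn : [a, b, t].Nodup := by simp [hab, hat, hbt]
  have h := sqrt_half_mul
  rw [tof, run_cons, run_append, run_cons, run_nil, single_mulVec, run_diagC t hn hb,
    run_diagC t hn hb, single_mulVec, single_mulVec]
  simp only [hU, Function.update_self, Function.update_idem]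
  rw [Function.update_of_ne hat, Function.update_of_ne hat, Function.update_of_ne hbt,
    Function.update_of_ne hbt]
  generalize hs : (Real.sqrt (1 / 2) : ℝ) = s at *
  rcases fin2_cases (x t) with hx | hx <;> rcases fin2_cases (x a) with ha | ha <;>
    rcases fin2_cases (x b) with hb | hb <;> simp [hx, ha, hb, Complex.exp_pi_mul_I] <;>
    first
      | linear_combination (2 * ψ (Function.update x t 0)) * h
      | linear_combination (2 * ψ (Function.update x t 1)) * h

theorem cost_tof (a b t : Q) : CostLE (tof a b t) 10 8 := by
  have := (CostLE.single t hU).append ((cost_diagC t [a, b, t]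
    (fun x => if x a = 1 ∧ x b = 1 ∧ x t = 1 then Real.pi else 0)).append (CostLE.single t hU))
  exact this.mono (by simp) (by simp)

end Primitives
end QBlock
end

noncomputable section

namespace QBlock

/-! ### State preparation -/

section Preparation

set_option linter.unusedSectionVars false

variable {Q : Type} [Fintype Q] [DecidableEq Q]

/-- The sum over all values of the bits in `L`. -/
def sumL {β : Type} [Add β] : List Q → ((Q → Fin 2) → β) → (Q → Fin 2) → β
  | [], h => h
  | t :: L, h => sumL L fun x => h (Function.update x t 0) + h (Function.update x t 1)

/-- The bits in `L` are reset to zero. -/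
def zeroL (L : List Q) (x : Q → Fin 2) : Q → Fin 2 := fun q => if q ∈ L then 0 else x q

/-- The number with the binary digits `x q`, `q ∈ L`, the head of the list being the last digit. -/
def val : List Q → (Q → Fin 2) → ℕ
  | [], _ => 0
  | t :: L, x => (x t : ℕ) + 2 * val L x

theorem val_congr {L : List Q} {x y : Q → Fin 2} (h : ∀ q ∈ L, x q = y q) : val L x = val L y := by
  induction L with
  | nil => rfl
  | cons t L ih => rw [val, val, h t (by simp), ih fun q hq => h q (by simp [hq])]

theorem val_update {L : List Q} {t : Q} (ht : t ∉ L) (x : Q → Fin 2) (b : Fin 2) :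
    val L (Function.update x t b) = val L x := by
  apply val_congr
  intro q hq
  rw [Function.update_of_ne]
  rintro rfl
  exact ht hq

theorem val_lt (L : List Q) (x : Q → Fin 2) : val L x < 2 ^ L.length := by
  induction L with
  | nil => simp [val]
  | cons t L ih => rw [val, List.length_cons, pow_succ]; have := (x t).2; omega

theorem sumL_congr {β : Type} [Add β] {L : List Q} {f g : (Q → Fin 2) → β} {x : Q → Fin 2}
    (h : ∀ y, (∀ q, q ∉ L → y q = x q) → f y = g y) : sumL L f x = sumL L g x := by
  induction L generalizing f g with
  | nil => exact h x fun _ _ => rfl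
  | cons t L ih =>
    apply ih
    intro y hy
    have : ∀ b, ∀ q, q ∉ t :: L → Function.update y t b q = x q := by
      intro b q hq
      rw [List.mem_cons, not_or] at hq
      rw [Function.update_of_ne hq.1, hy q hq.2]
    simp only [h _ (this 0), h _ (this 1)]

theorem sumL_val {β : Type} [AddCommMonoid β] {L : List Q} (hL : L.Nodup) (h : ℕ → β)
    (x : Q → Fin 2) :
    sumL L (fun y => h (val L y)) x = ∑ r ∈ Finset.range (2 ^ L.length), h r := by
  induction L generalizing h with
  | nil => simp [sumL, val]
  | cons t L ih =>
    rw [List.nodup_cons] at hL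
    -- The head of the list is the last binary digit, so its two values give the even and the odd
    -- numbers.
    have e : ∀ m (g : ℕ → β), ∑ r ∈ Finset.range (m * 2), g r =
        ∑ r ∈ Finset.range m, (g (2 * r) + g (1 + 2 * r)) := by
      intro m g
      induction m with
      | zero => simp
      | succ m ihm =>
        rw [add_mul, one_mul, Finset.sum_range_succ, Finset.sum_range_succ, ihm,
          Finset.sum_range_succ, add_assoc, mul_comm m 2, add_comm 1]
    rw [List.length_cons, pow_succ, e, ← ih hL.2]
    rw [sumL]
    congr 1
    funext y
    simp [val, val_update hL.1]

/-- A circuit that maps `|0⟩` on the qubits in `L` to the state with the real amplitudes `ρ`. -/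
def prepC : List Q → ((Q → Fin 2) → ℝ) → Circuit Q
  | [], _ => []
  | t :: L, ρ =>
    prepC L (fun x => Real.sqrt (ρ (Function.update x t 0) ^ 2 + ρ (Function.update x t 1) ^ 2)) ++
      muxY L t (fun x => Complex.arg ⟨ρ (Function.update x t 0), ρ (Function.update x t 1)⟩)

/-- Using `Complex.arg` as the angle covers `a = b = 0` as well: both sides vanish, so branches of
zero weight need no case distinction. -/
theorem cos_arg_mul_sqrt (a b : ℝ) :
    Real.cos (Complex.arg ⟨a, b⟩) * Real.sqrt (a ^ 2 + b ^ 2) = a := by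
  have h := Complex.norm_mul_cos_arg ⟨a, b⟩
  rw [mul_comm] at h
  rw [Complex.norm_def, Complex.normSq_mk, ← sq, ← sq] at h
  exact h

theorem sin_arg_mul_sqrt (a b : ℝ) :
    Real.sin (Complex.arg ⟨a, b⟩) * Real.sqrt (a ^ 2 + b ^ 2) = b := by
  have h := Complex.norm_mul_sin_arg ⟨a, b⟩
  rw [mul_comm] at h
  rw [Complex.norm_def, Complex.normSq_mk, ← sq, ← sq] at h
  exact h

/-- The norms of `ρ` over the bit `t` are prepared on the remaining qubits; a rotation of `t` by the
angle of the point `(ρ₀, ρ₁)` distributes each norm. Nonnegativity fixes the sign in the case of the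
empty list. -/
theorem run_prepC {L : List Q} (hL : L.Nodup) {ρ : (Q → Fin 2) → ℝ} (hρ : BitsIn L ρ)
    (h0 : ∀ x, 0 ≤ ρ x) (h1 : ∀ x, sumL L (fun y => ρ y ^ 2) x = 1) {ψ : (Q → Fin 2) → ℂ}
    (hψ : ∀ x, (∃ q ∈ L, x q ≠ 0) → ψ x = 0) (x : Q → Fin 2) :
    run (prepC L ρ) ψ x = ρ x * ψ (zeroL L x) := by
  induction L generalizing ρ x with
  | nil =>
    have : ρ x = 1 := by
      have := h1 x
      rw [sumL] at this
      nlinarith [h0 x]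
    have hz : zeroL [] x = x := by funext q; simp [zeroL]
    simp [prepC, run_nil, this, hz]
  | cons t L ih =>
    rw [List.nodup_cons] at hL
    have hI := ih hL.2 (hρ.subst fun a b => Real.sqrt (a ^ 2 + b ^ 2))
      (fun x => Real.sqrt_nonneg _)
      (fun x => by
        rw [← h1 x, sumL]
        refine sumL_congr fun y _ => ?_
        rw [Real.sq_sqrt (by positivity)])
      (fun x ⟨q, hq, hx⟩ => hψ x ⟨q, by simp [hq], hx⟩)
    have hu : ∀ y, ∀ b, ρ (Function.update (Function.update y t b) t 0) =
      ρ (Function.update y t 0) := by intro y b; simp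
    rw [prepC, run_append, run_muxY hL.1 (hρ.subst fun a b => Complex.arg ⟨a, b⟩), hI, hI]
    simp only [Function.update_idem]
    have hz0 : zeroL L (Function.update x t 0) = zeroL (t :: L) x := by
      funext q
      by_cases hq : q = t
      · subst hq; simp [zeroL]
      · simp [zeroL, hq]
    have hz1 : ψ (zeroL L (Function.update x t 1)) = 0 :=
      hψ _ ⟨t, by simp, by simp [zeroL, hL.1]⟩
    rw [hz0, hz1]
    have hc := cos_arg_mul_sqrt (ρ (Function.update x t 0)) (ρ (Function.update x t 1))
    have hs := sin_arg_mul_sqrt (ρ (Function.update x t 0)) (ρ (Function.update x t 1))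
    rcases fin2_cases (x t) with hx | hx
    · have hxx : Function.update x t 0 = x := by rw [← hx]; simp
      rw [if_pos hx, mul_zero, mul_zero, sub_zero, ← mul_assoc, ← Complex.ofReal_mul, hc, hxx]
    · have hxx : Function.update x t 1 = x := by rw [← hx]; simp
      rw [if_neg (by simp [hx]), mul_zero, mul_zero, add_zero, ← mul_assoc, ← Complex.ofReal_mul,
        hs, hxx]

/-- The adjoint of the preparation, read at the zero state of `L`, is the inner product with `ρ`. -/
theorem run_invC_prepC {L : List Q} (hL : L.Nodup) {ρ : (Q → Fin 2) → ℝ} (hρ : BitsIn L ρ)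
    (h0 : ∀ x, 0 ≤ ρ x) (h1 : ∀ x, sumL L (fun y => ρ y ^ 2) x = 1) (ψ : (Q → Fin 2) → ℂ)
    {x : Q → Fin 2} (hx : ∀ q ∈ L, x q = 0) :
    run (invC (prepC L ρ)) ψ x = sumL L (fun y => (ρ y : ℂ) * ψ y) x := by
  induction L generalizing ρ ψ x with
  | nil =>
    have : ρ x = 1 := by
      have := h1 x
      rw [sumL] at this
      nlinarith [h0 x]
    simp [prepC, run_nil, this, sumL, invC]
  | cons t L ih =>
    rw [List.nodup_cons] at hL
    have hI := fun ψ => ih hL.2 (hρ.subst fun a b => Real.sqrt (a ^ 2 + b ^ 2))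
      (fun x => Real.sqrt_nonneg _)
      (fun x => by
        rw [← h1 x, sumL]
        refine sumL_congr fun y _ => ?_
        rw [Real.sq_sqrt (by positivity)]) ψ
      (fun q hq => hx q (List.mem_cons_of_mem t hq))
    rw [prepC, invC_append, run_append, hI, sumL]
    refine sumL_congr fun y hy => ?_
    have hyt : y t = 0 := by rw [hy t hL.1, hx t (by simp)]
    have hb := hρ.subst fun a b => Complex.arg ⟨a, b⟩
    rw [run_invC_muxY hL.1 hb, run_muxY hL.1 (fun x y h => by simp only [hb x y h]), if_pos hyt,
      Real.cos_neg, Real.sin_neg]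
    have hc := cos_arg_mul_sqrt (ρ (Function.update y t 0)) (ρ (Function.update y t 1))
    have hs := sin_arg_mul_sqrt (ρ (Function.update y t 0)) (ρ (Function.update y t 1))
    have hc' := congrArg Complex.ofReal hc
    have hs' := congrArg Complex.ofReal hs
    rw [Complex.ofReal_mul] at hc' hs'
    rw [← hc', ← hs', Complex.ofReal_neg]
    ring

theorem cost_prepC (L : List Q) (ρ : (Q → Fin 2) → ℝ) :
    CostLE (prepC L ρ) (2 ^ L.length + 2 * L.length) (2 ^ (L.length + 1)) := by
  induction L generalizing ρ with
  | nil => exact CostLE.nil.mono (by simp) (by simp)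
  | cons t L ih =>
    refine ((ih _).append (cost_muxY _ _ _)).mono ?_ ?_
    · rw [List.length_cons, pow_succ]; omega
    · rw [List.length_cons, pow_succ _ (L.length + 1)]; omega

theorem targets_prepC (L : List Q) (ρ : (Q → Fin 2) → ℝ) : TargetsIn (· ∈ L) (prepC L ρ) := by
  induction L generalizing ρ with
  | nil => intro g hg; simp [prepC] at hg
  | cons t L ih =>
    refine ((ih _).mono ?_).append ((targets_muxY _ _ _).mono ?_)
    · intro q hq; simp [hq]
    · rintro q rfl; simp

theorem avoids_prepC {L : List Q} {q : Q} (hq : q ∉ L) (ρ : (Q → Fin 2) → ℝ) :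
    ∀ g ∈ prepC L ρ, Gate.Avoids q g := by
  induction L generalizing ρ with
  | nil => intro g hg; simp [prepC] at hg
  | cons t L ih =>
    rw [List.mem_cons, not_or] at hq
    intro g hg
    rcases List.mem_append.1 hg with hg | hg
    · exact ih hq.2 _ g hg
    · exact avoids_muxY hq.2 (fun e => hq.1 e.symm) _ g hg

end Preparation

end QBlock

end

noncomputable section

namespace QBlock

/-! ### Reversible circuits -/

section Classical

set_option linter.unusedSectionVars false
set_option linter.unusedSimpArgs false

variable {Q : Type} [Fintype Q] [DecidableEq Q]

/-- The circuit maps the basis state `|y⟩` to `|F y⟩`. -/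
def Classical (C : Circuit Q) (F : (Q → Fin 2) → (Q → Fin 2)) : Prop :=
  ∀ ψ y, run C ψ (F y) = ψ y

theorem Classical.append {C D : Circuit Q} {F G : (Q → Fin 2) → (Q → Fin 2)}
    (hC : Classical C F) (hD : Classical D G) : Classical (C ++ D) (fun y => G (F y)) := by
  intro ψ y
  rw [run_append, hD, hC]

theorem Classical.run_inv {C : Circuit Q} {F : (Q → Fin 2) → (Q → Fin 2)} (hC : Classical C F)
    (ψ : (Q → Fin 2) → ℂ) (y : Q → Fin 2) : run (invC C) ψ y = ψ (F y) := by
  rw [← hC (run (invC C) ψ) y, run_run_invC]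

/-- If two basis states had the same image, a state concentrated on one of them would be evaluated
to both 0 and 1. -/
theorem Classical.surjective {C : Circuit Q} {F : (Q → Fin 2) → (Q → Fin 2)}
    (hC : Classical C F) : Function.Surjective F := by
  apply Finite.surjective_of_injective
  intro x y h
  by_contra hne
  have h1 := hC (Pi.single x 1) x
  rw [h, hC] at h1
  simp [Pi.single_apply] at h1
  exact hne h1.symm

/-- Replaces a composed permutation by a variable known only through its values, so that it is
unfolded on demand. -/
theorem Classical.exists_eq {C : Circuit Q} {F : (Q → Fin 2) → (Q → Fin 2)}
    (hC : Classical C F) : ∃ G, Classical C G ∧ ∀ y, G y = F y := ⟨F, hC, fun _ => rfl⟩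

theorem Classical.nil : Classical ([] : Circuit Q) id := fun ψ y => by rw [run_nil, id]

theorem classical_cx {c t : Q} (h : c ≠ t) :
    Classical (cx c t) (fun y => Function.update y t (y t + y c)) := by
  intro ψ y
  rw [run_cx h]
  simp [h, fin2_add_add_cancel]

theorem classical_tof {a b t : Q} (hab : a ≠ b) (hat : a ≠ t) (hbt : b ≠ t) :
    Classical (tof a b t) (fun y => Function.update y t (y t + y a * y b)) := by
  intro ψ y
  rw [run_tof hab hat hbt]
  simp [hat, hbt, fin2_add_add_cancel]

/-- Controlled addition (control `e`): for a list of pairs `(aᵢ, bᵢ)` of qubits, the number in the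
qubits `aᵢ` and the carry bit `c` are added to the number in the qubits `bᵢ`. -/
def addC (e : Q) : Q → List (Q × Q) → Circuit Q
  | _, [] => []
  | c, (a, b) :: L =>
    cx a b ++ (cx a c ++ (tof c b a ++ (addC e a L ++
      (tof c b a ++ (cx a b ++ (tof e c b ++ cx a c))))))

theorem cost_addC (e c : Q) (L : List (Q × Q)) :
    CostLE (addC e c L) (L.length * 30) (L.length * 28) := by
  induction L generalizing c with
  | nil => exact CostLE.nil.mono (by simp) (by simp)
  | cons p L ih =>
    obtain ⟨a, b⟩ := p
    refine ((cost_cx _ _).append ((cost_cx _ _).append ((cost_tof _ _ _).append ((ih _).append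
      ((cost_tof _ _ _).append ((cost_cx _ _).append ((cost_tof _ _ _).append
        (cost_cx _ _)))))))).mono ?_ ?_ <;> rw [List.length_cons] <;> omega

/-- A ripple-carry adder. The first three gates turn `a` into the majority of `a`, `b`, `c`, the
next carry; after the recursive call they are undone in an order that also writes the sum bit. Only
the Toffoli gate writing `b` depends on `e`, so with `e` off everything cancels. The last carry is
dropped, hence the modulus. -/
theorem classical_addC {e : Q} {c : Q} {L : List (Q × Q)}
    (hL : (e :: c :: (L.map Prod.fst ++ L.map Prod.snd)).Nodup) :
    ∃ F, Classical (addC e c L) F ∧ (∀ y q, q ∉ L.map Prod.snd → F y q = y q) ∧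
      (∀ y, y e = 0 → F y = y) ∧
      ∀ y, y e = 1 → (val (L.map Prod.snd) (F y)) ≡
        (val (L.map Prod.snd) y + val (L.map Prod.fst) y + y c) [MOD 2 ^ L.length] := by
  induction L generalizing c with
  | nil =>
    refine ⟨id, Classical.nil, fun _ _ _ => rfl, fun _ _ => rfl, fun y _ => ?_⟩
    simp [Nat.ModEq, Nat.mod_one]
  | cons p L ih =>
    obtain ⟨a, b⟩ := p
    simp only [List.map_cons, List.nodup_cons, List.mem_cons, List.mem_append, not_or,
      List.cons_append, List.nodup_append] at hL
    obtain ⟨⟨hec, hea, heA, heb, heB⟩, ⟨hca, hcA, hcb, hcB⟩, ⟨haA, hab, haB⟩, hnA, ⟨hbB, hnB⟩,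
      hAB⟩ := hL
    have hbA : b ∉ L.map Prod.fst := fun h => hAB b h b (by simp) rfl
    have hnAB : ∀ x ∈ L.map Prod.fst, ∀ y ∈ L.map Prod.snd, x ≠ y :=
      fun x hx y hy => hAB x hx y (by simp [hy])
    obtain ⟨F, hF, hFo, hF0, hF1⟩ := ih (c := a) (by
      simp only [List.nodup_cons, List.mem_cons, List.mem_append, not_or, List.nodup_append]
      exact ⟨⟨hea, heA, heB⟩, ⟨haA, haB⟩, hnA, hnB, hnAB⟩)
    have hab' : a ≠ b := hab
    have hac : a ≠ c := fun h => hca h.symm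
    have hcb' : c ≠ b := hcb
    have hC := (classical_cx hab').append ((classical_cx hac).append
      ((classical_tof hcb' hca (Ne.symm hab')).append (hF.append
      ((classical_tof hcb' hca (Ne.symm hab')).append ((classical_cx hab').append
        ((classical_tof hec heb hcb').append (classical_cx hac)))))))
    obtain ⟨H, hH, hHd⟩ := hC.exists_eq
    -- Here `y1` is the state once the carry sits in `a`, `y2` is any state after the inner
    -- addition, of which only the untouched qubits matter, and `z` is the final state.
    have key : ∀ y y1 : Q → Fin 2, y1 = (fun y => Function.update y a (y a + y c * y b))
        ((fun y => Function.update y c (y c + y a)) ((fun y => Function.update y b (y b + y a)) y)) →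
        ∀ y2, (∀ q, q ∉ L.map Prod.snd → y2 q = y1 q) →
        ∀ z, z = (fun y => Function.update y c (y c + y a))
          ((fun y => Function.update y b (y b + y e * y c))
          ((fun y => Function.update y b (y b + y a))
          ((fun y => Function.update y a (y a + y c * y b)) y2))) →
        y1 a = y a + (y c + y a) * (y b + y a) ∧ z a = y a ∧ z c = y c ∧
          z b = y b + y e * (y c + y a) ∧
          (∀ q, q ≠ a → q ≠ b → q ≠ c → z q = y2 q) ∧
          (∀ q, q ≠ a → q ≠ b → q ≠ c → y1 q = y q) := by
      intro y y1 h1 y2 h2 z hz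
      have ha : y1 a = y a + (y c + y a) * (y b + y a) := by
        rw [h1]; simp [hca, hcb', hab', hac, Ne.symm hab', Ne.symm hcb']
      have hb : y1 b = y b + y a := by
        rw [h1]; simp [hca, hcb', hab', hac, Ne.symm hab', Ne.symm hcb']
      have hc : y1 c = y c + y a := by
        rw [h1]; simp [hca, hcb', hab', hac, Ne.symm hab', Ne.symm hcb']
      have ho : ∀ q, q ≠ a → q ≠ b → q ≠ c → y1 q = y q := by
        intro q qa qb qc; rw [h1]; simp [qa, qb, qc]
      have h2a : y2 a = y a + (y c + y a) * (y b + y a) := by rw [h2 a haB, ha]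
      have h2b : y2 b = y b + y a := by rw [h2 b hbB, hb]
      have h2c : y2 c = y c + y a := by rw [h2 c hcB, hc]
      have h2e : y2 e = y e := by rw [h2 e heB, ho e hea heb hec]
      have alg1 : ∀ A B C : Fin 2, A + (C + A) * (B + A) + (C + A) * (B + A) = A := by decide
      refine ⟨ha, ?_, ?_, ?_, ?_, ho⟩
      · rw [hz]
        simp [hca, hcb', hab', hac, Ne.symm hab', Ne.symm hcb', h2a, h2b, h2c, alg1]
      · rw [hz]
        simp [hca, hcb', hab', hac, Ne.symm hab', Ne.symm hcb', h2a, h2b, h2c, alg1, fin2_add_add_cancel]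
      · rw [hz]
        simp [hca, hcb', hab', hac, Ne.symm hab', Ne.symm hcb', h2a, h2b, h2c, alg1, fin2_add_add_cancel, hea,
          heb, hec, h2e]
      · intro q qa qb qc
        rw [hz]
        simp [qa, qb, qc]
    have hsep : ∀ q ∈ L.map Prod.snd, q ≠ a ∧ q ≠ b ∧ q ≠ c := by
      intro q hq
      exact ⟨fun h => haB (h ▸ hq), fun h => hbB (h ▸ hq), fun h => hcB (h ▸ hq)⟩
    have hsepA : ∀ q ∈ L.map Prod.fst, q ≠ a ∧ q ≠ b ∧ q ≠ c := by
      intro q hq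
      exact ⟨fun h => haA (h ▸ hq), fun h => hbA (h ▸ hq), fun h => hcA (h ▸ hq)⟩
    refine ⟨H, hH, ?_, ?_, ?_⟩
    · intro y q hq
      rw [List.map_cons, List.mem_cons, not_or] at hq
      obtain ⟨-, ka, kc, -, ko, ko1⟩ := key y _ rfl _ (hFo _) _ (hHd y)
      by_cases qa : q = a
      · subst qa; exact ka
      by_cases qc : q = c
      · subst qc; exact kc
      rw [ko q qa hq.1 qc, hFo _ q hq.2, ko1 q qa hq.1 qc]
    · intro y hy
      obtain ⟨-, ka, kc, kb, ko, ko1⟩ := key y _ rfl _ (hFo _) _ (hHd y)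
      have hF0' := hF0 _ ((ko1 e hea heb hec).trans hy)
      funext q
      by_cases qa : q = a
      · subst qa; exact ka
      by_cases qc : q = c
      · subst qc; exact kc
      by_cases qb : q = b
      · subst qb; rw [kb, hy]; simp
      exact (ko q qa qb qc).trans ((congrFun hF0' q).trans (ko1 q qa qb qc))
    · intro y hy
      obtain ⟨y1, hy1⟩ : ∃ y1, y1 = (fun y => Function.update y a (y a + y c * y b))
        ((fun y => Function.update y c (y c + y a))
          ((fun y => Function.update y b (y b + y a)) y)) := ⟨_, rfl⟩
      obtain ⟨k1a, ka, kc, kb, ko, ko1⟩ := key y y1 hy1 (F y1) (hFo _) (H y)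
        (by rw [hy1]; exact hHd y)
      have hF1' := hF1 _ ((ko1 e hea heb hec).trans hy)
      rw [k1a] at hF1'
      simp only [List.map_cons, val]
      rw [kb, hy, val_congr fun q hq => ko q (hsep q hq).1 (hsep q hq).2.1 (hsep q hq).2.2]
      rw [val_congr (L := L.map Prod.snd) (y := y)
          fun q hq => ko1 q (hsep q hq).1 (hsep q hq).2.1 (hsep q hq).2.2,
        val_congr (L := L.map Prod.fst) (y := y)
          fun q hq => ko1 q (hsepA q hq).1 (hsepA q hq).2.1 (hsepA q hq).2.2] at hF1'
      -- The full adder: sum bit plus twice the majority.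
      have alg : ∀ A B C : Fin 2, (A : ℕ) + B + C =
          ((B + 1 * (C + A) : Fin 2) : ℕ) + 2 * ((A + (C + A) * (B + A) : Fin 2) : ℕ) := by decide
      have h2 := (hF1'.mul_left' 2).add_left ((y b + 1 * (y c + y a) : Fin 2) : ℕ)
      rw [List.length_cons, pow_succ, mul_comm _ 2]
      refine h2.trans ?_
      have := alg (y a) (y b) (y c)
      have e : ((y b + 1 * (y c + y a) : Fin 2) : ℕ) + 2 * (val (List.map Prod.snd L) y +
          val (List.map Prod.fst L) y + ((y a + (y c + y a) * (y b + y a) : Fin 2) : ℕ)) =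
          (y b : ℕ) + 2 * val (List.map Prod.snd L) y +
            ((y a : ℕ) + 2 * val (List.map Prod.fst L) y) + (y c : ℕ) := by omega
      rw [e]

end Classical

end QBlock

end

noncomputable section

namespace QBlock

/-! ### The Fejér–Riesz theorem -/

section Polynomials

open Polynomial

theorem infinite_unit_circle : {z : ℂ | ‖z‖ = 1}.Infinite := by
  have h : IsPreconnected (Metric.sphere (0 : ℂ) 1) :=
    isPreconnected_sphere (by rw [Complex.rank_real_complex]; norm_num) 0 1
  have h2 : (Metric.sphere (0 : ℂ) 1).Nontrivial :=
    ⟨1, by simp, -1, by simp, by norm_num⟩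
  have := h.infinite_of_nontrivial h2
  convert this using 1
  ext z
  simp

theorem eq_of_eval_unit_circle {p q : ℂ[X]} (h : ∀ z : ℂ, ‖z‖ = 1 → p.eval z = q.eval z) :
    p = q :=
  eq_of_infinite_eval_eq p q (infinite_unit_circle.mono fun z hz => h z hz)

/-- The conjugate reciprocal polynomial of formal degree `N`. -/
def conjReflect (N : ℕ) (p : ℂ[X]) : ℂ[X] := reflect N (p.map (starRingEnd ℂ))

theorem natDegree_conjReflect {N : ℕ} {p : ℂ[X]} (hp : p.natDegree ≤ N) :
    (conjReflect N p).natDegree ≤ N := by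
  rw [conjReflect]
  refine natDegree_reflect_le.trans (max_le le_rfl ?_)
  exact natDegree_map_le.trans hp

theorem coeff_conjReflect {N i : ℕ} (h : i ≤ N) (p : ℂ[X]) :
    (conjReflect N p).coeff i = starRingEnd ℂ (p.coeff (N - i)) := by
  rw [conjReflect, coeff_reflect, revAt_le h, coeff_map]

theorem eval_conjReflect {N : ℕ} {p : ℂ[X]} (hp : p.natDegree ≤ N) {z : ℂ} (hz : z ≠ 0) :
    (conjReflect N p).eval z = z ^ N * starRingEnd ℂ (p.eval (1 / starRingEnd ℂ z)) := by
  have hz' : z⁻¹ ≠ 0 := inv_ne_zero hz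
  let _ : Invertible z⁻¹ := invertibleOfNonzero hz'
  have h := eval₂_reflect_mul_pow (RingHom.id ℂ) z⁻¹ N (p.map (starRingEnd ℂ))
    (natDegree_map_le.trans hp)
  rw [invOf_eq_inv, inv_inv] at h
  have e : eval₂ (RingHom.id ℂ) z⁻¹ (p.map (starRingEnd ℂ)) =
      starRingEnd ℂ (p.eval (1 / starRingEnd ℂ z)) := by
    rw [eval₂_map, eval, hom_eval₂]
    simp
  rw [e] at h
  rw [← h, conjReflect, eval, mul_left_comm, ← mul_pow, mul_inv_cancel₀ hz, one_pow, mul_one]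

theorem eval_conjReflect_of_norm {N : ℕ} {p : ℂ[X]} (hp : p.natDegree ≤ N) {z : ℂ}
    (hz : ‖z‖ = 1) : (conjReflect N p).eval z = z ^ N * starRingEnd ℂ (p.eval z) := by
  have hz0 : z ≠ 0 := by rintro rfl; simp at hz
  rw [eval_conjReflect hp hz0]
  congr 3
  rw [one_div, ← map_inv₀, Complex.inv_eq_conj hz, Complex.conj_conj]

theorem mul_conj_of_norm {z : ℂ} (hz : ‖z‖ = 1) : z * starRingEnd ℂ z = 1 := by
  rw [Complex.mul_conj, Complex.normSq_eq_norm_sq, hz]; simp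

/-- A trigonometric polynomial that is positive on the unit circle is the square of the absolute
value of a polynomial. -/
theorem fejer_riesz (d : ℕ) (G : ℂ[X]) (hdeg : G.natDegree ≤ 2 * d)
    (hpos : ∀ z : ℂ, ‖z‖ = 1 → ∃ r : ℝ, 0 < r ∧ G.eval z = r * z ^ d) :
    ∃ q : ℂ[X], q.natDegree ≤ d ∧
      ∀ z : ℂ, ‖z‖ = 1 → G.eval z = ((‖q.eval z‖ ^ 2 : ℝ) : ℂ) * z ^ d := by
  induction d generalizing G with
  | zero =>
    have hG := eq_C_of_natDegree_le_zero hdeg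
    obtain ⟨r, hr, h⟩ := hpos 1 (by simp)
    refine ⟨C (Real.sqrt r : ℂ), by simp, fun z _ => ?_⟩
    rw [hG] at h ⊢
    simp only [eval_C, pow_zero, mul_one] at h ⊢
    rw [h, Complex.norm_real, Real.norm_eq_abs, sq_abs, Real.sq_sqrt hr.le]
  | succ d ih =>
    -- On the circle `G` is real up to the factor `z^(d+1)`, which makes it its own conjugate
    -- reciprocal; its coefficients are conjugate-symmetric and its nonzero roots are closed under
    -- `r ↦ 1 / r̄`.
    have hself : conjReflect (2 * (d + 1)) G = G := by
      apply eq_of_eval_unit_circle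
      intro z hz
      obtain ⟨r, -, h⟩ := hpos z hz
      rw [eval_conjReflect_of_norm hdeg hz, h, map_mul, Complex.conj_ofReal, map_pow, two_mul,
        pow_add]
      have := mul_conj_of_norm hz
      calc _ = (r : ℂ) * z ^ (d + 1) * (z * starRingEnd ℂ z) ^ (d + 1) := by ring
        _ = _ := by rw [this]; simp
    have htop : G.coeff (2 * (d + 1)) = starRingEnd ℂ (G.coeff 0) := by
      conv_lhs => rw [← hself]
      rw [coeff_conjReflect le_rfl, Nat.sub_self]
    by_cases h0 : G.coeff 0 = 0
    -- The constant coefficient vanishes, hence so does the top one by symmetry: removing a factor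
    -- `X` lowers the degree bound by two.
    · have hX : G = X * G.divX := by
        conv_lhs => rw [← divX_mul_X_add G]
        rw [h0]; simp [mul_comm]
      obtain ⟨q, hq, hqz⟩ := ih G.divX (by
          rw [natDegree_le_iff_coeff_eq_zero]
          intro N hN
          rw [coeff_divX]
          by_cases h : N + 1 = 2 * (d + 1)
          · rw [h, htop, h0, map_zero]
          · exact coeff_eq_zero_of_natDegree_lt (by omega))
        (fun z hz => by
          obtain ⟨r, hr, h⟩ := hpos z hz
          have hz0 : z ≠ 0 := by rintro rfl; simp at hz
          refine ⟨r, hr, ?_⟩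
          rw [hX, eval_mul, eval_X, pow_succ] at h
          apply mul_left_cancel₀ hz0
          rw [h]; ring)
      refine ⟨q, by omega, fun z hz => ?_⟩
      rw [hX, eval_mul, eval_X, hqz z hz]
      ring
    · have hdegpos : 0 < G.degree := by
        apply natDegree_pos_iff_degree_pos.1
        refine lt_of_lt_of_le ?_ (le_natDegree_of_ne_zero (n := 2 * (d + 1)) ?_)
        · omega
        · rw [htop]; simpa using h0
      obtain ⟨r, hr⟩ := Complex.exists_root hdegpos
      have hr0 : r ≠ 0 := by
        rintro rfl
        rw [IsRoot, ← coeff_zero_eq_eval_zero] at hr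
        exact h0 hr
      -- Strict positivity excludes roots on the circle, so `r` and `s = 1 / r̄` are distinct and
      -- both linear factors split off.
      have hr1 : ‖r‖ ≠ 1 := by
        intro h
        obtain ⟨ρ, hρ, e⟩ := hpos r h
        rw [hr.eq_zero] at e
        have : (ρ : ℂ) * r ^ (d + 1) ≠ 0 :=
          mul_ne_zero (by exact_mod_cast hρ.ne') (pow_ne_zero _ hr0)
        exact this e.symm
      have hcr : starRingEnd ℂ r ≠ 0 := by simpa using hr0
      obtain ⟨s, hs⟩ : ∃ s, s = 1 / starRingEnd ℂ r := ⟨_, rfl⟩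
      have hs0 : s ≠ 0 := by rw [hs]; exact one_div_ne_zero hcr
      have hsr : s - r ≠ 0 := by
        rw [sub_ne_zero]
        intro h
        rw [hs, div_eq_iff hcr, Complex.mul_conj, Complex.normSq_eq_norm_sq] at h
        have h' : (1 : ℝ) = ‖r‖ ^ 2 := by exact_mod_cast h
        apply hr1
        nlinarith [norm_nonneg r]
      have hGs : G.eval s = 0 := by
        rw [← hself, eval_conjReflect hdeg hs0]
        have : 1 / starRingEnd ℂ s = r := by rw [hs]; simp
        rw [this, hr.eq_zero, map_zero, mul_zero]
      obtain ⟨H, hH⟩ := dvd_iff_isRoot.2 hr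
      have hHs : H.IsRoot s := by
        rw [hH, eval_mul, eval_sub, eval_X, eval_C] at hGs
        exact (mul_eq_zero.1 hGs).resolve_left hsr
      obtain ⟨K, hK⟩ := dvd_iff_isRoot.2 hHs
      have hGK : G = (X - C r) * ((X - C s) * K) := by rw [hH, hK]
      have hKdeg : K.natDegree ≤ 2 * d := by
        have hG0 : K ≠ 0 := by
          rintro rfl
          rw [hGK] at h0; simp at h0
        rw [hGK, (monic_X_sub_C r).natDegree_mul' (mul_ne_zero (X_sub_C_ne_zero s) hG0),
          (monic_X_sub_C s).natDegree_mul' hG0, natDegree_X_sub_C, natDegree_X_sub_C] at hdeg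
        omega
      have hne : ∀ z : ℂ, ‖z‖ = 1 → ‖z - r‖ ^ 2 ≠ 0 := by
        intro z hz h
        have : z - r = 0 := by simpa using h
        rw [sub_eq_zero] at this
        exact hr1 (this ▸ hz)
      -- On the circle `z - s = -s z (1/z - r̄)` and `1/z = z̄`, so the two factors multiply to `-s
      -- z |z - r|²`.
      have hfac : ∀ z : ℂ, ‖z‖ = 1 →
          G.eval z = ((‖z - r‖ ^ 2 : ℝ) : ℂ) * z * (C (-s) * K).eval z := by
        intro z hz
        have h1 := mul_conj_of_norm hz
        have h2 : s * starRingEnd ℂ r = 1 := by rw [hs]; field_simp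
        rw [hGK]
        simp only [eval_mul, eval_sub, eval_X, eval_C]
        rw [← Complex.normSq_eq_norm_sq, ← Complex.mul_conj, map_sub]
        linear_combination (K.eval z * (z - r) * s) * h1 - (K.eval z * (z - r) * z) * h2
      obtain ⟨q, hq, hqz⟩ := ih (C (-s) * K) ((natDegree_C_mul_le _ _).trans hKdeg)
        (fun z hz => by
          obtain ⟨ρ, hρ, h⟩ := hpos z hz
          have hz0 : z ≠ 0 := by rintro rfl; simp at hz
          have hn := hne z hz
          refine ⟨ρ / ‖z - r‖ ^ 2, div_pos hρ (lt_of_le_of_ne (by positivity) hn.symm), ?_⟩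
          rw [hfac z hz] at h
          have hn' : ((‖z - r‖ ^ 2 : ℝ) : ℂ) ≠ 0 := by exact_mod_cast hn
          apply mul_left_cancel₀ (mul_ne_zero hn' hz0)
          rw [h, Complex.ofReal_div]
          field_simp
          ring)
      refine ⟨(X - C r) * q, ?_, fun z hz => ?_⟩
      · refine natDegree_mul_le.trans ?_
        rw [natDegree_X_sub_C]; omega
      · rw [hfac z hz, hqz z hz, eval_mul, norm_mul, eval_sub, eval_X, eval_C]
        push_cast
        ring

/-! ### Quantum signal processing -/

/-- `Reach d p q`: the polynomials `p`, `q` are produced from `(1, 0)` by `d` signal steps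
`(p, q) ↦ (X p, q)`, with gates `diag(e^{iα}, e^{iβ}) R(θ)` before and after each of them. -/
inductive Reach : ℕ → ℂ[X] → ℂ[X] → Prop
  | zero (θ α β : ℝ) : Reach 0 (C (Complex.exp (α * Complex.I) * Real.cos θ))
      (C (Complex.exp (β * Complex.I) * Real.sin θ))
  | succ (θ α β : ℝ) (d : ℕ) (p q : ℂ[X]) (h : Reach d p q) : Reach (d + 1)
      (C (Complex.exp (α * Complex.I)) * (C (Real.cos θ : ℂ) * (X * p) - C (Real.sin θ : ℂ) * q))
      (C (Complex.exp (β * Complex.I)) * (C (Real.sin θ : ℂ) * (X * p) + C (Real.cos θ : ℂ) * q))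

/-- A vector of `ℂ²` is its norm times the first column of a gate `diag(e^{iα}, e^{iβ}) R(θ)`. -/
theorem exists_polar (a b : ℂ) : ∃ θ α β : ℝ,
    a = Real.sqrt (‖a‖ ^ 2 + ‖b‖ ^ 2) * (Complex.exp (α * Complex.I) * Real.cos θ) ∧
    b = Real.sqrt (‖a‖ ^ 2 + ‖b‖ ^ 2) * (Complex.exp (β * Complex.I) * Real.sin θ) := by
  refine ⟨Complex.arg ⟨‖a‖, ‖b‖⟩, a.arg, b.arg, ?_, ?_⟩
  · have h := Complex.norm_mul_cos_arg ⟨‖a‖, ‖b‖⟩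
    rw [Complex.norm_def, Complex.normSq_mk, ← sq, ← sq] at h
    have h' := congrArg Complex.ofReal h
    rw [Complex.ofReal_mul] at h'
    have := Complex.norm_mul_exp_arg_mul_I a
    simp only at h'
    linear_combination -this - Complex.exp (a.arg * Complex.I) * h'
  · have h := Complex.norm_mul_sin_arg ⟨‖a‖, ‖b‖⟩
    rw [Complex.norm_def, Complex.normSq_mk, ← sq, ← sq] at h
    have h' := congrArg Complex.ofReal h
    rw [Complex.ofReal_mul] at h'
    have := Complex.norm_mul_exp_arg_mul_I b
    simp only at h'
    linear_combination -this - Complex.exp (b.arg * Complex.I) * h'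

/-- Induction on the degree, peeling off the last gate. Norm one on the circle makes the leading and
the constant coefficient vectors of `(p, q)` orthogonal. So one inverse gate can clear the constant
coefficient of the first component, which becomes divisible by `X`, together with the leading
coefficient of the second. -/
theorem reach_of_norm (d : ℕ) (p q : ℂ[X]) (hp : p.natDegree ≤ d) (hq : q.natDegree ≤ d)
    (h : ∀ z : ℂ, ‖z‖ = 1 → ‖p.eval z‖ ^ 2 + ‖q.eval z‖ ^ 2 = 1) : Reach d p q := by
  induction d generalizing p q with
  | zero =>
    have h1 := h 1 (by simp)
    rw [eq_C_of_natDegree_le_zero hp, eq_C_of_natDegree_le_zero hq] at h1 ⊢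
    rw [eval_C, eval_C] at h1
    obtain ⟨θ, α, β, ha, hb⟩ := exists_polar (p.coeff 0) (q.coeff 0)
    rw [h1, Real.sqrt_one, Complex.ofReal_one, one_mul] at ha hb
    rw [ha, hb]
    exact Reach.zero θ α β
  | succ d ih =>
    have hpoly : p * conjReflect (d + 1) p + q * conjReflect (d + 1) q = X ^ (d + 1) := by
      apply eq_of_eval_unit_circle
      intro z hz
      have := h z hz
      rw [eval_add, eval_mul, eval_mul, eval_conjReflect_of_norm hp hz,
        eval_conjReflect_of_norm hq hz, eval_pow, eval_X]
      have h1 : (p.eval z) * starRingEnd ℂ (p.eval z) = ((‖p.eval z‖ ^ 2 : ℝ) : ℂ) := by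
        rw [Complex.mul_conj, Complex.normSq_eq_norm_sq]
      have h2 : (q.eval z) * starRingEnd ℂ (q.eval z) = ((‖q.eval z‖ ^ 2 : ℝ) : ℂ) := by
        rw [Complex.mul_conj, Complex.normSq_eq_norm_sq]
      have h3 : ((‖p.eval z‖ ^ 2 : ℝ) : ℂ) + ((‖q.eval z‖ ^ 2 : ℝ) : ℂ) = 1 := by
        exact_mod_cast this
      linear_combination z ^ (d + 1) * h1 + z ^ (d + 1) * h2 + z ^ (d + 1) * h3
    -- This is the coefficient of degree `2 (d + 1)` in `hpoly`, whose right side has only degree `d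
    -- + 1`.
    have horth : p.coeff (d + 1) * starRingEnd ℂ (p.coeff 0) +
        q.coeff (d + 1) * starRingEnd ℂ (q.coeff 0) = 0 := by
      have := congrArg (fun f => f.coeff (d + 1 + (d + 1))) hpoly
      simp only [coeff_add] at this
      rw [coeff_mul_add_eq_of_natDegree_le hp (natDegree_conjReflect hp),
        coeff_mul_add_eq_of_natDegree_le hq (natDegree_conjReflect hq),
        coeff_conjReflect le_rfl, coeff_conjReflect le_rfl, Nat.sub_self, coeff_X_pow,
        if_neg (by omega)] at this
      exact this
    obtain ⟨θ, α, β, h1, h2⟩ : ∃ θ α β : ℝ,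
        (Complex.exp (-α * Complex.I) * Real.cos θ * p.coeff 0 +
          Complex.exp (-β * Complex.I) * Real.sin θ * q.coeff 0 = 0) ∧
        (-(Complex.exp (-α * Complex.I) * Real.sin θ * p.coeff (d + 1)) +
          Complex.exp (-β * Complex.I) * Real.cos θ * q.coeff (d + 1) = 0) := by
      have hexp : ∀ x : ℝ, Complex.exp (-x * Complex.I) * Complex.exp (x * Complex.I) = 1 := by
        intro x; rw [← Complex.exp_add]; simp
      have hconj : ∀ x : ℝ, starRingEnd ℂ (Complex.exp (x * Complex.I)) =
          Complex.exp (-x * Complex.I) := by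
        intro x; rw [← Complex.exp_conj]; simp
      -- If the leading vector is zero, the gate is chosen with first column orthogonal to the
      -- constant vector; otherwise its first column is aligned with the leading vector, and `horth`
      -- gives the other equation.
      by_cases hv : p.coeff (d + 1) = 0 ∧ q.coeff (d + 1) = 0
      · obtain ⟨θ, α, β, ha, hb⟩ :=
          exists_polar (-starRingEnd ℂ (q.coeff 0)) (starRingEnd ℂ (p.coeff 0))
        refine ⟨θ, α, β, ?_, by simp [hv.1, hv.2]⟩
        generalize Real.sqrt _ = n at ha hb
        have ha' := congrArg (starRingEnd ℂ) ha
        have hb' := congrArg (starRingEnd ℂ) hb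
        simp only [map_neg, Complex.conj_conj, map_mul, Complex.conj_ofReal, hconj] at ha' hb'
        have ha'' : q.coeff 0 = -(_) := neg_eq_iff_eq_neg.1 ha'
        rw [ha'', hb']
        ring
      · obtain ⟨θ, α, β, ha, hb⟩ := exists_polar (p.coeff (d + 1)) (q.coeff (d + 1))
        have hn : (Real.sqrt (‖p.coeff (d + 1)‖ ^ 2 + ‖q.coeff (d + 1)‖ ^ 2) : ℂ) ≠ 0 := by
          intro h0
          rw [h0, zero_mul] at ha hb
          exact hv ⟨ha, hb⟩
        generalize (Real.sqrt (‖p.coeff (d + 1)‖ ^ 2 + ‖q.coeff (d + 1)‖ ^ 2) : ℝ) = n at *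
        refine ⟨θ, α, β, ?_, ?_⟩
        · have := congrArg (starRingEnd ℂ) horth
          rw [ha, hb] at this
          simp only [map_add, Complex.conj_conj, map_mul, Complex.conj_ofReal, hconj,
            map_zero] at this
          apply mul_left_cancel₀ hn
          rw [mul_zero, ← this]
          ring
        · rw [ha, hb]
          linear_combination (-(n : ℂ) * Real.sin θ * Real.cos θ) * hexp α +
            ((n : ℂ) * Real.sin θ * Real.cos θ) * hexp β
    obtain ⟨p', hp'⟩ : ∃ p', p' = (C (Complex.exp (-α * Complex.I) * Real.cos θ) * p +
        C (Complex.exp (-β * Complex.I) * Real.sin θ) * q).divX := ⟨_, rfl⟩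
    obtain ⟨q', hq'⟩ : ∃ q', q' = C (-(Complex.exp (-α * Complex.I) * Real.sin θ)) * p +
        C (Complex.exp (-β * Complex.I) * Real.cos θ) * q := ⟨_, rfl⟩
    have hXp : X * p' = C (Complex.exp (-α * Complex.I) * Real.cos θ) * p +
        C (Complex.exp (-β * Complex.I) * Real.sin θ) * q := by
      conv_rhs => rw [← divX_mul_X_add (C (Complex.exp (-α * Complex.I) * Real.cos θ) * p +
        C (Complex.exp (-β * Complex.I) * Real.sin θ) * q)]
      rw [← hp', coeff_add, coeff_C_mul, coeff_C_mul, h1, C_0, add_zero, mul_comm]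
    have hcs : (Real.cos θ : ℂ) ^ 2 + (Real.sin θ : ℂ) ^ 2 = 1 := by
      exact_mod_cast Real.cos_sq_add_sin_sq θ
    have hexp : ∀ x : ℝ, Complex.exp (x * Complex.I) * Complex.exp (-x * Complex.I) = 1 := by
      intro x; rw [← Complex.exp_add]; simp
    have hpe : p = C (Complex.exp (α * Complex.I)) *
        (C (Real.cos θ : ℂ) * (X * p') - C (Real.sin θ : ℂ) * q') := by
      have e1 := congrArg (C : ℂ → ℂ[X]) hcs
      have e2 := congrArg (C : ℂ → ℂ[X]) (hexp α)
      rw [hXp, hq']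
      simp only [map_add, map_mul, map_pow, map_neg, map_one] at e1 e2 ⊢
      linear_combination -p * e1 - p * (C (Real.cos θ : ℂ) ^ 2 + C (Real.sin θ : ℂ) ^ 2) * e2
    have hqe : q = C (Complex.exp (β * Complex.I)) *
        (C (Real.sin θ : ℂ) * (X * p') + C (Real.cos θ : ℂ) * q') := by
      have e1 := congrArg (C : ℂ → ℂ[X]) hcs
      have e2 := congrArg (C : ℂ → ℂ[X]) (hexp β)
      rw [hXp, hq']
      simp only [map_add, map_mul, map_pow, map_neg, map_one] at e1 e2 ⊢
      linear_combination -q * e1 - q * (C (Real.cos θ : ℂ) ^ 2 + C (Real.sin θ : ℂ) ^ 2) * e2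
    rw [hpe, hqe]
    apply Reach.succ
    apply ih
    · rw [hp', natDegree_divX_eq_natDegree_tsub_one]
      have : (C (Complex.exp (-α * Complex.I) * Real.cos θ) * p +
        C (Complex.exp (-β * Complex.I) * Real.sin θ) * q).natDegree ≤ d + 1 :=
        natDegree_add_le_of_degree_le ((natDegree_C_mul_le _ _).trans hp)
          ((natDegree_C_mul_le _ _).trans hq)
      omega
    · rw [natDegree_le_iff_coeff_eq_zero]
      intro N hN
      rw [hq', coeff_add, coeff_C_mul, coeff_C_mul]
      by_cases hN' : N = d + 1
      · rw [hN', ← h2]; ring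
      · rw [coeff_eq_zero_of_natDegree_lt (n := N) (p := p) (by omega),
          coeff_eq_zero_of_natDegree_lt (n := N) (p := q) (by omega)]
        simp
    · intro z hz
      rw [← h z hz]
      have hn : ‖(X * p').eval z‖ = ‖p'.eval z‖ := by rw [eval_mul, eval_X, norm_mul, hz, one_mul]
      rw [← hn]
      -- The gate is unitary, and on the circle the factor `X` does not change norms, so the reduced
      -- pair still has norm one.
      have e3 : ∀ a b : ℂ, ‖a‖ ^ 2 + ‖b‖ ^ 2 = ‖Complex.exp (α * Complex.I) *
          (Real.cos θ * a - Real.sin θ * b)‖ ^ 2 +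
          ‖Complex.exp (β * Complex.I) * (Real.sin θ * a + Real.cos θ * b)‖ ^ 2 := by
        intro a b
        rw [norm_mul, norm_mul, Complex.norm_exp_ofReal_mul_I, Complex.norm_exp_ofReal_mul_I,
          one_mul, one_mul]
        have := Real.cos_sq_add_sin_sq θ
        generalize Real.cos θ = co at *
        generalize Real.sin θ = si at *
        simp only [← Complex.normSq_eq_norm_sq, Complex.normSq_apply]
        simp
        linear_combination (-(a.re ^ 2 + a.im ^ 2 + b.re ^ 2 + b.im ^ 2)) * this
      rw [e3]
      conv_rhs => rw [hpe, hqe]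
      simp only [eval_mul, eval_sub, eval_add, eval_C]

/-- The polynomial `z^q P((z + 1/z)/2)`. -/
def signalPoly (q : ℕ) (P : ℝ[X]) : ℂ[X] :=
  ∑ k ∈ Finset.range (q + 1), C ((P.coeff k / 2 ^ k : ℝ) : ℂ) * ((X ^ 2 + 1) ^ k * X ^ (q - k))

theorem natDegree_signalPoly (q : ℕ) (P : ℝ[X]) : (signalPoly q P).natDegree ≤ 2 * q := by
  refine natDegree_sum_le_of_forall_le _ _ fun k hk => ?_
  rw [Finset.mem_range] at hk
  refine (natDegree_C_mul_le _ _).trans (natDegree_mul_le.trans ?_)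
  rw [natDegree_X_pow]
  have h1 : (X ^ 2 + 1 : ℂ[X]).natDegree ≤ 2 :=
    natDegree_add_le_of_degree_le (natDegree_X_pow_le 2) (by simp)
  have h2 := (natDegree_pow_le (p := (X ^ 2 + 1 : ℂ[X])) (n := k)).trans
    (Nat.mul_le_mul_left k h1)
  omega

/-- On the circle `z² + 1 = 2 Re(z) z`. -/
theorem eval_signalPoly {q : ℕ} {P : ℝ[X]} (hq : P.natDegree ≤ q) {z : ℂ} (hz : ‖z‖ = 1) :
    (signalPoly q P).eval z = z ^ q * (P.eval z.re : ℝ) := by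
  have h1 : z ^ 2 + 1 = 2 * (z.re : ℂ) * z := by
    have h2 := mul_conj_of_norm hz
    have h3 := Complex.add_conj z
    push_cast at h3
    linear_combination -h2 + z * h3
  rw [signalPoly, eval_finsetSum, eval_eq_sum_range' (Nat.lt_succ_of_le hq), Complex.ofReal_sum,
    Finset.mul_sum]
  refine Finset.sum_congr rfl fun k hk => ?_
  rw [Finset.mem_range] at hk
  simp only [eval_mul, eval_C, eval_pow, eval_add, eval_X, eval_one]
  rw [h1, show q = k + (q - k) by omega, pow_add, Nat.add_sub_cancel_left]
  push_cast
  have : (2 : ℂ) ^ k ≠ 0 := pow_ne_zero _ two_ne_zero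
  field_simp
  ring

/-- On the circle the signal polynomial has modulus `|P(Re z)| < 1`, so `1 - P(Re z)²` is positive
and Fejér–Riesz supplies the complementary polynomial. -/
theorem exists_reach {q : ℕ} {P : ℝ[X]} (hq : P.natDegree ≤ q)
    (hP : ∀ x ∈ Set.Icc (-1 : ℝ) 1, |P.eval x| < 1) :
    ∃ R, Reach (2 * q) (signalPoly q P) R := by
  have hF := natDegree_signalPoly q P
  obtain ⟨R, hR, hRz⟩ := fejer_riesz (2 * q)
    (X ^ (2 * q) - signalPoly q P * conjReflect (2 * q) (signalPoly q P))
    (by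
      refine (natDegree_sub_le _ _).trans (max_le ((natDegree_X_pow_le _).trans (by omega)) ?_)
      refine natDegree_mul_le.trans ?_
      have := natDegree_conjReflect hF
      omega)
    (fun z hz => by
      refine ⟨1 - P.eval z.re ^ 2, ?_, ?_⟩
      · have := hP z.re (abs_le.1 ((Complex.abs_re_le_norm z).trans hz.le))
        rw [sub_pos, sq_lt_one_iff_abs_lt_one]
        exact this
      · rw [eval_sub, eval_mul, eval_conjReflect_of_norm hF hz, eval_pow, eval_X,
          eval_signalPoly hq hz, map_mul, Complex.conj_ofReal, map_pow]
        have h2 := congrArg (· ^ q) (mul_conj_of_norm hz)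
        simp only [mul_pow, one_pow] at h2
        push_cast
        linear_combination (-z ^ (2 * q) * ((P.eval z.re : ℝ) : ℂ) ^ 2) * h2)
  refine ⟨R, reach_of_norm _ _ _ hF hR fun z hz => ?_⟩
  have h := hRz z hz
  have hz0 : z ≠ 0 := by rintro rfl; simp at hz
  rw [eval_sub, eval_mul, eval_conjReflect_of_norm hF hz, eval_pow, eval_X] at h
  have h1 : ((signalPoly q P).eval z) * starRingEnd ℂ ((signalPoly q P).eval z) =
      ((‖(signalPoly q P).eval z‖ ^ 2 : ℝ) : ℂ) := by
    rw [Complex.mul_conj, Complex.normSq_eq_norm_sq]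
  have h2 : ((‖(signalPoly q P).eval z‖ ^ 2 + ‖R.eval z‖ ^ 2 : ℝ) : ℂ) = ((1 : ℝ) : ℂ) := by
    apply mul_left_cancel₀ (pow_ne_zero (2 * q) hz0)
    push_cast at h1 h ⊢
    linear_combination -h - z ^ (2 * q) * h1
  exact_mod_cast h2

end Polynomials

end QBlock

end

noncomputable section

namespace QBlock

/-! ### Circuits that preserve or depend on given qubits; the signal polynomial of an operator -/

section Signal

set_option linter.unusedSectionVars false

variable {Q : Type} [Fintype Q] [DecidableEq Q]

/-- The circuit acts on the qubits in `S` only, controlled by the others: it commutes with the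
multiplication by functions that do not depend on the qubits in `S`. -/
def Comm (S : Q → Prop) (C : Circuit Q) : Prop :=
  ∀ h : (Q → Fin 2) → ℂ, (∀ t, S t → ∀ x b, h (Function.update x t b) = h x) →
    ∀ ψ, run C (fun x => h x * ψ x) = fun x => h x * run C ψ x

theorem Comm.append {S : Q → Prop} {C D : Circuit Q} (hC : Comm S C) (hD : Comm S D) :
    Comm S (C ++ D) := by
  intro h hh ψ
  rw [run_append, hC h hh, hD h hh, run_append]

theorem Comm.mono {S S' : Q → Prop} {C : Circuit Q} (hC : Comm S C) (hS : ∀ q, S q → S' q) :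
    Comm S' C := fun h hh => hC h fun t ht => hh t (hS t ht)

theorem Comm.inv {S : Q → Prop} {C : Circuit Q} (hC : Comm S C) : Comm S (invC C) := by
  intro h hh ψ
  have := hC h hh (run (invC C) ψ)
  rw [run_run_invC] at this
  rw [← this, run_invC_run]

theorem Comm.nil (S : Q → Prop) : Comm S ([] : Circuit Q) := by
  intro h _ ψ
  rw [run_nil, run_nil]

theorem Comm.flatMap {ι : Type} {S : Q → Prop} (L : List ι) {f : ι → Circuit Q}
    (h : ∀ i ∈ L, Comm S (f i)) : Comm S (L.flatMap f) := by
  induction L with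
  | nil => exact Comm.nil S
  | cons a L ih =>
    rw [List.flatMap_cons]
    exact (h a (by simp)).append (ih fun i hi => h i (by simp [hi]))

theorem TargetsIn.comm {S : Q → Prop} {C : Circuit Q} (hC : TargetsIn S C) : Comm S C :=
  fun h hh ψ => run_mul hC h hh ψ

/-- The circuit is the identity if the control qubit `e` is zero. -/
def IdOff (e : Q) (C : Circuit Q) : Prop :=
  ∀ ψ : (Q → Fin 2) → ℂ, (∀ x, x e = 1 → ψ x = 0) → run C ψ = ψ

theorem IdOff.append {e : Q} {C D : Circuit Q} (hC : IdOff e C) (hD : IdOff e D) :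
    IdOff e (C ++ D) := by
  intro ψ hψ
  rw [run_append, hC ψ hψ, hD ψ hψ]

theorem IdOff.inv {e : Q} {C : Circuit Q} (hC : IdOff e C) : IdOff e (invC C) := by
  intro ψ hψ
  conv_lhs => rw [← hC ψ hψ]
  rw [run_invC_run]

theorem IdOff.nil (e : Q) : IdOff e ([] : Circuit Q) := fun ψ _ => run_nil ψ

theorem IdOff.flatMap {ι : Type} {e : Q} (L : List ι) {f : ι → Circuit Q}
    (h : ∀ i ∈ L, IdOff e (f i)) : IdOff e (L.flatMap f) := by
  induction L with
  | nil => exact IdOff.nil e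
  | cons a L ih =>
    rw [List.flatMap_cons]
    exact (h a (by simp)).append (ih fun i hi => h i (by simp [hi]))

theorem comm_diagC (t₀ : Q) {L : List Q} (hL : L.Nodup) {φ : (Q → Fin 2) → ℝ} (hφ : BitsIn L φ)
    (S : Q → Prop) : Comm S (diagC t₀ L φ) := by
  intro h _ ψ
  funext x
  rw [run_diagC t₀ hL hφ, run_diagC t₀ hL hφ]
  ring

theorem run_flatMap_diagC {ι : Type} (t₀ : Q) (I : List ι) (L : ι → List Q)
    (φ : ι → (Q → Fin 2) → ℝ) (hL : ∀ i ∈ I, (L i).Nodup) (hφ : ∀ i ∈ I, BitsIn (L i) (φ i))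
    (ψ : (Q → Fin 2) → ℂ) (x : Q → Fin 2) :
    run (I.flatMap fun i => diagC t₀ (L i) (φ i)) ψ x =
      (I.map fun i => Complex.exp (φ i x * Complex.I)).prod * ψ x := by
  induction I generalizing ψ with
  | nil => simp [run_nil]
  | cons a I ih =>
    rw [List.flatMap_cons, run_append, ih (fun i hi => hL i (by simp [hi]))
      (fun i hi => hφ i (by simp [hi])), run_diagC t₀ (hL a (by simp)) (hφ a (by simp)),
      List.map_cons, List.prod_cons]
    ring

/-- The action of a circuit as a linear map. -/
def runL (C : Circuit Q) : Module.End ℂ ((Q → Fin 2) → ℂ) := mulVecLin (evalCircuit C)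

theorem runL_apply (C : Circuit Q) (ψ : (Q → Fin 2) → ℂ) : runL C ψ = run C ψ := rfl

open Polynomial in
-- On `u` alone, `W² + 1` acts as `2 W Y`. Thus `z + 1/z` may be replaced by `2 Y` there, although
-- this fails on the whole space.
theorem aeval_signalPoly {V : Type*} [AddCommGroup V] [Module ℂ V] (W Y : Module.End ℂ V)
    (hWY : Commute W Y) {u : V} (hu : W (W u) + u = (2 : ℂ) • W (Y u)) {q : ℕ} {P : ℝ[X]} :
    aeval W (signalPoly q P) u =
      (W ^ q) (∑ k ∈ Finset.range (q + 1), (P.coeff k : ℂ) • (Y ^ k) u) := by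
  have h2 : ∀ k : ℕ, ((W ^ 2 + 1 : Module.End ℂ V) ^ k) u = (2 : ℂ) ^ k • (W ^ k) ((Y ^ k) u) := by
    intro k
    have e1 : (W ^ 2 + 1 : Module.End ℂ V) u = ((2 : ℂ) • (W * Y)) u := by
      rw [pow_two, LinearMap.add_apply, Module.End.mul_apply, Module.End.one_apply, hu,
        LinearMap.smul_apply, Module.End.mul_apply]
    have c2 : Commute (W ^ 2 + 1 : Module.End ℂ V) ((2 : ℂ) • (W * Y)) :=
      Commute.smul_right ((((Commute.refl W).pow_left 2).mul_right
        (hWY.pow_left 2)).add_left (Commute.one_left _)) _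
    -- The relation is known only on `u`, so in each step one factor is applied to `u` and the
    -- resulting operator is moved past the others by commutation.
    have e2 : ((W ^ 2 + 1 : Module.End ℂ V) ^ k) u = (((2 : ℂ) • (W * Y)) ^ k) u := by
      induction k with
      | zero => simp
      | succ k ih =>
        rw [pow_succ, Module.End.mul_apply, e1, ← Module.End.mul_apply, (c2.pow_left k).eq,
          Module.End.mul_apply, ih, ← Module.End.mul_apply, ← pow_succ']
    rw [e2, _root_.smul_pow, hWY.mul_pow, LinearMap.smul_apply, Module.End.mul_apply]
  rw [signalPoly, map_sum, LinearMap.sum_apply, map_sum]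
  refine Finset.sum_congr rfl fun k hk => ?_
  rw [Finset.mem_range] at hk
  have h3 : aeval W (C ((P.coeff k / 2 ^ k : ℝ) : ℂ) * ((X ^ 2 + 1) ^ k * X ^ (q - k)) : ℂ[X]) =
      ((P.coeff k / 2 ^ k : ℝ) : ℂ) • (W ^ (q - k) * (W ^ 2 + 1 : Module.End ℂ V) ^ k) := by
    rw [mul_comm ((X ^ 2 + 1 : ℂ[X]) ^ k), map_mul, aeval_C, map_mul, map_pow, map_pow, aeval_X,
      map_add, map_pow, aeval_X, map_one, Algebra.algebraMap_eq_smul_one, smul_mul_assoc, one_mul]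
  rw [h3, LinearMap.smul_apply, Module.End.mul_apply, h2, map_smul, smul_smul, map_smul]
  congr 1
  · push_cast
    field_simp
  · rw [← Module.End.mul_apply, ← pow_add, Nat.sub_add_cancel (by omega)]

end Signal

end QBlock

end

noncomputable section

namespace QBlock

/-! ### The grid coordinate as a convex combination of signs -/

section Walk

set_option linter.unusedSectionVars false

variable {Q : Type} [Fintype Q] [DecidableEq Q]

theorem val_ofFn {n : ℕ} (g : Fin n → Q) (x : Q → Fin 2) :
    val (List.ofFn g) x = ∑ i : Fin n, (x (g i) : ℕ) * 2 ^ (i : ℕ) := by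
  induction n with
  | zero => simp [val]
  | succ n ih =>
    rw [List.ofFn_succ, val, ih, Fin.sum_univ_succ, Finset.mul_sum]
    simp only [Fin.val_zero, pow_zero, mul_one, Fin.val_succ]
    congr 1
    refine Finset.sum_congr rfl fun i _ => ?_
    rw [pow_succ]; ring

theorem val_eq_zero_iff {L : List Q} {x : Q → Fin 2} : val L x = 0 ↔ ∀ q ∈ L, x q = 0 := by
  induction L with
  | nil => simp [val]
  | cons t L ih =>
    rw [val, List.forall_mem_cons, ← ih, ← Fin.val_eq_zero_iff]
    omega

theorem exp_ite_pi (p : Prop) [Decidable p] :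
    Complex.exp (((if p then Real.pi else 0 : ℝ) : ℂ) * Complex.I) = if p then -1 else 1 := by
  split_ifs
  · exact Complex.exp_pi_mul_I
  · simp

/-- The weights of the decomposition of the coordinate into signs. -/
def weight (n : ℕ) (a b : ℝ) : ℕ → ℝ
  | 0 => (1 + a) / 2
  | 1 => (1 - b) / 2
  | r + 2 => if r < n then gridStep n a b * 2 ^ r / 2 else 0

/-- The signs of the decomposition of the coordinate. -/
def wsign {n : ℕ} (g : Fin n → Q) (r : ℕ) (x : Q → Fin 2) : ℂ :=
  (if r = 1 then -1 else 1) * ∏ i : Fin n, if r = (i : ℕ) + 2 ∧ x (g i) = 0 then -1 else 1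

theorem wsign_mul_self {n : ℕ} (g : Fin n → Q) (r : ℕ) (x : Q → Fin 2) :
    wsign g r x * wsign g r x = 1 := by
  have h : ∀ (p : Prop) [Decidable p], (if p then (-1 : ℂ) else 1) * (if p then -1 else 1) = 1 := by
    intro p _; split_ifs <;> simp
  rw [wsign, mul_mul_mul_comm, h, ← Finset.prod_mul_distrib, one_mul]
  exact Finset.prod_eq_one fun i _ => h _

theorem gridStep_mul {n : ℕ} (hn : 1 ≤ n) (a b : ℝ) : gridStep n a b * (2 ^ n - 1) = b - a := by
  rw [gridStep, div_mul_cancel₀]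
  have : (2 : ℝ) ^ 1 ≤ 2 ^ n := pow_le_pow_right₀ (by norm_num) hn
  linarith

theorem weight_nonneg {n : ℕ} {a b : ℝ} (ha : -1 ≤ a) (hab : a ≤ b) (hb : b ≤ 1) (r : ℕ) :
    0 ≤ weight n a b r := by
  have h1 : 0 ≤ gridStep n a b := by
    rw [gridStep]
    apply div_nonneg (by linarith)
    have : (1 : ℝ) ≤ 2 ^ n := one_le_pow₀ (by norm_num)
    linarith
  match r with
  | 0 => rw [weight]; linarith
  | 1 => rw [weight]; linarith
  | r + 2 => rw [weight]; split_ifs <;> positivity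

/-- The work register has `N = 2^w` states, of which only `n + 2` carry a weight; the others are
padded by zeros. -/
theorem sum_weight_mul {n N : ℕ} (hN : n + 2 ≤ N) (a b : ℝ) (F : ℕ → ℂ) :
    ∑ r ∈ Finset.range N, (weight n a b r : ℂ) * F r =
      ((1 + a) / 2 : ℝ) * F 0 + ((1 - b) / 2 : ℝ) * F 1 +
        ∑ i ∈ Finset.range n, ((gridStep n a b * 2 ^ i / 2 : ℝ) : ℂ) * F (i + 2) := by
  obtain ⟨k, rfl⟩ := Nat.exists_eq_add_of_le hN
  rw [show n + 2 + k = n + k + 1 + 1 by ring, Finset.sum_range_succ', Finset.sum_range_succ',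
    Finset.sum_range_add]
  have h1 : ∑ x ∈ Finset.range k, (weight n a b (n + x + 1 + 1) : ℂ) * F (n + x + 1 + 1) = 0 := by
    refine Finset.sum_eq_zero fun x _ => ?_
    rw [weight, if_neg (by omega)]; simp
  have h2 : ∑ x ∈ Finset.range n, (weight n a b (x + 1 + 1) : ℂ) * F (x + 1 + 1) =
      ∑ i ∈ Finset.range n, ((gridStep n a b * 2 ^ i / 2 : ℝ) : ℂ) * F (i + 2) := by
    refine Finset.sum_congr rfl fun x hx => ?_
    rw [weight, if_pos (Finset.mem_range.1 hx)]
  rw [h1, h2]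
  simp only [weight, zero_add]
  ring

theorem geom_two (n : ℕ) : ∑ i ∈ Finset.range n, (2 : ℂ) ^ i = 2 ^ n - 1 := by
  have := geom_sum_eq (x := (2 : ℂ)) (by norm_num) n
  rw [this]; norm_num

/-- The digits contribute `Δx (2^n - 1) / 2 = (b - a) / 2`, and `(1 + a)/2 + (1 - b)/2` is the
complement to 1. This is where the two constant signs come from. -/
theorem sum_weight {n N : ℕ} (hn : 1 ≤ n) (hN : n + 2 ≤ N) (a b : ℝ) :
    ∑ r ∈ Finset.range N, weight n a b r = 1 := by
  have h := sum_weight_mul hN a b (fun _ => 1)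
  have h1 : ∑ i ∈ Finset.range n, ((gridStep n a b * 2 ^ i / 2 : ℝ) : ℂ) * 1 =
      ((b - a) / 2 : ℝ) := by
    rw [← gridStep_mul hn]
    push_cast
    rw [← geom_two, Finset.mul_sum, Finset.sum_div]
    exact Finset.sum_congr rfl fun i _ => by ring
  rw [h1] at h
  simp only [mul_one] at h
  have h2 : ((∑ r ∈ Finset.range N, weight n a b r : ℝ) : ℂ) = ((1 : ℝ) : ℂ) := by
    rw [Complex.ofReal_sum, h]; push_cast; ring
  exact_mod_cast h2

/-- Writing a bit as `(1 + sign)/2`, the digits give `val · Δx - (b - a)/2`, and the constant signs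
add `(a + b)/2`. -/
theorem sum_weight_wsign {n N : ℕ} (hn : 1 ≤ n) (hN : n + 2 ≤ N) (a b : ℝ) (g : Fin n → Q)
    (x : Q → Fin 2) :
    ∑ r ∈ Finset.range N, (weight n a b r : ℂ) * wsign g r x =
      ((a + val (List.ofFn g) x * gridStep n a b : ℝ) : ℂ) := by
  rw [sum_weight_mul hN]
  have h0 : wsign g 0 x = 1 := by
    rw [wsign, if_neg (by norm_num), one_mul]
    exact Finset.prod_eq_one fun i _ => if_neg (by omega)
  have h1 : wsign g 1 x = -1 := by
    rw [wsign, if_pos rfl, Finset.prod_eq_one fun i _ => if_neg (by omega), mul_one]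
  have h2 : ∀ i : Fin n, wsign g (i + 2) x = 2 * ((x (g i) : ℕ) : ℂ) - 1 := by
    intro i
    rw [wsign, if_neg (by omega), one_mul, Finset.prod_eq_single i]
    · rcases fin2_cases (x (g i)) with h | h <;> simp [h]; norm_num
    · intro j _ hj
      rw [if_neg]
      rintro ⟨h, -⟩
      exact hj (Fin.ext (by omega))
    · simp
  have hg := gridStep_mul hn a b
  have hg' : (gridStep n a b : ℂ) * (2 ^ n - 1) = b - a := by exact_mod_cast hg
  rw [h0, h1, Finset.sum_range, Finset.sum_congr rfl fun i _ => by rw [h2 i], val_ofFn]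
  have h3 : ∑ i : Fin n, ((gridStep n a b * 2 ^ (i : ℕ) / 2 : ℝ) : ℂ) *
      (2 * ((x (g i) : ℕ) : ℂ) - 1) = (gridStep n a b : ℂ) *
        ∑ i : Fin n, ((x (g i) : ℕ) : ℂ) * 2 ^ (i : ℕ) - (gridStep n a b : ℂ) * (2 ^ n - 1) / 2 := by
    rw [← geom_two, Finset.sum_range, Finset.mul_sum, Finset.mul_sum, Finset.sum_div,
      ← Finset.sum_sub_distrib]
    refine Finset.sum_congr rfl fun i _ => ?_
    push_cast
    ring
  rw [h3, hg']
  push_cast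
  ring

end Walk

end QBlock

end

noncomputable section

namespace QBlock

/-! ### States with a signal flag, controlled flag gates, and the walk -/

section Gadget

set_option linter.unusedSectionVars false

variable {Q : Type} [Fintype Q] [DecidableEq Q]

/-- The state with the component `u₀` if the qubit `f` is zero, and `u₁` otherwise. -/
def joinF (f : Q) (u₀ u₁ : (Q → Fin 2) → ℂ) : (Q → Fin 2) → ℂ :=
  fun x => if x f = 0 then u₀ x else u₁ x

theorem update_of_sep {S : Q → Prop} {q t : Q} (hq : ¬ S q) (ht : S t) (x : Q → Fin 2)
    (b : Fin 2) : Function.update x t b q = x q := by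
  rw [Function.update_of_ne]
  rintro rfl
  exact hq ht

theorem Comm.run_joinF {S : Q → Prop} {C : Circuit Q} (hC : Comm S C) {f : Q} (hf : ¬ S f)
    (u₀ u₁ : (Q → Fin 2) → ℂ) : run C (joinF f u₀ u₁) = joinF f (run C u₀) (run C u₁) := by
  have h1 := hC (fun x => if x f = 0 then 1 else 0) (fun t ht x b => by
    simp only [update_of_sep hf ht]) u₀
  have h2 := hC (fun x => if x f = 0 then 0 else 1) (fun t ht x b => by
    simp only [update_of_sep hf ht]) u₁
  have h3 : joinF f u₀ u₁ = (fun x => (if x f = 0 then 1 else 0) * u₀ x) +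
      (fun x => (if x f = 0 then 0 else 1) * u₁ x) := by
    funext x; rw [joinF, Pi.add_apply]; split_ifs <;> simp
  rw [h3, run_add, h1, h2]
  funext x; rw [joinF, Pi.add_apply]; split_ifs <;> simp

/-- A commuting circuit preserves supports. -/
theorem Comm.support {S : Q → Prop} {C : Circuit Q} (hC : Comm S C) {p : (Q → Fin 2) → Prop}
    (hp : ∀ t, S t → ∀ x b, p (Function.update x t b) ↔ p x) {ψ : (Q → Fin 2) → ℂ}
    (hψ : ∀ x, ¬ p x → ψ x = 0) (x : Q → Fin 2) (hx : ¬ p x) : run C ψ x = 0 := by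
  classical
  have h1 := hC (fun x => if p x then 1 else 0) (fun t ht x b => by simp only [hp t ht]) ψ
  have h2 : (fun x => (if p x then 1 else 0) * ψ x) = ψ := by
    funext x
    by_cases h : p x
    · simp [h]
    · simp [h, hψ x h]
  rw [h2] at h1
  rw [h1]
  simp [hx]

/-- The state does not depend on the qubit `f` and vanishes if the control `e` is zero. -/
structure GoodState (e f : Q) (u : (Q → Fin 2) → ℂ) : Prop where
  indep : ∀ x b, u (Function.update x f b) = u x
  supp : ∀ x, x e = 0 → u x = 0

theorem GoodState.comb {e f : Q} {u v : (Q → Fin 2) → ℂ} (hu : GoodState e f u)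
    (hv : GoodState e f v) (a b : ℂ) : GoodState e f (a • u + b • v) :=
  ⟨fun x c => by simp [hu.indep, hv.indep], fun x hx => by simp [hu.supp x hx, hv.supp x hx]⟩

theorem goodState_zero (e f : Q) : GoodState e f (0 : (Q → Fin 2) → ℂ) :=
  ⟨fun _ _ => rfl, fun _ _ => rfl⟩

/-- The gate `diag(e^{iα}, e^{iβ}) R(θ)` on `f`, controlled by `e`. -/
def gateC (e f : Q) (θ α β : ℝ) : Circuit Q :=
  muxY [e] f (fun x => if x e = 1 then θ else 0) ++
    diagC f [e, f] (fun x => if x e = 1 then (if x f = 0 then α else β) else 0)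

theorem cost_gateC (e f : Q) (θ α β : ℝ) : CostLE (gateC e f θ α β) 8 4 :=
  ((cost_muxY _ _ _).append (cost_diagC _ _ _)).mono (by simp) (by simp)

theorem run_gateC {e f : Q} (hef : e ≠ f) (θ α β : ℝ) (ψ : (Q → Fin 2) → ℂ) (x : Q → Fin 2) :
    run (gateC e f θ α β) ψ x =
      Complex.exp (((if x e = 1 then (if x f = 0 then α else β) else 0 : ℝ) : ℂ) * Complex.I) *
      run (muxY [e] f (fun x => if x e = 1 then θ else 0)) ψ x := by
  rw [gateC, run_append, run_diagC f (by simp [hef])]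
  intro x y h
  simp only [h e (by simp), h f (by simp)]

theorem bitsIn_ctrl (e : Q) (θ : ℝ) : BitsIn [e] (fun x : Q → Fin 2 => if x e = 1 then θ else 0) := by
  intro x y h
  simp only [h e (by simp)]

/-- Neither component depends on `f`, so a gate on `f` acts on the pair as a `2 × 2` matrix of
scalars. -/
theorem run_gateC_joinF {e f : Q} (hef : e ≠ f) (θ α β : ℝ) {u₀ u₁ : (Q → Fin 2) → ℂ}
    (h0 : GoodState e f u₀) (h1 : GoodState e f u₁) :
    run (gateC e f θ α β) (joinF f u₀ u₁) =
      joinF f (Complex.exp (α * Complex.I) • ((Real.cos θ : ℂ) • u₀ - (Real.sin θ : ℂ) • u₁))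
        (Complex.exp (β * Complex.I) • ((Real.sin θ : ℂ) • u₀ + (Real.cos θ : ℂ) • u₁)) := by
  funext x
  rw [run_gateC hef, run_muxY (by simpa using hef.symm) (bitsIn_ctrl e θ)]
  rcases fin2_cases (x e) with hx | hx
  · rcases fin2_cases (x f) with hf | hf <;>
      simp [joinF, hx, hf, h0.supp x hx, h1.supp x hx, h0.indep, h1.indep]
  · rcases fin2_cases (x f) with hf | hf <;>
      simp [joinF, hx, hf, h0.indep, h1.indep]

theorem idOff_gateC {e f : Q} (hef : e ≠ f) (θ α β : ℝ) : IdOff e (gateC e f θ α β) := by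
  intro ψ hψ
  funext x
  rw [run_gateC hef, run_muxY (by simpa using hef.symm) (bitsIn_ctrl e θ)]
  rcases fin2_cases (x e) with hx | hx
  · rcases fin2_cases (x f) with hf | hf
    · have hxx : Function.update x f 0 = x := by rw [← hf]; simp
      simp [hx, hf, hxx]
    · have hxx : Function.update x f 1 = x := by rw [← hf]; simp
      simp [hx, hf, hxx]
  · have h2 : ∀ b, ψ (Function.update x f b) = 0 := fun b => hψ _ (by simp [hef, hx])
    simp [h2, hψ x hx]

theorem comm_gateC {e f : Q} (hef : e ≠ f) (θ α β : ℝ) : Comm (· = f) (gateC e f θ α β) := by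
  refine (targets_muxY _ _ _).comm.append (comm_diagC f (by simp [hef]) ?_ _)
  intro x y h
  simp only [h e (by simp), h f (by simp)]

/-! ### The walk operator -/

/-- The controlled signs, on the control qubits `e`, `f`, the work qubits and the coordinate. -/
def condSel {n : ℕ} (cnd : (Q → Fin 2) → Bool) (e f : Q) (work : List Q) (g : Fin n → Q) :
    Circuit Q :=
  diagC f (e :: f :: work) (fun x => if cnd x = true ∧ val work x = 1 then Real.pi else 0) ++
    (List.finRange n).flatMap fun i => diagC f (g i :: e :: f :: work) (fun x =>
      if cnd x = true ∧ val work x = (i : ℕ) + 2 ∧ x (g i) = 0 then Real.pi else 0)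

/-- The controlled reflection at the zero state of the work qubits. -/
def condRefl (cnd : (Q → Fin 2) → Bool) (e f : Q) (work : List Q) : Circuit Q :=
  diagC f (e :: f :: work) (fun x => if cnd x = true ∧ val work x ≠ 0 then Real.pi else 0)

/-- The preparation of the weights. -/
def weightC (n : ℕ) (a b : ℝ) (work : List Q) : Circuit Q :=
  prepC work (fun x => Real.sqrt (weight n a b (val work x)))

/-- The controlled walk operator. -/
def walkC {n : ℕ} (a b : ℝ) (cnd : (Q → Fin 2) → Bool) (e f : Q) (work : List Q) (g : Fin n → Q) :
    Circuit Q :=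
  weightC n a b work ++ (condSel cnd e f work g ++ (invC (weightC n a b work) ++
    condRefl cnd e f work))

/-- The inverse of the controlled walk operator. -/
def walkInvC {n : ℕ} (a b : ℝ) (cnd : (Q → Fin 2) → Bool) (e f : Q) (work : List Q)
    (g : Fin n → Q) : Circuit Q :=
  condRefl cnd e f work ++ (weightC n a b work ++ (condSel cnd e f work g ++
    invC (weightC n a b work)))

variable {n : ℕ} {a b : ℝ} {e f : Q} {work : List Q} {g : Fin n → Q}

theorem run_condRefl (hnd : (e :: f :: work).Nodup) {cnd : (Q → Fin 2) → Bool}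
    (hc : BitsIn [e, f] cnd) (ψ : (Q → Fin 2) → ℂ) (x : Q → Fin 2) :
    run (condRefl cnd e f work) ψ x =
      (if cnd x = true ∧ val work x ≠ 0 then -1 else 1) * ψ x := by
  rw [condRefl, run_diagC f hnd, exp_ite_pi]
  intro x y h
  have h1 : cnd x = cnd y := hc x y fun q hq => h q (by simp at hq ⊢; tauto)
  have h2 : val work x = val work y := val_congr fun q hq => h q (by simp [hq])
  simp only [h1, h2]

theorem run_condSel (hnd : (e :: f :: (work ++ List.ofFn g)).Nodup) {cnd : (Q → Fin 2) → Bool}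
    (hc : BitsIn [e, f] cnd) (ψ : (Q → Fin 2) → ℂ) (x : Q → Fin 2) :
    run (condSel cnd e f work g) ψ x =
      (if cnd x = true then wsign g (val work x) x else 1) * ψ x := by
  have hc' : ∀ L : List Q, e ∈ L → f ∈ L → ∀ x y : Q → Fin 2, (∀ q ∈ L, x q = y q) →
      cnd x = cnd y := by
    intro L he hf x y h
    refine hc x y fun q hq => ?_
    simp only [List.mem_cons, List.not_mem_nil, or_false] at hq
    rcases hq with rfl | rfl
    · exact h _ he
    · exact h _ hf
  simp only [List.nodup_cons, List.mem_cons, List.mem_append, not_or, List.nodup_append,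
    List.mem_ofFn] at hnd
  obtain ⟨⟨hef, hew, heg⟩, ⟨hfw, hfg⟩, hw, hg, hwg⟩ := hnd
  rw [condSel, run_append, run_flatMap_diagC, run_diagC, exp_ite_pi]
  · simp only [exp_ite_pi]
    rw [← Fin.prod_univ_def]
    cases h : cnd x
    · simp
    · simp only [true_and, if_true, wsign]
      ring
  · simp [hef, hew, hfw, hw]
  · intro x y h
    have h1 := hc' _ (by simp) (by simp) x y h
    have h2 : val work x = val work y := val_congr fun q hq => h q (by simp [hq])
    simp only [h1, h2]
  · intro i _
    simp only [List.nodup_cons, List.mem_cons, not_or]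
    refine ⟨⟨fun h => heg ⟨i, h⟩, fun h => hfg ⟨i, h⟩, ?_⟩, ⟨hef, hew⟩, hfw, hw⟩
    exact fun h => hwg _ h _ ⟨i, rfl⟩ rfl
  · intro i _ x y h
    have h1 := hc' _ (by simp) (by simp) x y h
    have h2 : val work x = val work y := val_congr fun q hq => h q (by simp [hq])
    have h3 := h (g i) (by simp)
    simp only [h1, h2, h3]

theorem comm_condRefl (hnd : (e :: f :: work).Nodup) {cnd : (Q → Fin 2) → Bool}
    (hc : BitsIn [e, f] cnd) (S : Q → Prop) : Comm S (condRefl cnd e f work) := by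
  intro h _ ψ
  funext x
  rw [run_condRefl hnd hc, run_condRefl hnd hc]; ring

theorem comm_condSel (hnd : (e :: f :: (work ++ List.ofFn g)).Nodup) {cnd : (Q → Fin 2) → Bool}
    (hc : BitsIn [e, f] cnd) (S : Q → Prop) : Comm S (condSel cnd e f work g) := by
  intro h _ ψ
  funext x
  rw [run_condSel hnd hc, run_condSel hnd hc]; ring

theorem comm_weightC : Comm (· ∈ work) (weightC n a b work) := (targets_prepC _ _).comm

theorem nodup_ctrl_work (hnd : (e :: f :: (work ++ List.ofFn g)).Nodup) :
    (e :: f :: work).Nodup := by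
  simp only [List.nodup_cons, List.mem_cons, List.mem_append, not_or, List.nodup_append] at hnd ⊢
  tauto

theorem comm_walkC (hnd : (e :: f :: (work ++ List.ofFn g)).Nodup) {cnd : (Q → Fin 2) → Bool}
    (hc : BitsIn [e, f] cnd) : Comm (· ∈ work) (walkC a b cnd e f work g) :=
  comm_weightC.append ((comm_condSel hnd hc _).append (comm_weightC.inv.append
    (comm_condRefl (nodup_ctrl_work hnd) hc _)))

theorem comm_walkInvC (hnd : (e :: f :: (work ++ List.ofFn g)).Nodup) {cnd : (Q → Fin 2) → Bool}
    (hc : BitsIn [e, f] cnd) : Comm (· ∈ work) (walkInvC a b cnd e f work g) :=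
  (comm_condRefl (nodup_ctrl_work hnd) hc _).append (comm_weightC.append
    ((comm_condSel hnd hc _).append comm_weightC.inv))

theorem cost_condRefl (cnd : (Q → Fin 2) → Bool) :
    CostLE (condRefl cnd e f work) (4 * 2 ^ work.length) (8 * 2 ^ work.length) := by
  refine (cost_diagC _ _ _).mono ?_ ?_ <;> simp only [List.length_cons, pow_succ] <;> omega

theorem cost_condSel (cnd : (Q → Fin 2) → Bool) :
    CostLE (condSel cnd e f work g) ((8 * n + 4) * 2 ^ work.length)
      ((16 * n + 8) * 2 ^ work.length) := by
  refine ((cost_diagC _ _ _).append (CostLE.flatMap _ _ (8 * 2 ^ work.length) (16 * 2 ^ work.length)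
    fun i _ => (cost_diagC _ _ _).mono ?_ ?_)).mono ?_ ?_
  · simp only [List.length_cons, pow_succ]; omega
  · simp only [List.length_cons, pow_succ]; omega
  · simp only [List.length_cons, pow_succ, List.length_finRange]; apply le_of_eq; ring
  · simp only [List.length_cons, pow_succ, List.length_finRange]
    refine (Nat.add_le_add_right ((Nat.sub_le _ _).trans (Nat.sub_le _ _)) _).trans (le_of_eq ?_)
    ring

theorem cost_weightC : CostLE (weightC n a b work) (2 ^ work.length + 2 * work.length)
    (2 * 2 ^ work.length) :=
  (cost_prepC _ _).mono le_rfl (by rw [pow_succ, mul_comm])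

theorem cost_walkC (cnd : (Q → Fin 2) → Bool) :
    CostLE (walkC a b cnd e f work g) ((8 * n + 10) * 2 ^ work.length + 4 * work.length)
      ((16 * n + 20) * 2 ^ work.length) := by
  refine (cost_weightC.append ((cost_condSel cnd).append (cost_weightC.inv.append
    (cost_condRefl cnd)))).mono ?_ ?_ <;> apply le_of_eq <;> ring

theorem cost_walkInvC (cnd : (Q → Fin 2) → Bool) :
    CostLE (walkInvC a b cnd e f work g) ((8 * n + 10) * 2 ^ work.length + 4 * work.length)
      ((16 * n + 20) * 2 ^ work.length) := by
  refine ((cost_condRefl cnd).append (cost_weightC.append ((cost_condSel cnd).append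
    cost_weightC.inv))).mono ?_ ?_ <;> apply le_of_eq <;> ring

theorem run_condSel_condSel (hnd : (e :: f :: (work ++ List.ofFn g)).Nodup)
    {cnd : (Q → Fin 2) → Bool} (hc : BitsIn [e, f] cnd) (ψ : (Q → Fin 2) → ℂ) :
    run (condSel cnd e f work g) (run (condSel cnd e f work g) ψ) = ψ := by
  funext x
  rw [run_condSel hnd hc, run_condSel hnd hc, ← mul_assoc]
  split_ifs
  · rw [wsign_mul_self, one_mul]
  · simp

theorem run_condRefl_condRefl (hnd : (e :: f :: work).Nodup)
    {cnd : (Q → Fin 2) → Bool} (hc : BitsIn [e, f] cnd) (ψ : (Q → Fin 2) → ℂ) :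
    run (condRefl cnd e f work) (run (condRefl cnd e f work) ψ) = ψ := by
  funext x
  rw [run_condRefl hnd hc, run_condRefl hnd hc, ← mul_assoc]
  split_ifs <;> simp

theorem run_walkInvC_walkC (hnd : (e :: f :: (work ++ List.ofFn g)).Nodup)
    {cnd : (Q → Fin 2) → Bool} (hc : BitsIn [e, f] cnd) (ψ : (Q → Fin 2) → ℂ) :
    run (walkInvC a b cnd e f work g) (run (walkC a b cnd e f work g) ψ) = ψ := by
  rw [walkC, walkInvC]
  simp only [run_append]
  rw [run_condRefl_condRefl (nodup_ctrl_work hnd) hc, run_run_invC, run_condSel_condSel hnd hc,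
    run_invC_run]

theorem run_walkC_walkInvC (hnd : (e :: f :: (work ++ List.ofFn g)).Nodup)
    {cnd : (Q → Fin 2) → Bool} (hc : BitsIn [e, f] cnd) (ψ : (Q → Fin 2) → ℂ) :
    run (walkC a b cnd e f work g) (run (walkInvC a b cnd e f work g) ψ) = ψ := by
  rw [walkC, walkInvC]
  simp only [run_append]
  rw [run_run_invC, run_condSel_condSel hnd hc, run_invC_run,
    run_condRefl_condRefl (nodup_ctrl_work hnd) hc]

/-- The control condition `e = 1`. -/
def cndE (e : Q) : (Q → Fin 2) → Bool := fun x => decide (x e = 1)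

/-- The control condition `e = 1`, `f = 0`. -/
def cndEF (e f : Q) : (Q → Fin 2) → Bool := fun x => decide (x e = 1 ∧ x f = 0)

theorem bitsIn_cndE : BitsIn [e, f] (cndE e) := by
  intro x y h
  simp only [cndE, h e (by simp)]

theorem bitsIn_cndEF : BitsIn [e, f] (cndEF e f) := by
  intro x y h
  simp only [cndEF, h e (by simp), h f (by simp)]

/-- The weight preparation is not controlled; with the signs and the reflection switched off it
meets its inverse and cancels. -/
theorem idOff_walk (hnd : (e :: f :: (work ++ List.ofFn g)).Nodup)
    {cnd : (Q → Fin 2) → Bool} (hc : BitsIn [e, f] cnd) (hce : ∀ x, cnd x = true → x e = 1) :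
    IdOff e (walkC a b cnd e f work g) ∧ IdOff e (walkInvC a b cnd e f work g) := by
  have hS : IdOff e (condSel cnd e f work g) := by
    intro ψ hψ
    funext x
    rw [run_condSel hnd hc]
    split_ifs with h
    · rw [hψ x (hce x h), mul_zero]
    · rw [one_mul]
  have hR : IdOff e (condRefl cnd e f work) := by
    intro ψ hψ
    funext x
    rw [run_condRefl (nodup_ctrl_work hnd) hc]
    split_ifs with h
    · rw [hψ x (hce x h.1), mul_zero]
    · rw [one_mul]
  have hew : e ∉ work := by
    have := nodup_ctrl_work hnd
    simp only [List.nodup_cons, List.mem_cons, not_or] at this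
    exact this.1.2
  have hV : ∀ ψ : (Q → Fin 2) → ℂ, (∀ x, x e = 1 → ψ x = 0) → ∀ x, x e = 1 →
      run (weightC n a b work) ψ x = 0 := by
    intro ψ hψ x hx
    refine (comm_weightC (n := n) (a := a) (b := b) (work := work)).support
      (p := fun x => ¬ x e = 1) ?_ ?_ x (by simpa using hx)
    · intro t ht x b
      rw [update_of_sep (S := (· ∈ work)) hew ht]
    · intro x hx
      exact hψ x (by simpa using hx)
  constructor
  · intro ψ hψ
    rw [walkC, run_append, run_append, run_append, hS _ (hV ψ hψ), run_invC_run, hR ψ hψ]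
  · intro ψ hψ
    rw [walkInvC, run_append, run_append, run_append, hR ψ hψ, hS _ (hV ψ hψ), run_invC_run]

/-- The walk operator block-encodes the coordinate. -/
theorem run_walkC_add (hnd : (e :: f :: (work ++ List.ofFn g)).Nodup) (hn : 1 ≤ n)
    (hw : n + 2 ≤ 2 ^ work.length) (ha : -1 ≤ a) (hab : a ≤ b) (hb : b ≤ 1)
    {u : (Q → Fin 2) → ℂ} (hu : ∀ x, u x ≠ 0 → x e = 1 ∧ val work x = 0) :
    run (walkC a b (cndE e) e f work g) u + run (walkInvC a b (cndE e) e f work g) u =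
      fun x => 2 * ((a + val (List.ofFn g) x * gridStep n a b : ℝ) : ℂ) * u x := by
  have hnd' := hnd
  simp only [List.nodup_cons, List.mem_cons, List.mem_append, not_or, List.nodup_append,
    List.mem_ofFn] at hnd'
  obtain ⟨⟨hef, hew, heg⟩, ⟨hfw, hfg⟩, hwn, hg, hwg⟩ := hnd'
  have hρ : BitsIn work (fun x => Real.sqrt (weight n a b (val work x))) := by
    intro x y h
    simp only [val_congr h]
  have h1 : ∀ x, sumL work (fun y => Real.sqrt (weight n a b (val work y)) ^ 2) x = 1 := by
    intro x
    rw [sumL_val hwn (fun r => Real.sqrt (weight n a b r) ^ 2)]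
    rw [Finset.sum_congr rfl fun r _ => Real.sq_sqrt (weight_nonneg ha hab hb r)]
    exact sum_weight hn hw a b
  have hu0 : ∀ x, (∃ q ∈ work, x q ≠ 0) → u x = 0 := by
    rintro x ⟨q, hq, hx⟩
    by_contra h
    exact hx (val_eq_zero_iff.1 (hu x h).2 q hq)
  have hue : ∀ x, ¬ x e = 1 → u x = 0 := fun x hx => by
    by_contra h
    exact hx (hu x h).1
  have hRu : run (condRefl (cndE e) e f work) u = u := by
    funext x
    rw [run_condRefl (nodup_ctrl_work hnd) bitsIn_cndE]
    by_cases h : u x = 0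
    · simp [h]
    · simp [(hu x h).2]
  -- With `v = V† S V u` and a reflection fixing `u`, the walk gives `R v` and its inverse gives
  -- `v`. The sum doubles the part of `v` with zero work qubits and kills the rest.
  obtain ⟨v, hv⟩ : ∃ v, v = run (invC (weightC n a b work)) (run (condSel (cndE e) e f work g)
    (run (weightC n a b work) u)) := ⟨_, rfl⟩
  have hve : ∀ x, ¬ x e = 1 → v x = 0 := by
    intro x hx
    rw [hv, ← run_append, ← run_append]
    refine ((comm_weightC (n := n) (a := a) (b := b)).append
      ((comm_condSel hnd bitsIn_cndE _).append comm_weightC.inv)).support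
      (p := fun x => x e = 1) ?_ hue x hx
    intro t ht x b
    rw [update_of_sep (S := (· ∈ work)) hew ht]
  -- The matrix element of the signs between two copies of the prepared weights is the weighted mean
  -- of the signs.
  have hvx : ∀ x, x e = 1 → val work x = 0 →
      v x = ((a + val (List.ofFn g) x * gridStep n a b : ℝ) : ℂ) * u x := by
    intro x hx hx0
    have hxw := val_eq_zero_iff.1 hx0
    rw [hv, weightC, run_invC_prepC hwn hρ (fun _ => Real.sqrt_nonneg _) h1 _ hxw,
      ← sum_weight_wsign hn hw, Finset.sum_mul, ← sumL_val hwn (fun r =>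
        (weight n a b r : ℂ) * wsign g r x * u x) x]
    refine sumL_congr fun y hy => ?_
    have hz : zeroL work y = x := by
      funext q
      rw [zeroL]
      split_ifs with h
      · exact (hxw q h).symm
      · exact hy q h
    have hye : y e = 1 := (hy e hew).trans hx
    have hs : wsign g (val work y) y = wsign g (val work y) x := by
      have : ∀ i, y (g i) = x (g i) := fun i => hy _ fun h => hwg _ h _ ⟨i, rfl⟩ rfl
      simp only [wsign, this]
    rw [run_condSel hnd bitsIn_cndE, run_prepC hwn hρ (fun _ => Real.sqrt_nonneg _) h1 hu0, hz,
      if_pos (by simp [cndE, hye]), hs]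
    have hsq : (Real.sqrt (weight n a b (val work y)) : ℂ) *
        (Real.sqrt (weight n a b (val work y)) : ℂ) = (weight n a b (val work y) : ℂ) := by
      rw [← Complex.ofReal_mul, Real.mul_self_sqrt (weight_nonneg ha hab hb _)]
    linear_combination (wsign g (val work y) x * u x) * hsq
  rw [walkC, walkInvC]
  simp only [run_append]
  rw [hRu, ← hv]
  funext x
  rw [Pi.add_apply, run_condRefl (nodup_ctrl_work hnd) bitsIn_cndE]
  by_cases hx : x e = 1
  · by_cases hx0 : val work x = 0
    · rw [hvx x hx hx0, if_neg (by simp [hx0])]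
      ring
    · rw [if_pos ⟨by simp [cndE, hx], hx0⟩]
      have : u x = 0 := by
        by_contra h
        exact hx0 (hu x h).2
      rw [this]; ring
  · rw [hve x hx, hue x hx]; ring

end Gadget

end QBlock

end

noncomputable section

namespace QBlock

/-! ### Multiplication by a polynomial of the coordinate -/

section SignalProcessing

set_option linter.unusedSectionVars false

variable {Q : Type} [Fintype Q] [DecidableEq Q]
variable {n : ℕ} {a b : ℝ} {e f : Q} {work : List Q} {g : Fin n → Q}

theorem goodState_walkC (hnd : (e :: f :: (work ++ List.ofFn g)).Nodup) {u : (Q → Fin 2) → ℂ}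
    (hu : GoodState e f u) : GoodState e f (run (walkC a b (cndE e) e f work g) u) := by
  have hnd' := hnd
  simp only [List.nodup_cons, List.mem_cons, List.mem_append, not_or, List.nodup_append,
    List.mem_ofFn] at hnd'
  obtain ⟨⟨hef, hew, heg⟩, ⟨hfw, hfg⟩, hwn, hg, hwg⟩ := hnd'
  have key : ∀ C : Circuit Q, (∀ g ∈ C, Gate.Avoids f g) → ∀ ψ : (Q → Fin 2) → ℂ,
      (∀ x b, ψ (Function.update x f b) = ψ x) →
      ∀ x b, run C ψ (Function.update x f b) = run C ψ x := by
    intro C hC ψ hψ x b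
    have h := run_update hC b ψ
    have h2 : (fun x => ψ (Function.update x f b)) = ψ := by
      funext x; exact hψ x b
    rw [h2] at h
    exact (congrFun h x).symm
  have hval : ∀ (x : Q → Fin 2) b, val work (Function.update x f b) = val work x :=
    fun x b => val_update hfw x b
  have hcnd : ∀ (x : Q → Fin 2) b, cndE e (Function.update x f b) = cndE e x := by
    intro x b
    simp only [cndE, Function.update_of_ne hef]
  refine ⟨?_, ?_⟩
  · have hVa := avoids_prepC hfw (fun x => Real.sqrt (weight n a b (val work x)))
    have hVia : ∀ g ∈ invC (weightC n a b work), Gate.Avoids f g := by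
      intro g hg
      simp only [invC, List.mem_reverse, List.mem_map] at hg
      obtain ⟨g, hg, rfl⟩ := hg
      have := hVa g hg
      cases g <;> exact this
    rw [walkC]
    simp only [run_append]
    have hV := key (weightC n a b work) hVa u hu.indep
    -- The diagonal circuits list `f` among their qubits, so they do not avoid it syntactically;
    -- their phases do not depend on it under the condition `cndE`.
    have hS : ∀ x b', run (condSel (cndE e) e f work g) (run (weightC n a b work) u)
        (Function.update x f b') = run (condSel (cndE e) e f work g)
          (run (weightC n a b work) u) x := by
      intro x b'
      have hgx : ∀ i, Function.update x f b' (g i) = x (g i) := by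
        intro i
        rw [Function.update_of_ne]
        exact fun h => hfg ⟨i, h⟩
      rw [run_condSel hnd bitsIn_cndE, run_condSel hnd bitsIn_cndE, hV, hcnd, hval]
      simp only [wsign, hgx]
    have hI := key _ hVia _ hS
    intro x b'
    rw [run_condRefl (nodup_ctrl_work hnd) bitsIn_cndE,
      run_condRefl (nodup_ctrl_work hnd) bitsIn_cndE, hI, hcnd, hval]
  · intro x hx
    refine (comm_walkC (a := a) (b := b) hnd (bitsIn_cndE)).support (p := fun x => ¬ x e = 0)
      ?_ ?_ x (by simpa using hx)
    · intro t ht x b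
      rw [update_of_sep (S := (· ∈ work)) hew ht]
    · intro x hx
      exact hu.supp x (by simpa using hx)

/-- For `f = 1` signs and reflection are off and the preparation cancels, so the walk acts on one
component only. This realises the signal step `(p, q) ↦ (X p, q)`. -/
theorem run_walkC_joinF (hnd : (e :: f :: (work ++ List.ofFn g)).Nodup)
    (u₀ u₁ : (Q → Fin 2) → ℂ) :
    run (walkC a b (cndEF e f) e f work g) (joinF f u₀ u₁) =
      joinF f (run (walkC a b (cndE e) e f work g) u₀) u₁ := by
  have hfw : f ∉ work := by
    have := nodup_ctrl_work hnd
    simp only [List.nodup_cons] at this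
    exact this.2.1
  have hS : ∀ u v : (Q → Fin 2) → ℂ, run (condSel (cndEF e f) e f work g) (joinF f u v) =
      joinF f (run (condSel (cndE e) e f work g) u) v := by
    intro u v
    funext x
    rw [run_condSel hnd bitsIn_cndEF, joinF, joinF]
    rcases fin2_cases (x f) with hx | hx
    · rw [if_pos hx, if_pos hx, run_condSel hnd bitsIn_cndE]
      simp [cndE, cndEF, hx]
    · simp [cndEF, hx]
  have hR : ∀ u v : (Q → Fin 2) → ℂ, run (condRefl (cndEF e f) e f work) (joinF f u v) =
      joinF f (run (condRefl (cndE e) e f work) u) v := by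
    intro u v
    funext x
    rw [run_condRefl (nodup_ctrl_work hnd) bitsIn_cndEF, joinF, joinF]
    rcases fin2_cases (x f) with hx | hx
    · rw [if_pos hx, if_pos hx, run_condRefl (nodup_ctrl_work hnd) bitsIn_cndE]
      simp [cndE, cndEF, hx]
    · simp [cndEF, hx]
  rw [walkC, walkC]
  simp only [run_append]
  rw [comm_weightC.run_joinF hfw, hS, comm_weightC.inv.run_joinF hfw, hR, run_invC_run]

open Polynomial in
-- Substituting the walk for `X`, each step of `Reach` becomes a walk conditioned on `f = 0`
-- followed by a gate on `f`.
theorem exists_circuit_of_reach (hnd : (e :: f :: (work ++ List.ofFn g)).Nodup) {d : ℕ}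
    {p q : ℂ[X]} (h : Reach d p q) :
    ∃ C : Circuit Q,
      CostLE C (8 + d * ((8 * n + 10) * 2 ^ work.length + 4 * work.length + 8))
        (4 + d * ((16 * n + 20) * 2 ^ work.length + 4)) ∧
      IdOff e C ∧ Comm (fun t => t = f ∨ t ∈ work) C ∧
      ∀ u, GoodState e f u →
        GoodState e f (aeval (runL (walkC a b (cndE e) e f work g)) p u) ∧
        GoodState e f (aeval (runL (walkC a b (cndE e) e f work g)) q u) ∧
        run C (joinF f u 0) =
          joinF f (aeval (runL (walkC a b (cndE e) e f work g)) p u)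
            (aeval (runL (walkC a b (cndE e) e f work g)) q u) := by
  have hef : e ≠ f := by
    simp only [List.nodup_cons, List.mem_cons, not_or] at hnd
    exact hnd.1.1
  induction h with
  | zero θ α β =>
    refine ⟨gateC e f θ α β, (cost_gateC e f θ α β).mono (by simp) (by simp), idOff_gateC hef θ α β,
      (comm_gateC hef θ α β).mono fun q hq => Or.inl hq, fun u hu => ?_⟩
    have h0 := goodState_zero (Q := Q) e f
    simp only [aeval_C, Module.algebraMap_end_apply]
    refine ⟨?_, ?_, ?_⟩
    · have := hu.comb h0 (Complex.exp (α * Complex.I) * Real.cos θ) 0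
      simpa using this
    · have := hu.comb h0 (Complex.exp (β * Complex.I) * Real.sin θ) 0
      simpa using this
    · rw [run_gateC_joinF hef θ α β hu h0]
      simp [smul_smul]
  | succ θ α β d p q h ih =>
    obtain ⟨C, hcost, hoff, hcomm, hC⟩ := ih
    have hoffW := (idOff_walk (a := a) (b := b) hnd (bitsIn_cndEF) (fun x hx => by
      simp only [cndEF, decide_eq_true_eq] at hx
      exact hx.1)).1
    refine ⟨C ++ (walkC a b (cndEF e f) e f work g ++ gateC e f θ α β),
      (hcost.append ((cost_walkC _).append (cost_gateC e f θ α β))).mono ?_ ?_,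
      hoff.append (hoffW.append (idOff_gateC hef θ α β)),
      hcomm.append (((comm_walkC hnd bitsIn_cndEF).mono fun q hq => Or.inr hq).append
        ((comm_gateC hef θ α β).mono fun q hq => Or.inl hq)), fun u hu => ?_⟩
    · apply le_of_eq; ring
    · apply le_of_eq; ring
    obtain ⟨hp, hq, hrun⟩ := hC u hu
    have hWp := goodState_walkC (a := a) (b := b) hnd hp
    simp only [map_mul, map_sub, map_add, aeval_C, aeval_X, LinearMap.sub_apply,
      LinearMap.add_apply, Module.End.mul_apply, Module.algebraMap_end_apply, runL_apply]
    refine ⟨?_, ?_, ?_⟩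
    · have := hWp.comb hq (Complex.exp (α * Complex.I) * Real.cos θ)
        (-(Complex.exp (α * Complex.I) * Real.sin θ))
      rw [neg_smul, ← sub_eq_add_neg] at this
      rwa [smul_smul, smul_smul]
    · have := hWp.comb hq (Complex.exp (β * Complex.I) * Real.sin θ)
        (Complex.exp (β * Complex.I) * Real.cos θ)
      rwa [smul_smul, smul_smul]
    · rw [run_append, hrun, run_append, run_walkC_joinF hnd, run_gateC_joinF hef θ α β hWp hq]
      simp only [smul_sub, smul_add]

/-- Multiplication by the coordinate. -/
def coordL (n : ℕ) (a b : ℝ) (g : Fin n → Q) : Module.End ℂ ((Q → Fin 2) → ℂ) :=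
  LinearMap.mulLeft ℂ fun x => ((a + val (List.ofFn g) x * gridStep n a b : ℝ) : ℂ)

theorem coordL_pow (k : ℕ) (u : (Q → Fin 2) → ℂ) (x : Q → Fin 2) :
    (coordL n a b g ^ k) u x =
      ((a + val (List.ofFn g) x * gridStep n a b : ℝ) : ℂ) ^ k * u x := by
  induction k generalizing u with
  | zero => simp
  | succ k ih =>
    rw [pow_succ, Module.End.mul_apply, ih, coordL, LinearMap.mulLeft_apply, Pi.mul_apply]
    ring

open Polynomial in
/-- Multiplication by `P(x)` by quantum signal processing. -/
theorem exists_signal_gadget (hnd : (e :: f :: (work ++ List.ofFn g)).Nodup) (hn : 1 ≤ n)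
    (hw : n + 2 ≤ 2 ^ work.length) (ha : -1 ≤ a) (hab : a ≤ b) (hb : b ≤ 1) {q : ℕ} {P : ℝ[X]}
    (hq : P.natDegree ≤ q) (hP : ∀ x ∈ Set.Icc (-1 : ℝ) 1, |P.eval x| < 1) :
    ∃ G : Circuit Q,
      CostLE G (8 + 3 * q * ((8 * n + 10) * 2 ^ work.length + 4 * work.length + 8))
        (4 + 3 * q * ((16 * n + 20) * 2 ^ work.length + 4)) ∧
      IdOff e G ∧ Comm (fun t => t = f ∨ t ∈ work) G ∧
      ∀ ψ : (Q → Fin 2) → ℂ, (∀ x, ψ x ≠ 0 → x e = 1 ∧ x f = 0 ∧ val work x = 0) →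
        ∀ x, x f = 0 → run G ψ x =
          (P.eval (a + val (List.ofFn g) x * gridStep n a b) : ℝ) * ψ x := by
  obtain ⟨R, hR⟩ := exists_reach hq hP
  obtain ⟨C, hcost, hoff, hcomm, hC⟩ := exists_circuit_of_reach (a := a) (b := b) hnd hR
  have hnd' := hnd
  simp only [List.nodup_cons, List.mem_cons, List.mem_append, not_or, List.nodup_append,
    List.mem_ofFn] at hnd'
  obtain ⟨⟨hef, hew, heg⟩, ⟨hfw, hfg⟩, hwn, hg, hwg⟩ := hnd'
  have hoffI := (idOff_walk (a := a) (b := b) hnd (bitsIn_cndE) (fun x hx => by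
      simpa [cndE] using hx)).2
  have hcommI := comm_walkInvC (a := a) (b := b) hnd bitsIn_cndE
  -- The signal polynomial has formal degree `2q`, which takes `2q` conditioned walks; `q` inverse
  -- walks not conditioned on `f` remove the factor `W^q`. Hence `3q` walks.
  refine ⟨C ++ (List.range q).flatMap fun _ => walkInvC a b (cndE e) e f work g,
    (hcost.append (CostLE.flatMap _ _ _ _ fun _ _ => cost_walkInvC _)).mono ?_ ?_,
    hoff.append (IdOff.flatMap _ fun _ _ => hoffI),
    hcomm.append (Comm.flatMap _ fun _ _ => hcommI.mono fun q hq => Or.inr hq), ?_⟩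
  · rw [List.length_range]
    have := Nat.zero_le (8 * q)
    nlinarith
  · rw [List.length_range]
    have := Nat.zero_le (8 * q)
    nlinarith
  intro ψ hψ x hxf
  -- The component with `f = 0` is extended to be independent of `f`, as `GoodState` requires.
  obtain ⟨u, hu⟩ : ∃ u : (Q → Fin 2) → ℂ, u = fun x => ψ (Function.update x f 0) := ⟨_, rfl⟩
  have hψu : ψ = joinF f u 0 := by
    funext x
    rw [joinF, hu]
    rcases fin2_cases (x f) with h | h
    · have hxx : Function.update x f 0 = x := by rw [← h]; simp
      simp [h, hxx]
    · rw [if_neg (by simp [h])]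
      by_contra h'
      have := (hψ x h').2.1
      rw [h] at this
      simp at this
  have hsupp : ∀ x, u x ≠ 0 → x e = 1 ∧ val work x = 0 := by
    intro x hx
    rw [hu] at hx
    obtain ⟨h1, -, h2⟩ := hψ _ hx
    rw [Function.update_of_ne hef] at h1
    rw [val_update hfw] at h2
    exact ⟨h1, h2⟩
  have hgood : GoodState e f u := by
    refine ⟨fun x b => by rw [hu]; simp, fun x hx => ?_⟩
    by_contra h
    rw [(hsupp x h).1] at hx
    simp at hx
  obtain ⟨-, -, hrun⟩ := hC u hgood
  have hW : ∀ v, runL (walkC a b (cndE e) e f work g) (run (walkInvC a b (cndE e) e f work g) v) =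
      v := fun v => run_walkC_walkInvC hnd bitsIn_cndE v
  have hadd := run_walkC_add (f := f) hnd hn hw ha hab hb hsupp
  -- This is `W` applied to `W u + W⁻¹ u = 2 x u`.
  have hkey : runL (walkC a b (cndE e) e f work g) (runL (walkC a b (cndE e) e f work g) u) + u =
      (2 : ℂ) • runL (walkC a b (cndE e) e f work g) (coordL n a b g u) := by
    have := congrArg (runL (walkC a b (cndE e) e f work g)) hadd
    rw [map_add, hW] at this
    rw [runL_apply _ u, this, ← map_smul]
    congr 1
    funext x
    rw [coordL, Pi.smul_apply, LinearMap.mulLeft_apply, Pi.mul_apply, smul_eq_mul, mul_assoc]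
  have hcW : Commute (runL (walkC a b (cndE e) e f work g)) (coordL n a b g) := by
    refine LinearMap.ext fun v => ?_
    rw [Module.End.mul_apply, Module.End.mul_apply]
    refine comm_walkC hnd bitsIn_cndE _ (fun t ht x b' => ?_) v
    rw [val_update]
    rw [List.mem_ofFn]
    rintro ⟨i, rfl⟩
    exact hwg _ ht _ ⟨i, rfl⟩ rfl
  rw [aeval_signalPoly _ _ hcW hkey] at hrun
  -- Only the component with `f = 0` is tracked; whatever the inverse walks do for `f = 1` is
  -- flagged.
  have hpow : ∀ (k : ℕ) (v v' : (Q → Fin 2) → ℂ), ∃ v'',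
      run ((List.range k).flatMap fun _ => walkInvC a b (cndE e) e f work g)
        (joinF f ((runL (walkC a b (cndE e) e f work g) ^ k) v) v') = joinF f v v'' := by
    intro k
    induction k with
    | zero => intro v v'; exact ⟨v', by simp [run_nil]⟩
    | succ k ih =>
      intro v v'
      rw [List.range_succ_eq_map, List.flatMap_cons, List.flatMap_map, run_append,
        hcommI.run_joinF hfw, pow_succ', Module.End.mul_apply]
      have : run (walkInvC a b (cndE e) e f work g) (runL (walkC a b (cndE e) e f work g)
          ((runL (walkC a b (cndE e) e f work g) ^ k) v)) =
          (runL (walkC a b (cndE e) e f work g) ^ k) v :=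
        run_walkInvC_walkC hnd bitsIn_cndE _
      rw [this]
      exact ih v _
  obtain ⟨v'', hv''⟩ := hpow q _ _
  rw [run_append, hψu, hrun, hv'', joinF, if_pos hxf, joinF, if_pos hxf, Finset.sum_apply,
    eval_eq_sum_range' (Nat.lt_succ_of_le hq), Complex.ofReal_sum, Finset.sum_mul]
  refine Finset.sum_congr rfl fun k _ => ?_
  rw [Pi.smul_apply, coordL_pow]
  push_cast
  rw [smul_eq_mul]
  ring

open Polynomial in
/-- Multiplication by `P(x)` by a rotation that is multiplexed over the grid. -/
theorem exists_direct_gadget (hnd : (e :: f :: List.ofFn g).Nodup) (P : ℝ[X])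
    (hP : ∀ x : Q → Fin 2, |P.eval (a + val (List.ofFn g) x * gridStep n a b)| ≤ 1) :
    ∃ G : Circuit Q, CostLE G (2 * 2 ^ n + 2) (4 * 2 ^ n) ∧ IdOff e G ∧ Comm (fun t => t = f) G ∧
      ∀ ψ : (Q → Fin 2) → ℂ, (∀ x, ψ x ≠ 0 → x e = 1 ∧ x f = 0) →
        ∀ x, x f = 0 → run G ψ x =
          (P.eval (a + val (List.ofFn g) x * gridStep n a b) : ℝ) * ψ x := by
  obtain ⟨θ, hθd⟩ : ∃ θ : (Q → Fin 2) → ℝ, θ = fun x => if x e = 1 then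
    Real.arccos (P.eval (a + val (List.ofFn g) x * gridStep n a b)) else 0 := ⟨_, rfl⟩
  have hθ : BitsIn (e :: List.ofFn g) θ := by
    intro x y h
    rw [hθd]
    simp only [h e (by simp), val_congr (L := List.ofFn g) (x := x) (y := y)
      fun q hq => h q (by simp [hq])]
  simp only [List.nodup_cons, List.mem_cons, not_or] at hnd
  obtain ⟨⟨hef, heg⟩, hfg, hg⟩ := hnd
  have hf : f ∉ e :: List.ofFn g := by
    rw [List.mem_cons, not_or]
    exact ⟨fun h => hef h.symm, hfg⟩
  refine ⟨muxY (e :: List.ofFn g) f θ, (cost_muxY _ _ _).mono ?_ ?_, ?_,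
    (targets_muxY _ _ _).comm, ?_⟩
  · rw [List.length_cons, List.length_ofFn, pow_succ]; omega
  · rw [List.length_cons, List.length_ofFn, pow_succ, pow_succ]; omega
  · intro ψ hψ
    funext x
    rw [run_muxY hf hθ]
    rcases fin2_cases (x e) with hx | hx
    · have hθ0 : θ x = 0 := by rw [hθd]; simp [hx]
      rcases fin2_cases (x f) with hxf | hxf
      · have hxx : Function.update x f 0 = x := by rw [← hxf]; simp
        simp [hθ0, hxf, hxx]
      · have hxx : Function.update x f 1 = x := by rw [← hxf]; simp
        simp [hθ0, hxf, hxx]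
    · have h2 : ∀ b, ψ (Function.update x f b) = 0 := fun b => hψ _ (by simp [hef, hx])
      simp [h2, hψ x hx]
  · intro ψ hψ x hxf
    have hxx : Function.update x f 0 = x := by rw [← hxf]; simp
    have h1 : ψ (Function.update x f 1) = 0 := by
      by_contra h
      have := (hψ _ h).2
      simp at this
    rw [run_muxY hf hθ, if_pos hxf, hxx, h1, mul_zero, sub_zero]
    by_cases h0 : ψ x = 0
    · rw [h0]; simp
    · have hc : Real.cos (θ x) = P.eval (a + val (List.ofFn g) x * gridStep n a b) := by
        rw [hθd]
        simp only [(hψ x h0).1, if_true]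
        exact Real.cos_arccos (abs_le.1 (hP x)).1 (abs_le.1 (hP x)).2
      rw [hc]

end SignalProcessing

end QBlock

end

noncomputable section

namespace QBlock

/-! ### The circuit of one term -/

section Spread

set_option linter.unusedSectionVars false

variable {Q : Type} [Fintype Q] [DecidableEq Q]

/-- Two strings that agree off `S` are joined by finitely many updates at qubits of `S`. -/
theorem eq_of_forall_update {β : Type} {S : Q → Prop} {h : (Q → Fin 2) → β}
    (hh : ∀ t, S t → ∀ x b, h (Function.update x t b) = h x) {x y : Q → Fin 2}
    (hxy : ∀ q, ¬ S q → x q = y q) : h x = h y := by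
  have key : ∀ T : Finset Q, (∀ q ∈ T, S q) → h (fun q => if q ∈ T then x q else y q) = h y := by
    intro T
    induction T using Finset.induction_on with
    | empty => intro _; simp
    | insert a T ha ih =>
      intro hT
      rw [← ih fun q hq => hT q (Finset.mem_insert_of_mem hq),
        ← hh a (hT a (Finset.mem_insert_self _ _)) (fun q => if q ∈ T then x q else y q) (x a)]
      congr 1
      funext q
      rcases eq_or_ne q a with rfl | hq
      · simp
      · simp [hq]
  classical
  rw [← key (Finset.univ.filter S) (by simp)]
  congr 1
  funext q
  by_cases hq : S q
  · simp [hq]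
  · simp [hq, hxy q hq]

theorem Classical.comm {C : Circuit Q} {F : (Q → Fin 2) → (Q → Fin 2)} (hC : Classical C F)
    {S : Q → Prop} (hF : ∀ y q, ¬ S q → F y q = y q) : Comm S C := by
  intro h hh ψ
  funext z
  obtain ⟨y, rfl⟩ := hC.surjective z
  rw [hC, hC, eq_of_forall_update hh (hF y)]

theorem Classical.idOff {C : Circuit Q} {F : (Q → Fin 2) → (Q → Fin 2)} (hC : Classical C F)
    {e : Q} (hF : ∀ y, y e = 0 → F y = y) : IdOff e C := by
  intro ψ hψ
  funext z
  rcases fin2_cases (z e) with hz | hz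
  · conv_lhs => rw [← hF z hz]
    exact hC ψ z
  · obtain ⟨y, hy⟩ := hC.surjective z
    rw [hψ z hz, ← hy, hC]
    rcases fin2_cases (y e) with h | h
    · rw [← hy, hF y h, h] at hz
      simp at hz
    · exact hψ y h

theorem Classical.injective {C : Circuit Q} {F : (Q → Fin 2) → (Q → Fin 2)}
    (hC : Classical C F) : Function.Injective F :=
  Finite.injective_iff_surjective.2 hC.surjective

theorem Classical.inv {C : Circuit Q} {F : (Q → Fin 2) → (Q → Fin 2)} (hC : Classical C F) :
    ∃ F', Classical (invC C) F' ∧ (∀ y, F' (F y) = y) ∧ ∀ y, F (F' y) = y := by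
  have hl := Function.leftInverse_surjInv ⟨hC.injective, hC.surjective⟩
  have hr := Function.rightInverse_surjInv hC.surjective
  refine ⟨Function.surjInv hC.surjective, fun ψ y => ?_, hl, hr⟩
  rw [hC.run_inv, hr]

theorem val_append (L L' : List Q) (x : Q → Fin 2) :
    val (L ++ L') x = val L x + 2 ^ L.length * val L' x := by
  induction L with
  | nil => simp [val]
  | cons t L ih => rw [List.cons_append, val, ih, val, List.length_cons, pow_succ]; ring

theorem val_inj {L : List Q} {x y : Q → Fin 2} (h : val L x = val L y) : ∀ q ∈ L, x q = y q := by
  induction L with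
  | nil => simp
  | cons t L ih =>
    rw [val, val] at h
    have h1 := (x t).2
    have h2 := (y t).2
    intro q hq
    rcases List.mem_cons.1 hq with rfl | hq
    · exact Fin.ext (by omega)
    · exact ih (by omega) q hq

theorem exists_val_eq {L : List Q} (hL : L.Nodup) {v : ℕ} (hv : v < 2 ^ L.length)
    (x : Q → Fin 2) : ∃ y : Q → Fin 2, val L y = v ∧ ∀ q, q ∉ L → y q = x q := by
  induction L generalizing v with
  | nil => exact ⟨x, by simp at hv; simp [val, hv], fun _ _ => rfl⟩
  | cons t L ih =>
    rw [List.nodup_cons] at hL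
    rw [List.length_cons, pow_succ] at hv
    obtain ⟨y, hy, hyx⟩ := ih hL.2 (v := v / 2) (by omega)
    refine ⟨Function.update y t ⟨v % 2, by omega⟩, ?_, fun q hq => ?_⟩
    · rw [val, val_update hL.1, hy]
      simp only [Function.update_self]
      omega
    · rw [List.mem_cons, not_or] at hq
      rw [Function.update_of_ne hq.1, hyx q hq.2]

/-- Copies of the bit `s` are added to the bits in `T`, controlled by `e`. -/
def fanC (e s : Q) (T : List Q) : Circuit Q := T.flatMap fun t => tof e s t

theorem cost_fanC (e s : Q) (T : List Q) : CostLE (fanC e s T) (T.length * 10) (T.length * 8) :=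
  CostLE.flatMap _ _ _ _ fun _ _ => cost_tof _ _ _

theorem classical_fanC {e s : Q} (hes : e ≠ s) {T : List Q} (he : e ∉ T) (hs : s ∉ T)
    (hT : T.Nodup) :
    Classical (fanC e s T) (fun y q => if q ∈ T then y q + y e * y s else y q) := by
  induction T with
  | nil =>
    intro ψ y
    simp [fanC, run_nil]
  | cons t T ih =>
    rw [List.nodup_cons] at hT
    simp only [List.mem_cons, not_or] at he hs
    have := (classical_tof hes he.1 hs.1).append (ih he.2 hs.2 hT.2)
    intro ψ y
    rw [← this ψ y, fanC, List.flatMap_cons, fanC]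
    congr 1
    funext q
    rcases eq_or_ne q t with rfl | hq
    · simp [hT.1]
    · by_cases hqT : q ∈ T <;> simp [hqT, hq, he.1, hs.1]

theorem val_of_forall_eq {T : List Q} {x : Q → Fin 2} {b : Fin 2} (h : ∀ q ∈ T, x q = b) :
    val T x = b * (2 ^ T.length - 1) := by
  induction T with
  | nil => simp [val]
  | cons t T ih =>
    rw [val, ih fun q hq => h q (by simp [hq]), h t (by simp), List.length_cons, pow_succ]
    have := Nat.one_le_two_pow (n := T.length)
    rcases fin2_cases b with rfl | rfl <;> simp
    omega

/-- The patterns are two's complement numbers: `v` holds the bits of `u` after the parity bit `ε`,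
its highest bit `v / H` is the sign, and copies of the sign in the `K - 1` term extend it to `N =
4HK`. If `K = 1` nothing is to be extended and every `s` of the right parity occurs. -/
theorem spread_arith {ε m s H K N l : ℕ} {u : ℤ} (hε : ε = m % 2) (hs : s < N)
    (hN : N = 4 * (H * K)) (hK : 0 < K) (hH : 0 < H) (hm : m + 1 ≤ 2 ^ l)
    (hl : K ≠ 1 → 2 ^ l ≤ 2 * H) (hu : |u| ≤ m) (hum : u % 2 = m % 2) (hus : u ≡ s [ZMOD N]) :
    ∃ v < 2 * H, ε + 2 * v + 4 * H * (v / H * (K - 1)) = s := by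
  obtain ⟨t, ht⟩ := hus.dvd
  have hN' : (N : ℤ) = 4 * (H * K : ℕ) := by rw [hN]; push_cast; ring
  have hpar : s % 2 = ε := by
    have : (s : ℤ) = u + 2 * (2 * ((H * K : ℕ) * t)) := by
      rw [← sub_eq_iff_eq_add', ht, hN']; ring
    omega
  by_cases hK1 : K = 1
  · subst hK1
    refine ⟨s / 2, by omega, ?_⟩
    simp only [Nat.sub_self, mul_zero]
    omega
  have hHm := hl hK1
  have hHK : 2 * H ≤ H * K := by
    rw [mul_comm 2 H]; exact Nat.mul_le_mul_left _ (by omega)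
  rw [abs_le] at hu
  have hle := hu.1
  have hue := hu.2
  by_cases h0 : 0 ≤ u
  · have ht0 : t = 0 := by
      have h1 : (N : ℤ) * t < N * 1 := by rw [← ht]; omega
      have h2 : (N : ℤ) * (-1) < N * t := by rw [← ht]; omega
      have hNp : (0 : ℤ) ≤ N := by positivity
      have := lt_of_mul_lt_mul_left h1 hNp
      have := lt_of_mul_lt_mul_left h2 hNp
      omega
    rw [ht0, mul_zero] at ht
    refine ⟨s / 2, by omega, ?_⟩
    rw [Nat.div_eq_of_lt (by omega : s / 2 < H)]
    omega
  · have ht0 : t = 1 := by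
      have h1 : (N : ℤ) * t < N * 2 := by rw [← ht]; omega
      have h2 : (N : ℤ) * 0 < N * t := by rw [← ht]; omega
      have hNp : (0 : ℤ) ≤ N := by positivity
      have := lt_of_mul_lt_mul_left h1 hNp
      have := lt_of_mul_lt_mul_left h2 hNp
      omega
    rw [ht0, mul_one] at ht
    -- For negative `u` the pattern is `(u + 4H) / 2`; since `m < 2H` it lies in `[H, 2H)`, so its
    -- sign bit is 1.
    have hsz : s + 4 * H = (s + 4 * H - N) + N := by omega
    refine ⟨(s + 4 * H - N) / 2, by omega, ?_⟩
    have hd : (s + 4 * H - N) / 2 / H = 1 :=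
      Nat.div_eq_of_lt_le (by omega) (by omega)
    rw [hd, one_mul, Nat.mul_sub, mul_one, mul_assoc]
    omega

/-- Sign extension of the number in `mid` to the register `r0 :: (mid ++ top)`. -/
theorem exists_spread {e r0 : Q} {mid top : List Q} (hnd : (e :: r0 :: (mid ++ top)).Nodup)
    {n m : ℕ} (hn : 2 ≤ n) (hlen : (r0 :: (mid ++ top)).length = n)
    (hmid : mid.length = min (logSparsity m) (n - 1)) :
    ∃ (C : Circuit Q) (F : (Q → Fin 2) → (Q → Fin 2)) (sv : ℕ → ℕ),
      CostLE C (top.length * 10) (top.length * 8 + 1) ∧ Classical C F ∧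
      (∀ y q, q ∉ r0 :: top → F y q = y q) ∧ (∀ y, y e = 0 → F y = y) ∧
      (∀ y y', (∀ q ∈ e :: r0 :: (mid ++ top), y q = y' q) →
        ∀ q ∈ e :: r0 :: (mid ++ top), F y q = F y' q) ∧
      (∀ y, y e = 1 → y r0 = 0 → val top y = 0 →
        val (r0 :: (mid ++ top)) (F y) = sv (val mid y)) ∧
      ∀ s : ℕ, s < 2 ^ n → ∀ u : ℤ, |u| ≤ m → u % 2 = m % 2 → u ≡ s [ZMOD (2 ^ n : ℕ)] →
        ∃ v < 2 ^ mid.length, sv v = s := by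
  have hm : m + 1 ≤ 2 ^ logSparsity m := Nat.le_pow_clog (by norm_num) _
  rcases List.eq_nil_or_concat mid with rfl | ⟨mid', src, rfl⟩
  -- As `n ≥ 2`, an empty pattern forces `l = 0`, hence `m = 0` with the zero shift only.
  · have hl : logSparsity m = 0 := by simp at hmid; omega
    have hm0 : m = 0 := by rw [hl] at hm; simpa using hm
    subst hm0
    refine ⟨[], id, fun _ => 0, CostLE.nil.mono (by simp) (by simp), Classical.nil,
      fun _ _ _ => rfl, fun _ _ => rfl, fun _ _ h => h, ?_, ?_⟩
    · intro y _ h0 ht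
      simp [val, h0, ht]
    · intro s hs u hu _ hus
      have hu0 : u = 0 := by simpa using hu
      subst hu0
      refine ⟨0, by simp, ?_⟩
      have hus' : ((0 : ℕ) : ℤ) ≡ (s : ℕ) [ZMOD ((2 ^ n : ℕ) : ℤ)] := by rwa [Nat.cast_zero]
      have := Int.natCast_modEq_iff.1 hus'
      rw [Nat.ModEq, Nat.mod_eq_of_lt hs] at this
      simpa using this
  · rw [List.concat_eq_append] at *
    have hnd' := hnd
    simp only [List.nodup_cons, List.mem_cons, List.mem_append, List.nodup_append, not_or,
      List.not_mem_nil, not_false_eq_true, and_true] at hnd'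
    obtain ⟨⟨her, ⟨hem, hes⟩, het⟩, ⟨⟨hrm, hrs⟩, hrt⟩, ⟨hm', -, hms⟩, ht, hmt⟩ := hnd'
    have hst : src ∉ top := fun h => hmt src (by simp) src h rfl
    -- The lowest row qubit `r0` receives the common parity of all shifts, by one C-NOT from the
    -- control if `m` is odd.
    obtain ⟨X, F₀, hXc, hX, hXo, hX0, hXl, hX1⟩ : ∃ (X : Circuit Q) (F₀ : (Q → Fin 2) → (Q → Fin 2)),
        CostLE X 0 1 ∧ Classical X F₀ ∧ (∀ y q, q ≠ r0 → F₀ y q = y q) ∧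
        (∀ y, y e = 0 → F₀ y = y) ∧
        (∀ y y', y e = y' e → y r0 = y' r0 → F₀ y r0 = F₀ y' r0) ∧ ∀ y, y e = 1 → y r0 = 0 → (F₀ y r0 : ℕ) = m % 2 := by
      rcases Nat.mod_two_eq_zero_or_one m with h | h
      · exact ⟨[], id, CostLE.nil.mono le_rfl (by simp), Classical.nil, fun _ _ _ => rfl,
          fun _ _ => rfl, fun _ _ _ h => h, fun y _ h0 => by simp [h, h0]⟩
      · refine ⟨cx e r0, _, cost_cx _ _, classical_cx her, fun y q hq => by simp [hq],
          fun y hy => by simp [hy], fun y y' h h' => by simp [h, h'], fun y hy h0 => ?_⟩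
        simp [h, h0, hy]
    -- `src`, the highest qubit of the pattern, is its sign bit and is copied to all of `top`.
    refine ⟨fanC e src top ++ X, _, fun v => m % 2 + 2 * v + 4 * 2 ^ mid'.length *
      (v / 2 ^ mid'.length * (2 ^ top.length - 1)),
      ((cost_fanC _ _ _).append hXc).mono (by simp) le_rfl,
      (classical_fanC hes het hst ht).append hX, ?_, ?_, ?_, ?_, ?_⟩
    · intro y q hq
      rw [List.mem_cons, not_or] at hq
      rw [hXo _ _ hq.1, if_neg hq.2]
    · intro y hy
      have h1 : (fun q => if q ∈ top then y q + y e * y src else y q) = y := by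
        funext q; simp [hy]
      rw [h1, hX0 y hy]
    · intro y y' h q hq
      have hs' : y src = y' src := h src (by simp)
      have he' : y e = y' e := h e (by simp)
      rcases eq_or_ne q r0 with rfl | hqr
      · exact hXl _ _ (by simp [het, he']) (by simp [hrt, h q hq])
      · rw [hXo _ _ hqr, hXo _ _ hqr, h q hq, hs', he']
    · intro y hy h0 htop
      rw [val_eq_zero_iff] at htop
      obtain ⟨y1, hy1⟩ : ∃ y1 : Q → Fin 2,
        y1 = fun q => if q ∈ top then y q + y e * y src else y q := ⟨_, rfl⟩
      rw [← hy1]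
      have e1 : y1 e = 1 := by rw [hy1]; simp [het, hy]
      have r1 : y1 r0 = 0 := by rw [hy1]; simp [hrt, h0]
      have t1 : ∀ q ∈ top, F₀ y1 q = y src := by
        intro q hq
        rw [hXo _ _ (fun h => hrt (h ▸ hq)), hy1]
        simp [hq, htop q hq, hy]
      have m1 : ∀ q ∈ mid' ++ [src], F₀ y1 q = y q := by
        intro q hq
        have hqt : q ∉ top := fun h => hmt q (by simpa using hq) q h rfl
        have hqr : q ≠ r0 := by
          rintro rfl
          simp only [List.mem_append, List.mem_cons, List.not_mem_nil, or_false] at hq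
          exact hq.elim hrm hrs
        rw [hXo _ _ hqr, hy1]
        simp [hqt]
      rw [val, val_append, val_of_forall_eq t1, val_congr m1, hX1 y1 e1 r1]
      have hv : val (mid' ++ [src]) y / 2 ^ mid'.length = (y src : ℕ) := by
        rw [val_append]
        simp only [val, mul_zero, add_zero]
        rw [Nat.add_mul_div_left _ _ (by positivity), Nat.div_eq_of_lt (val_lt _ _), zero_add]
      dsimp only
      rw [hv, List.length_append, List.length_singleton, pow_succ]
      ring
    · intro s hs u hu hum hus
      rw [List.length_append, List.length_singleton]
      have hlen' : n = mid'.length + 2 + top.length := by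
        rw [← hlen]; simp; omega
      have hl : 2 ^ top.length ≠ 1 → 2 ^ logSparsity m ≤ 2 * 2 ^ mid'.length := by
        intro hK
        have hT : top.length ≠ 0 := by rintro h; rw [h] at hK; simp at hK
        rw [List.length_append, List.length_singleton] at hmid
        have : logSparsity m = mid'.length + 1 := by omega
        rw [this, pow_succ]; omega
      obtain ⟨v, hv, hvs⟩ := spread_arith (H := 2 ^ mid'.length) (K := 2 ^ top.length)
        (N := 2 ^ n) (l := logSparsity m) rfl hs (by rw [hlen', pow_add, pow_add]; ring)
        (by positivity) (by positivity) hm hl hu hum hus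
      exact ⟨v, by rwa [pow_succ, mul_comm], hvs⟩

end Spread

end QBlock

end

noncomputable section

namespace QBlock

/-! ### Loading the amplitudes of the shifts -/

section Term

set_option linter.unusedSectionVars false

variable {Q : Type} [Fintype Q] [DecidableEq Q]

theorem idOff_muxY {e t : Q} {L : List Q} (het : e ≠ t) (ht : t ∉ L) {θ : (Q → Fin 2) → ℝ}
    (hθ : BitsIn L θ) (h0 : ∀ x, x e = 0 → θ x = 0) : IdOff e (muxY L t θ) := by
  intro ψ hψ
  funext x
  rw [run_muxY ht hθ]
  rcases fin2_cases (x e) with hx | hx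
  · rw [h0 x hx]
    rcases fin2_cases (x t) with hxt | hxt
    · have hxx : Function.update x t 0 = x := by rw [← hxt]; simp
      simp [hxt, hxx]
    · have hxx : Function.update x t 1 = x := by rw [← hxt]; simp
      simp [hxt, hxx]
  · have h2 : ∀ b, ψ (Function.update x t b) = 0 := fun b => hψ _ (by simp [het, hx])
    simp [h2, hψ x hx]

/-- Rotations by `π / 4` of the qubits in `L`, controlled by `e`. -/
def rotC (e : Q) (L : List Q) : Circuit Q :=
  L.flatMap fun t => muxY [e] t fun x => if x e = 1 then Real.pi / 4 else 0

theorem bitsIn_quarter (e : Q) :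
    BitsIn [e] fun x : Q → Fin 2 => if x e = 1 then Real.pi / 4 else 0 := by
  intro x y h
  simp only [h e (by simp)]

theorem run_rotC {e : Q} {L : List Q} (hL : (e :: L).Nodup) {ψ : (Q → Fin 2) → ℂ}
    (hψ : ∀ x, (∃ q ∈ L, x q ≠ 0) → ψ x = 0) {y : Q → Fin 2} (hy : y e = 1) :
    run (rotC e L) ψ y = ((Real.sqrt 2 / 2) ^ L.length : ℝ) * ψ (zeroL L y) := by
  induction L generalizing ψ with
  | nil =>
    have : zeroL [] y = y := by funext q; simp [zeroL]
    simp [rotC, run_nil, this]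
  | cons t L ih =>
    simp only [List.nodup_cons, List.mem_cons, not_or] at hL
    obtain ⟨⟨het, heL⟩, htL, hL⟩ := hL
    have ht : t ∉ [e] := by simpa using fun h => het h.symm
    rw [rotC, List.flatMap_cons, run_append]
    rw [rotC] at ih
    rw [ih (List.nodup_cons.2 ⟨heL, hL⟩)]
    · have h1 : ∀ x : Q → Fin 2, ψ (Function.update x t 1) = 0 := fun x => hψ _ ⟨t, by simp⟩
      have hze : zeroL L y e = 1 := by simp [zeroL, heL, hy]
      have hzz : Function.update (zeroL L y) t 0 = zeroL (t :: L) y := by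
        funext q
        rcases eq_or_ne q t with rfl | hq
        · simp [zeroL]
        · simp [zeroL, hq]
      rw [run_muxY ht (bitsIn_quarter e), hze, h1, hzz]
      simp only [if_true, mul_zero, sub_zero, add_zero, Real.cos_pi_div_four,
        Real.sin_pi_div_four, ite_self, List.length_cons, pow_succ]
      push_cast
      ring
    · rintro x ⟨q, hq, hx⟩
      have hqt : q ≠ t := fun h => htL (h ▸ hq)
      have h2 : ∀ b, ψ (Function.update x t b) = 0 :=
        fun b => hψ _ ⟨q, by simp [hq], by simp [hqt, hx]⟩
      rw [run_muxY ht (bitsIn_quarter e)]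
      simp [h2]

/-- Preparation of the amplitudes of a shift. -/
theorem exists_prep {e f : Q} {L : List Q} (hL : (e :: f :: L).Nodup) (amp : ℕ → ℝ)
    (hamp : ∀ v < 2 ^ L.length, |amp v| * Real.sqrt 2 ^ L.length ≤ 1) :
    ∃ C : Circuit Q, CostLE C (L.length * 4 + (2 * 2 ^ L.length + 2))
        (L.length * 2 + 4 * 2 ^ L.length) ∧
      IdOff e C ∧ Comm (· ∈ f :: L) C ∧
      ∀ ψ : (Q → Fin 2) → ℂ, (∀ x, (∃ q ∈ f :: L, x q ≠ 0) → ψ x = 0) →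
        ∀ y, y e = 1 → y f = 0 → run C ψ y = amp (val L y) * ψ (zeroL L y) := by
  have hL' := hL
  simp only [List.nodup_cons, List.mem_cons, not_or] at hL'
  obtain ⟨⟨hef, heL⟩, hfL, hLn⟩ := hL'
  -- The rotations by `π / 4` give every pattern the amplitude `√2^(-|L|)`; the flag rotation
  -- multiplies it by `amp · √2^|L|`, which is a cosine by `hamp`.
  obtain ⟨θ, hθd⟩ : ∃ θ : (Q → Fin 2) → ℝ, θ = fun x => if x e = 1 then
    Real.arccos (amp (val L x) * Real.sqrt 2 ^ L.length) else 0 := ⟨_, rfl⟩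
  have hθ : BitsIn (e :: L) θ := by
    intro x y h
    rw [hθd]
    simp only [h e (by simp), val_congr (L := L) (x := x) (y := y) fun q hq => h q (by simp [hq])]
  have hf : f ∉ e :: L := by
    rw [List.mem_cons, not_or]
    exact ⟨fun h => hef h.symm, hfL⟩
  have hne : ∀ t ∈ L, e ≠ t := fun t ht h => heL (h ▸ ht)
  have hrot : Comm (· ∈ L) (rotC e L) := Comm.flatMap _ fun t ht =>
    (targets_muxY _ _ _).comm.mono fun q hq => hq ▸ ht
  refine ⟨rotC e L ++ muxY (e :: L) f θ, ((CostLE.flatMap L _ 4 2 fun _ _ =>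
    (cost_muxY _ _ _).mono (by simp) (by simp)).append (cost_muxY _ _ _)).mono ?_ ?_,
    IdOff.append (IdOff.flatMap _ fun t ht => idOff_muxY (hne t ht)
      (by simpa using (hne t ht).symm) (bitsIn_quarter e) fun x hx => by simp [hx])
      (idOff_muxY hef hf hθ fun x hx => by rw [hθd]; simp [hx]),
    (hrot.mono fun q hq => by simp [hq]).append
      ((targets_muxY _ _ _).comm.mono fun q hq => by simp [hq]), ?_⟩
  · rw [List.length_cons, pow_succ]; omega
  · rw [List.length_cons, pow_succ, pow_succ]; omega
  · intro ψ hψ y hye hyf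
    have hyy : Function.update y f 0 = y := by rw [← hyf]; simp
    have h1 : run (rotC e L) ψ (Function.update y f 1) = 0 := by
      refine hrot.support (p := fun x => x f = 0) (fun t ht x b => ?_) (fun x hx => ?_) _ (by simp)
      · rw [update_of_sep (S := (· ∈ L)) hfL ht]
      · exact hψ x ⟨f, by simp, hx⟩
    rw [run_append, run_muxY hf hθ, if_pos hyf, hyy, h1, mul_zero, sub_zero,
      run_rotC (List.nodup_cons.2 ⟨heL, hLn⟩) (fun x ⟨q, hq, hx⟩ => hψ x ⟨q, by simp [hq], hx⟩) hye,
      ← mul_assoc]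
    congr 1
    have hb := hamp _ (val_lt L y)
    have hs : |amp (val L y) * Real.sqrt 2 ^ L.length| ≤ 1 := by
      rwa [abs_mul, abs_of_nonneg (a := Real.sqrt 2 ^ L.length) (by positivity)]
    have hc : Real.cos (θ y) = amp (val L y) * Real.sqrt 2 ^ L.length := by
      rw [hθd]
      simp only [hye, if_true]
      exact Real.cos_arccos (abs_le.1 hs).1 (abs_le.1 hs).2
    rw [hc, ← Complex.ofReal_mul, mul_assoc, ← mul_pow]
    have : Real.sqrt 2 * (Real.sqrt 2 / 2) = 1 := by
      rw [← mul_div_assoc, Real.mul_self_sqrt (by norm_num)]; norm_num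
    rw [this, one_pow, mul_one]

end Term

end QBlock

end

noncomputable section

namespace QBlock

/-! ### Products of band matrices and diagonal matrices -/

section Term

set_option linter.unusedSectionVars false

variable {Q : Type} [Fintype Q] [DecidableEq Q]

/-- The circuit spreads a band of amplitudes: with the control `e` set and the carry `c` cleared, it
maps `|0⟩|j⟩` to `∑ᵢ w (i - j) p(i, j) |i⟩|j⟩` on the row and column registers, up to states
with flags that are not zero. -/
def BandSpec (e c f f' : Q) (row col : List Q) (w : ℕ → ℝ) (p : ℕ → ℕ → ℝ) (C : Circuit Q) : Prop :=
  IdOff e C ∧ Comm (fun q => q ≠ e ∧ q ≠ c) C ∧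
    ∀ ψ : (Q → Fin 2) → ℂ,
      (∀ x, ψ x ≠ 0 → x e = 1 ∧ x c = 0 ∧ x f = 0 ∧ x f' = 0 ∧ val row x = 0) →
      ∀ z, z e = 1 → z c = 0 → z f = 0 → z f' = 0 →
        run C ψ z = ((w ((val row z + 2 ^ row.length - val col z) % 2 ^ row.length) *
          p (val row z) (val col z) : ℝ) : ℂ) * ψ (zeroL row z)

variable {e c f f' r0 : Q} {mid top col : List Q}

/-- The pattern is loaded, `Mid` applies the diagonal factor, `CF` expands the pattern to a shift
and the adder turns the shift into a row index. The modular sum in `hM` is the row index that will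
result, so both products fit the same scheme. -/
theorem exists_bandSpec_of_mid
    (hnd : (e :: c :: f :: f' :: (r0 :: (mid ++ top) ++ col)).Nodup) {n m : ℕ}
    (hlen : (r0 :: (mid ++ top)).length = n) (hcol : col.length = n)
    {F : (Q → Fin 2) → (Q → Fin 2)} {CF : Circuit Q} {sv : ℕ → ℕ} {s₁ c₁ s₂ c₂ : ℕ}
    (hCF : CostLE CF s₁ c₁) (hF : Classical CF F) (hFo : ∀ y q, q ∉ r0 :: top → F y q = y q)
    (hF0 : ∀ y, y e = 0 → F y = y)
    (hF1 : ∀ y, y e = 1 → y r0 = 0 → val top y = 0 →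
      val (r0 :: (mid ++ top)) (F y) = sv (val mid y))
    (hsv : ∀ s : ℕ, s < 2 ^ n → ∀ u : ℤ, |u| ≤ m → u % 2 = m % 2 → u ≡ s [ZMOD (2 ^ n : ℕ)] →
      ∃ v < 2 ^ mid.length, sv v = s)
    {w : ℕ → ℝ} (hw : ∀ s, |w s| * Real.sqrt 2 ^ mid.length ≤ 1)
    (hw0 : ∀ s, w s ≠ 0 → ∃ u : ℤ, |u| ≤ m ∧ u % 2 = m % 2 ∧ u ≡ s [ZMOD (2 ^ n : ℕ)])
    {p : ℕ → ℕ → ℝ} {Mid : Circuit Q} (hMc : CostLE Mid s₂ c₂) (hMo : IdOff e Mid)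
    (hMm : Comm (fun q => q ≠ e ∧ q ≠ c) Mid)
    (hM : ∀ ψ : (Q → Fin 2) → ℂ,
      (∀ x, ψ x ≠ 0 → x e = 1 ∧ x c = 0 ∧ x f' = 0 ∧ x r0 = 0 ∧ val top x = 0) →
      ∀ y, y e = 1 → y c = 0 → y f' = 0 → run Mid ψ y =
        p ((val (r0 :: (mid ++ top)) (F y) + val col y) % 2 ^ n) (val col y) * ψ y) :
    ∃ C : Circuit Q, CostLE C
        (mid.length * 4 + (2 * 2 ^ mid.length + 2) + (s₂ + (s₁ + n * 30)))
        (mid.length * 2 + 4 * 2 ^ mid.length + (c₂ + (c₁ + n * 28))) ∧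
      BandSpec e c f f' (r0 :: (mid ++ top)) col w p C := by
  obtain ⟨row, hrow⟩ : ∃ row, row = r0 :: (mid ++ top) := ⟨_, rfl⟩
  have hnd' := hnd
  simp only [← hrow, List.nodup_cons, List.nodup_append, List.mem_cons, List.mem_append,
    not_or] at hnd'
  obtain ⟨⟨hec, hef, hef', her, hecol⟩, ⟨hcf, hcf', hcr, hccol⟩, ⟨hff', hfr, hfcol⟩,
    ⟨hf'r, hf'col⟩, hrown, hcoln, hrc⟩ := hnd'
  have hmemtop : ∀ q ∈ r0 :: top, q ∈ row := by
    intro q hq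
    rw [hrow]; simp only [List.mem_cons, List.mem_append] at hq ⊢; tauto
  have hmemmid : ∀ q ∈ mid, q ∈ row := by
    intro q hq
    rw [hrow]; simp [hq]
  have hrown' := hrown
  rw [hrow] at hrown'
  simp only [List.nodup_cons, List.mem_append, not_or, List.nodup_append] at hrown'
  obtain ⟨⟨hrm, hrt⟩, hmn, htn, hmt⟩ := hrown'
  obtain ⟨P, hPc, hPo, hPm, hP⟩ := exists_prep (e := e) (f := f) (L := mid) (by
    simp only [List.nodup_cons, List.mem_cons, not_or]
    exact ⟨⟨hef, fun h => her (hmemmid e h)⟩, fun h => hfr (hmemmid f h), hmn⟩)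
    (fun v => w (sv v)) (fun v _ => hw _)
  have hrl : row.length = n := by rw [hrow, hlen]
  -- The column is added to the row, the carry `c` starting at zero.
  have hm1 : (List.zip col row).map Prod.fst = col := List.map_fst_zip (by omega)
  have hm2 : (List.zip col row).map Prod.snd = row := List.map_snd_zip (by omega)
  obtain ⟨A, hA, hAo, hA0, hA1⟩ := classical_addC (e := e) (c := c) (L := List.zip col row) (by
    rw [hm1, hm2]
    simp only [List.nodup_cons, List.nodup_append, List.mem_cons, List.mem_append, not_or]
    exact ⟨⟨hec, hecol, her⟩, ⟨hccol, hcr⟩, hcoln, hrown,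
      fun a ha b hb h => hrc b hb a ha h.symm⟩)
  rw [hm2] at hAo
  rw [hm1, hm2, List.length_zip, hcol, hrl, min_self] at hA1
  have hAc := cost_addC e c (List.zip col row)
  rw [List.length_zip, hcol, hrl, min_self] at hAc
  have hFr : ∀ y q, q ∉ row → F y q = y q := fun y q hq => hFo y q fun h => hq (hmemtop q h)
  refine ⟨P ++ (Mid ++ (CF ++ addC e c (List.zip col row))),
    hPc.append (hMc.append (hCF.append hAc)), ?_, ?_, ?_⟩
  · exact hPo.append (hMo.append ((hF.idOff hF0).append (hA.idOff hA0)))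
  · refine (hPm.mono ?_).append (hMm.append ((hF.comm fun y q hq => ?_).append
      (hA.comm fun y q hq => ?_)))
    · intro q hq
      rcases List.mem_cons.1 hq with rfl | hq
      · exact ⟨fun h => hef h.symm, fun h => hcf h.symm⟩
      · exact ⟨fun h => her (hmemmid _ (h ▸ hq)), fun h => hcr (hmemmid _ (h ▸ hq))⟩
    · refine hFr y q fun h => hq ⟨?_, ?_⟩ <;> rintro rfl
      exacts [her h, hcr h]
    · refine hAo y q fun h => hq ⟨?_, ?_⟩ <;> rintro rfl
      exacts [her h, hcr h]
  rw [← hrow]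
  intro ψ hψ z hze hzc hzf hzf'
  obtain ⟨y1, rfl⟩ := hA.surjective z
  obtain ⟨y, rfl⟩ := hF.surjective y1
  have hAF : ∀ q, q ∉ row → A (F y) q = y q := fun q hq => by rw [hAo _ _ hq, hFr _ _ hq]
  rw [hAF e her] at hze
  rw [hAF c hcr] at hzc
  rw [hAF f hfr] at hzf
  rw [hAF f' hf'r] at hzf'
  have hcolA : val col (A (F y)) = val col y :=
    val_congr fun q hq => hAF q fun h => hrc q h q hq rfl
  have hcolF : val col (F y) = val col y :=
    val_congr fun q hq => hFr y q fun h => hrc q h q hq rfl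
  have hrowA := hA1 (F y) (by rw [hFr _ _ her, hze])
  rw [hcolF, hFr _ _ hcr, hzc] at hrowA
  simp only [Fin.val_zero, add_zero] at hrowA
  have hltR : val row (A (F y)) < 2 ^ n := hrl ▸ val_lt row _
  have hltF : val row (F y) < 2 ^ n := hrl ▸ val_lt row _
  have hltC : val col y < 2 ^ n := hcol ▸ val_lt col _
  have hR : val row (A (F y)) = (val row (F y) + val col y) % 2 ^ n := by
    rw [← Nat.mod_eq_of_lt hltR]; exact hrowA
  -- Subtracting the column index from the final row index recovers the shift, including the case of
  -- a wrap-around.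
  have hS : (val row (A (F y)) + 2 ^ n - val col y) % 2 ^ n = val row (F y) := by
    rw [hR]
    rcases lt_or_ge (val row (F y) + val col y) (2 ^ n) with h | h
    · rw [Nat.mod_eq_of_lt h]
      have : val row (F y) + val col y + 2 ^ n - val col y = val row (F y) + 2 ^ n := by omega
      rw [this, Nat.add_mod_right, Nat.mod_eq_of_lt hltF]
    · rw [Nat.mod_eq_sub_mod h, Nat.mod_eq_of_lt
        (show val row (F y) + val col y - 2 ^ n < 2 ^ n by omega)]
      have : val row (F y) + val col y - 2 ^ n + 2 ^ n - val col y = val row (F y) := by omega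
      rw [this, Nat.mod_eq_of_lt hltF]
  rw [hcolA, hrl, hS, run_append, run_append, run_append, hA, hF]
  have hPsup : ∀ x, run P ψ x ≠ 0 → x e = 1 ∧ x c = 0 ∧ x f' = 0 ∧ x r0 = 0 ∧ val top x = 0 := by
    intro x hx
    by_contra h
    refine hx (hPm.support (p := fun x => x e = 1 ∧ x c = 0 ∧ x f' = 0 ∧ x r0 = 0 ∧ val top x = 0)
      (fun t ht x b => ?_) (fun x hx => ?_) x h)
    · have h1 : e ∉ f :: mid := by
        rw [List.mem_cons, not_or]; exact ⟨hef, fun h => her (hmemmid e h)⟩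
      have h2 : c ∉ f :: mid := by
        rw [List.mem_cons, not_or]; exact ⟨hcf, fun h => hcr (hmemmid c h)⟩
      have h3 : f' ∉ f :: mid := by
        rw [List.mem_cons, not_or]
        exact ⟨fun h => hff' h.symm, fun h => hf'r (hmemmid f' h)⟩
      have h4 : r0 ∉ f :: mid := by
        rw [List.mem_cons, not_or]
        exact ⟨fun h => hfr (h ▸ hmemtop r0 (by simp)), hrm⟩
      have h5 : t ∉ top := by
        rcases List.mem_cons.1 ht with rfl | ht
        · exact fun h => hfr (hmemtop _ (by simp [h]))
        · exact fun h => hmt t ht t h rfl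
      rw [update_of_sep (S := (· ∈ f :: mid)) h1 ht, update_of_sep (S := (· ∈ f :: mid)) h2 ht,
        update_of_sep (S := (· ∈ f :: mid)) h3 ht, update_of_sep (S := (· ∈ f :: mid)) h4 ht,
        val_update h5]
    · by_contra h0
      obtain ⟨g1, g2, -, g4, g5⟩ := hψ x h0
      rw [val_eq_zero_iff] at g5
      exact hx ⟨g1, g2, g4, g5 r0 (hmemtop r0 (by simp)),
        val_eq_zero_iff.2 fun q hq => g5 q (hmemtop q (by simp [hq]))⟩
  rw [hM _ hPsup y hze hzc hzf', ← hrow, ← hR]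
  -- All permutations are pulled back to the string `y` before expansion. Loaded states have `r0`
  -- and `top` zero; for any other `y` both sides must be shown to vanish.
  by_cases hy : y r0 = 0 ∧ val top y = 0
  · have hval := hF1 y hze hy.1 hy.2
    rw [← hrow] at hval
    have hz0 : zeroL mid y = zeroL row (A (F y)) := by
      funext q
      by_cases hq : q ∈ row
      · simp only [zeroL, hq, if_true]
        split_ifs with h
        · rfl
        · rw [hrow, List.mem_cons, List.mem_append] at hq
          rcases hq with rfl | hq | hq
          · exact hy.1
          · exact absurd hq h
          · exact val_eq_zero_iff.1 hy.2 q hq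
      · have hqm : q ∉ mid := fun h => hq (hmemmid q h)
        simp only [zeroL, hq, hqm, if_false]
        rw [hAF q hq]
    rw [hP ψ _ y hze hzf, hz0, hval]
    · push_cast; ring
    · rintro x ⟨q, hq, hx⟩
      by_contra h0
      obtain ⟨-, -, g3, -, g5⟩ := hψ x h0
      rcases List.mem_cons.1 hq with rfl | hq
      · exact hx g3
      · exact hx (val_eq_zero_iff.1 g5 q (hmemmid q hq))
  · have h1 : run P ψ y = 0 := by
      by_contra h
      exact hy (hPsup y h).2.2.2
    -- If the amplitude were nonzero, some pattern would expand to the same shift; injectivity of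
    -- `F` would then make `y` that pattern, with `r0` and `top` zero.
    have h2 : w (val row (F y)) = 0 := by
      by_contra h
      obtain ⟨u, hu1, hu2, hu3⟩ := hw0 _ h
      obtain ⟨v, hv, hvs⟩ := hsv _ hltF u hu1 hu2 hu3
      obtain ⟨y', hy', hyo⟩ := exists_val_eq hmn hv (zeroL row y)
      have ho : ∀ q, q ∉ row → y' q = y q := fun q hq => by
        rw [hyo q fun h => hq (hmemmid q h)]; simp [zeroL, hq]
      have h0' : ∀ q ∈ r0 :: top, y' q = 0 := by
        intro q hq
        have hqm : q ∉ mid := by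
          rcases List.mem_cons.1 hq with rfl | hq
          · exact hrm
          · exact fun h => hmt q h q hq rfl
        rw [hyo q hqm]
        simp [zeroL, hmemtop q hq]
      have ht0 : val top y' = 0 := val_eq_zero_iff.2 fun q hq => h0' q (by simp [hq])
      have hval := hF1 y' (by rw [ho e her, hze]) (h0' r0 (by simp)) ht0
      rw [← hrow, hy', hvs] at hval
      have hFF : F y' = F y := by
        funext q
        by_cases hq : q ∈ row
        · exact val_inj hval q hq
        · rw [hFr _ _ hq, hFr _ _ hq, ho q hq]
      have := hF.injective hFF
      rw [← this] at hy
      exact hy ⟨h0' r0 (by simp), ht0⟩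
    rw [h1, h2]
    simp

/-- The circuits of the products of a diagonal matrix, implemented by `G`, and of a band matrix. -/
theorem exists_bandSpec
    (hnd : (e :: c :: f :: f' :: (r0 :: (mid ++ top) ++ col)).Nodup) {n m : ℕ} (hn : 2 ≤ n)
    (hlen : (r0 :: (mid ++ top)).length = n) (hcol : col.length = n)
    (hmid : mid.length = min (logSparsity m) (n - 1))
    {w : ℕ → ℝ} (hw : ∀ s, |w s| * Real.sqrt 2 ^ mid.length ≤ 1)
    (hw0 : ∀ s, w s ≠ 0 → ∃ u : ℤ, |u| ≤ m ∧ u % 2 = m % 2 ∧ u ≡ s [ZMOD (2 ^ n : ℕ)])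
    {d : ℕ → ℝ} {G : Circuit Q} {s₂ c₂ : ℕ} (hGc : CostLE G s₂ c₂) (hGo : IdOff e G)
    (hGm : Comm (fun t => t = f' ∨ t ∈ top) G)
    (hG : ∀ ψ : (Q → Fin 2) → ℂ, (∀ x, ψ x ≠ 0 → x e = 1 ∧ x f' = 0 ∧ val top x = 0) →
      ∀ x, x f' = 0 → run G ψ x = d (val col x) * ψ x) :
    (∃ C : Circuit Q, CostLE C
        (mid.length * 4 + (2 * 2 ^ mid.length + 2) + (s₂ + (top.length * 10 + n * 30)))
        (mid.length * 2 + 4 * 2 ^ mid.length + (c₂ + (top.length * 8 + 1 + n * 28))) ∧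
      BandSpec e c f f' (r0 :: (mid ++ top)) col w (fun _ j => d j) C) ∧
    ∃ C : Circuit Q, CostLE C
        (mid.length * 4 + (2 * 2 ^ mid.length + 2) +
          (s₂ + 2 * (top.length * 10 + n * 30) + 2 * (top.length * 10) + (top.length * 10 + n * 30)))
        (mid.length * 2 + 4 * 2 ^ mid.length +
          (c₂ + 2 * (top.length * 8 + 1 + n * 28) + 2 * (top.length * 8 + 1) +
            (top.length * 8 + 1 + n * 28))) ∧
      BandSpec e c f f' (r0 :: (mid ++ top)) col w (fun i _ => d i) C := by
  obtain ⟨row, hrow⟩ : ∃ row, row = r0 :: (mid ++ top) := ⟨_, rfl⟩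
  have hnd' := hnd
  simp only [← hrow, List.nodup_cons, List.nodup_append, List.mem_cons, List.mem_append,
    not_or] at hnd'
  obtain ⟨⟨hec, hef, hef', her, hecol⟩, ⟨hcf, hcf', hcr, hccol⟩, ⟨hff', hfr, hfcol⟩,
    ⟨hf'r, hf'col⟩, hrown, hcoln, hrc⟩ := hnd'
  have hmemtop : ∀ q ∈ r0 :: top, q ∈ row := by
    intro q hq
    rw [hrow]; simp only [List.mem_cons, List.mem_append] at hq ⊢; tauto
  obtain ⟨CF, F, sv, hCF, hF, hFo, hF0, hFl, hF1, hsv⟩ := exists_spread (e := e) (r0 := r0)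
    (mid := mid) (top := top) (m := m) (by
      rw [← hrow, List.nodup_cons]; exact ⟨her, hrown⟩) hn hlen hmid
  have hGm' : Comm (fun q => q ≠ e ∧ q ≠ c) G := hGm.mono fun q hq => by
    rcases hq with rfl | hq
    · exact ⟨fun h => hef' h.symm, fun h => hcf' h.symm⟩
    · have := hmemtop q (by simp [hq])
      exact ⟨fun h => her (h ▸ this), fun h => hcr (h ▸ this)⟩
  have hrl : row.length = n := by rw [hrow, hlen]
  have hFr : ∀ y q, q ∉ row → F y q = y q := fun y q hq => hFo y q fun h => hq (hmemtop q h)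
  constructor
  · exact exists_bandSpec_of_mid hnd hlen hcol hCF hF hFo hF0 hF1 hsv hw hw0 hGc hGo hGm'
      fun ψ hψ y _ _ hy => hG ψ (fun x hx => ⟨(hψ x hx).1, (hψ x hx).2.2.1, (hψ x hx).2.2.2.2⟩) y hy
  have hm1 : (List.zip row col).map Prod.fst = row := List.map_fst_zip (by omega)
  have hm2 : (List.zip row col).map Prod.snd = col := List.map_snd_zip (by omega)
  obtain ⟨A, hA, hAo, hA0, hA1⟩ := classical_addC (e := e) (c := c) (L := List.zip row col) (by
    rw [hm1, hm2]
    simp only [List.nodup_cons, List.nodup_append, List.mem_cons, List.mem_append, not_or]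
    exact ⟨⟨hec, her, hecol⟩, ⟨hcr, hccol⟩, hrown, hcoln, hrc⟩)
  rw [hm2] at hAo
  rw [hm1, hm2, List.length_zip, hcol, hrl, min_self] at hA1
  have hAc := cost_addC e c (List.zip row col)
  rw [List.length_zip, hcol, hrl, min_self] at hAc
  obtain ⟨F', hF', hF'F, hFF'⟩ := hF.inv
  -- Expanding the pattern, adding the row to the column and compressing the pattern again moves the
  -- column register to the row index while `top` returns to zero. The diagonal gadget can then read
  -- the row index there with `top` as clean workspace.
  obtain ⟨Sh, hShd⟩ : ∃ Sh, Sh = CF ++ (addC e c (List.zip row col) ++ invC CF) := ⟨_, rfl⟩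
  obtain ⟨H, hHd⟩ : ∃ H : (Q → Fin 2) → (Q → Fin 2), H = fun y => F' (A (F y)) := ⟨_, rfl⟩
  have hSh : Classical Sh H := by
    rw [hShd, hHd]; exact hF.append (hA.append hF')
  -- The expansion does not look at the column register, so it is undone exactly although the column
  -- has changed in between.
  have hHeq : ∀ y, H y = fun q => if q ∈ col then A (F y) q else y q := by
    intro y
    have hcolrow : ∀ q ∈ e :: row, q ∉ col := by
      intro q hq h
      rcases List.mem_cons.1 hq with rfl | hq
      · exact hecol h
      · exact hrc q hq q h rfl
    have : F (fun q => if q ∈ col then A (F y) q else y q) = A (F y) := by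
      funext q
      by_cases hq : q ∈ r0 :: top
      · have hqr := hmemtop q hq
        have := hFl (fun q => if q ∈ col then A (F y) q else y q) y (fun q hq => by
          rw [← hrow] at hq; simp [hcolrow q hq]) q (by rw [← hrow]; simp [hqr])
        rw [this, hAo]
        exact hcolrow q (by simp [hqr])
      · rw [hFo _ _ hq]
        split_ifs with h
        · rfl
        · rw [hAo _ _ h, hFo _ _ hq]
    rw [hHd]
    dsimp only
    rw [← this, hF'F, this]
  have hHo : ∀ y q, q ∉ col → H y q = y q := fun y q hq => by rw [hHeq]; simp [hq]
  have hShm : Comm (fun q => q ≠ e ∧ q ≠ c) Sh := hSh.comm fun y q hq => by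
    refine hHo y q fun h => hq ⟨?_, ?_⟩ <;> rintro rfl
    exacts [hecol h, hccol h]
  have hSho : IdOff e Sh := by
    rw [hShd]
    exact (hF.idOff hF0).append ((hA.idOff hA0).append (hF.idOff hF0).inv)
  have hShc : CostLE Sh (top.length * 10 + n * 30 + top.length * 10)
      (top.length * 8 + 1 + n * 28 + (top.length * 8 + 1)) := by
    rw [hShd]
    exact (hCF.append (hAc.append hCF.inv)).mono (by omega) (by omega)
  obtain ⟨C, hC, hCs⟩ := exists_bandSpec_of_mid hnd hlen hcol hCF hF hFo hF0 hF1 hsv hw hw0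
    (p := fun i _ => d i) (hShc.append (hGc.append hShc.inv)) (hSho.append (hGo.append hSho.inv))
    (hShm.append (hGm'.append hShm.inv)) (by
      intro ψ hψ y hye hyc hyf'
      have hFye : F y e = 1 := by rw [hFr _ _ her, hye]
      have hval : val col (H y) = (val (r0 :: (mid ++ top)) (F y) + val col y) % 2 ^ n := by
        have h1 : val col (H y) = val col (A (F y)) :=
          val_congr fun q hq => by rw [hHeq]; simp [hq]
        have h2 : val col (F y) = val col y :=
          val_congr fun q hq => hFr y q fun h => hrc q h q hq rfl
        have h3 := hA1 (F y) hFye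
        rw [hFr _ _ hcr, hyc, h2] at h3
        simp only [Fin.val_zero, add_zero] at h3
        rw [h1, ← hrow, ← Nat.mod_eq_of_lt (hcol ▸ val_lt col (A (F y)) : val col _ < 2 ^ n),
          add_comm]
        exact h3
      rw [run_append, run_append, hSh.run_inv, hG _ (fun x hx => ?_) _ (by
        rw [hHo _ _ hf'col, hyf']), hSh, hval]
      obtain ⟨x', rfl⟩ := hSh.surjective x
      rw [hSh] at hx
      obtain ⟨g1, -, g3, -, g5⟩ := hψ x' hx
      refine ⟨by rw [hHo _ _ hecol, g1], by rw [hHo _ _ hf'col, g3], ?_⟩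
      rw [← g5]
      exact val_congr fun q hq => hHo _ _ fun h => hrc q (hmemtop q (by simp [hq])) q h rfl)
  exact ⟨C, hC.mono (by omega) (by omega), hCs⟩

end Term

end QBlock

end

noncomputable section

namespace QBlock

/-! ### Powers of the momentum matrix -/

section Momentum

set_option linter.unusedSectionVars false

variable {n : ℕ} {a b : ℝ}

/-- The entries of the real matrix `(i p̂)^m`, as a function of the difference of the indices. -/
def momentumCoeff (n : ℕ) (a b : ℝ) : ℕ → ZMod (2 ^ n) → ℝ
  | 0, z => if z = 0 then 1 else 0
  | m + 1, z => (momentumCoeff n a b m (z + 1) - momentumCoeff n a b m (z - 1)) /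
      (2 * gridStep n a b)

theorem natCast_fin_inj {i j : Fin (2 ^ n)} (h : ((i : ℕ) : ZMod (2 ^ n)) = (j : ℕ)) : i = j := by
  rw [ZMod.natCast_eq_natCast_iff', Nat.mod_eq_of_lt i.2, Nat.mod_eq_of_lt j.2] at h
  exact Fin.ext h

theorem exists_fin_natCast (z : ZMod (2 ^ n)) : ∃ i : Fin (2 ^ n), ((i : ℕ) : ZMod (2 ^ n)) = z :=
  ⟨⟨z.val, ZMod.val_lt z⟩, ZMod.natCast_zmod_val z⟩

theorem succ_mod_eq_iff (i j : Fin (2 ^ n)) :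
    ((i : ℕ) + 1) % 2 ^ n = j ↔ ((i : ℕ) : ZMod (2 ^ n)) + 1 = (j : ℕ) := by
  have : ((i : ℕ) : ZMod (2 ^ n)) + 1 = ((i + 1 : ℕ) : ZMod (2 ^ n)) := by push_cast; rfl
  rw [this, ZMod.natCast_eq_natCast_iff', Nat.mod_eq_of_lt j.2]

theorem sum_fin_ite (f : Fin (2 ^ n) → ℂ) (k : Fin (2 ^ n)) (p : Fin (2 ^ n) → Prop)
    [DecidablePred p] (hp : ∀ i, p i ↔ i = k) : ∑ i, f i * (if p i then 1 else 0) = f k := by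
  rw [Finset.sum_eq_single k]
  · simp [(hp k).2 rfl]
  · intro i _ hi
    rw [if_neg fun h => hi ((hp i).1 h), mul_zero]
  · simp

/-- The matrix is circulant; multiplying by one more factor takes the central difference of the
coefficient function. -/
theorem pHat_pow_apply (m : ℕ) (i j : Fin (2 ^ n)) :
    (pHat n a b ^ m) i j =
      (-Complex.I) ^ m * momentumCoeff n a b m (((i : ℕ) : ZMod (2 ^ n)) - (j : ℕ)) := by
  induction m generalizing j with
  | zero =>
    rw [pow_zero, pow_zero, one_mul, momentumCoeff, one_apply]
    rcases eq_or_ne i j with rfl | h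
    · simp
    · rw [if_neg h, if_neg]
      · simp
      · rw [sub_eq_zero]
        exact fun h' => h (natCast_fin_inj h')
  | succ m ih =>
    obtain ⟨k, hk⟩ := exists_fin_natCast (n := n) ((j : ℕ) - 1)
    obtain ⟨k', hk'⟩ := exists_fin_natCast (n := n) ((j : ℕ) + 1)
    have h1 := sum_fin_ite (fun x => (pHat n a b ^ m) i x) k
      (fun x => ((x : ℕ) + 1) % 2 ^ n = j) fun x => by
        rw [succ_mod_eq_iff, ← eq_sub_iff_add_eq, ← hk]
        exact ⟨natCast_fin_inj, fun h => by rw [h]⟩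
    have h2 := sum_fin_ite (fun x => (pHat n a b ^ m) i x) k'
      (fun x => ((j : ℕ) + 1) % 2 ^ n = x) fun x => by
        rw [succ_mod_eq_iff, ← hk']
        exact ⟨fun h => natCast_fin_inj h.symm, fun h => by rw [h]⟩
    have h3 : (pHat n a b ^ (m + 1)) i j = -Complex.I / (2 * (gridStep n a b : ℂ)) *
        ((pHat n a b ^ m) i k - (pHat n a b ^ m) i k') := by
      rw [pow_succ, mul_apply, ← h1, ← h2, ← Finset.sum_sub_distrib, Finset.mul_sum]
      refine Finset.sum_congr rfl fun x _ => ?_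
      rw [pHat, of_apply]
      ring
    rw [h3, ih, ih, momentumCoeff, hk, hk', pow_succ]
    have e1 : ((i : ℕ) : ZMod (2 ^ n)) - ((j : ℕ) - 1) = (i : ℕ) - (j : ℕ) + 1 := by ring
    have e2 : ((i : ℕ) : ZMod (2 ^ n)) - ((j : ℕ) + 1) = (i : ℕ) - (j : ℕ) - 1 := by ring
    rw [e1, e2]
    push_cast
    ring

/-- A path of `m` steps `±1` ends at distance at most `m` and with the parity of `m`. -/
theorem momentumCoeff_support {m : ℕ} {z : ZMod (2 ^ n)} (h : momentumCoeff n a b m z ≠ 0) :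
    ∃ u : ℤ, |u| ≤ m ∧ u % 2 = m % 2 ∧ (u : ZMod (2 ^ n)) = z := by
  induction m generalizing z with
  | zero =>
    rw [momentumCoeff] at h
    have hz : z = 0 := by
      by_contra hz
      simp [hz] at h
    exact ⟨0, by simp, by simp, by simp [hz]⟩
  | succ m ih =>
    rw [momentumCoeff] at h
    have : momentumCoeff n a b m (z + 1) ≠ 0 ∨ momentumCoeff n a b m (z - 1) ≠ 0 := by
      by_contra hc
      simp only [not_or, not_not] at hc
      rw [hc.1, hc.2] at h
      simp at h
    rcases this with h | h
    · obtain ⟨u, hu, hu2, huz⟩ := ih h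
      rw [abs_le] at hu
      refine ⟨u - 1, ?_, ?_, ?_⟩
      · rw [abs_le]; push_cast; omega
      · push_cast; omega
      · push_cast; rw [huz]; ring
    · obtain ⟨u, hu, hu2, huz⟩ := ih h
      rw [abs_le] at hu
      refine ⟨u + 1, ?_, ?_, ?_⟩
      · rw [abs_le]; push_cast; omega
      · push_cast; omega
      · push_cast; rw [huz]; ring

theorem gridStep_pos (hn : 1 ≤ n) (hab : a < b) : 0 < gridStep n a b := by
  rw [gridStep]
  have : (2 : ℝ) ^ 1 ≤ 2 ^ n := pow_le_pow_right₀ (by norm_num) hn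
  exact div_pos (by linarith) (by linarith)

/-- The Fourier coefficient at the character with `χ 1 = i` is `(-i / Δx)^m`, which never vanishes.
Such a character exists because 4 divides `2^n`. -/
theorem exists_momentumCoeff_ne_zero (hn : 2 ≤ n) (hab : a < b) (m : ℕ) :
    ∃ z, momentumCoeff n a b m z ≠ 0 := by
  have hI : Complex.I ^ (2 ^ n) = 1 := by
    obtain ⟨k, rfl⟩ := Nat.exists_eq_add_of_le hn
    rw [pow_add, pow_mul]
    norm_num
  obtain ⟨χ, hχ⟩ : ∃ χ : AddChar (ZMod (2 ^ n)) ℂ, χ 1 = Complex.I := by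
    refine ⟨AddChar.zmodChar (2 ^ n) hI, ?_⟩
    have := AddChar.zmodChar_apply' (n := 2 ^ n) hI 1
    simpa using this
  have hχm : ∀ z, χ (z - 1) = -Complex.I * χ z := by
    intro z
    have : χ z = χ (z - 1) * Complex.I := by rw [← hχ, ← AddChar.map_add_eq_mul]; simp
    rw [this]
    linear_combination (χ (z - 1)) * Complex.I_mul_I
  have hstep := (gridStep_pos (a := a) (b := b) (by omega : 1 ≤ n) hab).ne'
  have key : ∑ z, (momentumCoeff n a b m z : ℂ) * χ z = (-Complex.I / gridStep n a b) ^ m := by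
    induction m with
    | zero => simp [momentumCoeff, apply_ite Complex.ofReal]
    | succ m ih =>
      have h1 : ∑ z, (momentumCoeff n a b m (z + 1) : ℂ) * χ z =
          ∑ z, (momentumCoeff n a b m z : ℂ) * χ (z - 1) :=
        Fintype.sum_equiv (Equiv.addRight 1) _ _ fun z => by simp
      have h2 : ∑ z, (momentumCoeff n a b m (z - 1) : ℂ) * χ z =
          ∑ z, (momentumCoeff n a b m z : ℂ) * χ (z + 1) :=
        Fintype.sum_equiv (Equiv.subRight 1) _ _ fun z => by simp
      have h3 : ∑ z, (momentumCoeff n a b (m + 1) z : ℂ) * χ z =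
          (∑ z, (momentumCoeff n a b m (z + 1) : ℂ) * χ z -
            ∑ z, (momentumCoeff n a b m (z - 1) : ℂ) * χ z) / (2 * gridStep n a b) := by
        rw [← Finset.sum_sub_distrib, Finset.sum_div]
        refine Finset.sum_congr rfl fun z _ => ?_
        rw [momentumCoeff]
        push_cast
        ring
      rw [h3, h1, h2, ← Finset.sum_sub_distrib, pow_succ, ← ih, Finset.sum_div, Finset.sum_mul]
      refine Finset.sum_congr rfl fun z _ => ?_
      rw [hχm, AddChar.map_add_eq_mul, hχ]
      have : (gridStep n a b : ℂ) ≠ 0 := by exact_mod_cast hstep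
      field_simp
      ring
  by_contra hc
  simp only [not_exists, not_not] at hc
  simp only [hc, Complex.ofReal_zero, zero_mul, Finset.sum_const_zero] at key
  have : (gridStep n a b : ℂ) ≠ 0 := by exact_mod_cast hstep
  exact pow_ne_zero m (div_ne_zero (neg_ne_zero.2 Complex.I_ne_zero) this) key.symm

theorem momentumCoeff_sq_le {m : ℕ} {Np : ℝ} (hNp : ∀ i j, ‖(pHat n a b ^ m) i j‖ ^ 2 ≤ Np)
    (z : ZMod (2 ^ n)) : momentumCoeff n a b m z ^ 2 ≤ Np := by
  obtain ⟨i, hi⟩ := exists_fin_natCast z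
  have := hNp i 0
  rw [pHat_pow_apply, norm_mul, norm_pow, norm_neg, Complex.norm_I, one_pow, one_mul,
    Complex.norm_real, Real.norm_eq_abs, sq_abs, hi] at this
  simpa using this

/-- No power of the momentum matrix vanishes, so the constants may be divided by. -/
theorem normConst_pos (hn : 2 ≤ n) (hab : a < b) {m : ℕ} {Np : ℝ}
    (hNp : ∀ i j, ‖(pHat n a b ^ m) i j‖ ^ 2 ≤ Np) : 0 < Np := by
  obtain ⟨z, hz⟩ := exists_momentumCoeff_ne_zero (n := n) hn hab m
  exact lt_of_lt_of_le (by positivity) (momentumCoeff_sq_le hNp z)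

theorem aeval_xHat (P : Polynomial ℝ) :
    Polynomial.aeval (xHat n a b) P =
      diagonal fun κ => ((P.eval (gridPoint n a b κ) : ℝ) : ℂ) := by
  have h := Polynomial.aeval_algHom_apply (diagonalAlgHom (n := Fin (2 ^ n)) (α := ℂ) ℝ)
    (fun κ => (gridPoint n a b κ : ℂ)) P
  rw [diagonalAlgHom_apply, diagonalAlgHom_apply] at h
  rw [xHat, h]
  congr 1
  funext κ
  have h2 := Polynomial.aeval_algHom_apply (Pi.evalAlgHom ℝ (fun _ : Fin (2 ^ n) => ℂ) κ)
    (fun κ => (gridPoint n a b κ : ℂ)) P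
  rw [Pi.evalAlgHom_apply, Pi.evalAlgHom_apply] at h2
  rw [← h2]
  have h3 := Polynomial.aeval_algebraMap_apply ℂ (gridPoint n a b κ) P
  simpa using h3

end Momentum

end QBlock

end

noncomputable section

namespace QBlock

/-! ### Circuits and costs of the two products of one term -/

section TermCircuits

set_option linter.unusedSectionVars false

variable {Q : Type} [Fintype Q] [DecidableEq Q]

/-- Multiplication by `P(x)`, by signal processing if there are enough work qubits in `top`. -/
theorem exists_gadget {e f : Q} {top : List Q} {n k : ℕ} {g : Fin n → Q}
    (hnd : (e :: f :: (top ++ List.ofFn g)).Nodup) (hn : 1 ≤ n) (hk : k + top.length + 1 = n)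
    {a b : ℝ} (ha : -1 ≤ a) (hab : a < b) (hb : b ≤ 1) {q : ℕ} {P : Polynomial ℝ}
    (hP : IsAdmissible q P) :
    ∃ G : Circuit Q, CostLE G (8 + 4 * (n + 1) * 2 ^ k + q * (48 * n ^ 2 + 120 * n + 84))
        (4 + 8 * (n + 1) * 2 ^ k + q * (96 * n ^ 2 + 216 * n + 132)) ∧
      IdOff e G ∧ Comm (fun t => t = f ∨ t ∈ top) G ∧
      ∀ ψ : (Q → Fin 2) → ℂ, (∀ x, ψ x ≠ 0 → x e = 1 ∧ x f = 0 ∧ val top x = 0) →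
        ∀ x, x f = 0 → run G ψ x =
          (P.eval (a + val (List.ofFn g) x * gridStep n a b) : ℝ) * ψ x := by
  obtain ⟨hdeg, -, hP1⟩ := hP
  -- The least number of work qubits with room for the `n + 2` weights; minimality gives `2^w ≤ 2 (n
  -- + 1)`.
  obtain ⟨w, hw⟩ : ∃ w, w = Nat.clog 2 (n + 2) := ⟨_, rfl⟩
  have hw1 : n + 2 ≤ 2 ^ w := hw ▸ Nat.le_pow_clog (by norm_num) _
  have hw2 : 2 ^ w ≤ 2 * (n + 1) := by
    have h := Nat.pow_pred_clog_lt_self (b := 2) (by norm_num) (x := n + 2) (by omega)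
    rw [← hw] at h
    have hpos : w ≠ 0 := by rintro rfl; simp at hw1
    obtain ⟨v, rfl⟩ := Nat.exists_eq_succ_of_ne_zero hpos
    rw [Nat.pred_succ] at h
    rw [Nat.succ_eq_add_one, pow_succ]
    omega
  by_cases hwt : w ≤ top.length
  · have hlen : (top.take w).length = w := by simp [hwt]
    have hsub : (e :: f :: (top.take w ++ List.ofFn g)).Nodup := by
      refine hnd.sublist (List.Sublist.cons_cons _ (List.Sublist.cons_cons _ ?_))
      exact (List.take_sublist w top).append_right _
    obtain ⟨G, hGc, hGo, hGm, hG⟩ := exists_signal_gadget (n := n) (a := a) (b := b) hsub hn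
      (by rw [hlen]; exact hw1) ha hab.le hb hdeg.le hP1
    refine ⟨G, hGc.mono ?_ ?_, hGo, hGm.mono fun t ht => ht.imp_right List.mem_of_mem_take,
      fun ψ hψ => hG ψ fun x hx => ⟨(hψ x hx).1, (hψ x hx).2.1, ?_⟩⟩
    · rw [hlen]
      have hwn : w ≤ n := by omega
      have : (8 * n + 10) * 2 ^ w ≤ (8 * n + 10) * (2 * (n + 1)) := Nat.mul_le_mul_left _ hw2
      have h3 : 3 * ((8 * n + 10) * 2 ^ w + 4 * w + 8) ≤ 48 * n ^ 2 + 120 * n + 84 :=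
        calc _ ≤ 3 * ((8 * n + 10) * (2 * (n + 1)) + 4 * n + 8) := by omega
          _ = _ := by ring
      have h4 := Nat.mul_le_mul_left q h3
      calc _ = 8 + q * (3 * ((8 * n + 10) * 2 ^ w + 4 * w + 8)) := by ring
        _ ≤ _ := by omega
    · rw [hlen]
      have : (16 * n + 20) * 2 ^ w ≤ (16 * n + 20) * (2 * (n + 1)) := Nat.mul_le_mul_left _ hw2
      have h3 : 3 * ((16 * n + 20) * 2 ^ w + 4) ≤ 96 * n ^ 2 + 216 * n + 132 :=
        calc _ ≤ 3 * ((16 * n + 20) * (2 * (n + 1)) + 4) := by omega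
          _ = _ := by ring
      have h4 := Nat.mul_le_mul_left q h3
      calc _ = 4 + q * (3 * ((16 * n + 20) * 2 ^ w + 4)) := by ring
        _ ≤ _ := by omega
    · have := (hψ x hx).2.2
      rw [val_eq_zero_iff] at this ⊢
      exact fun q hq => this q (List.mem_of_mem_take hq)
  · have hsub : (e :: f :: List.ofFn g).Nodup :=
      hnd.sublist (List.Sublist.cons_cons _ (List.Sublist.cons_cons _ (List.sublist_append_right top _)))
    -- Fewer than `w` qubits are left in `top`, so `n ≤ w + k`, and a rotation over the whole grid
    -- costs only `O(n 2^k)`.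
    have h2n : 2 ^ n ≤ 2 * (n + 1) * 2 ^ k := by
      calc 2 ^ n ≤ 2 ^ (w + k) := Nat.pow_le_pow_right (by norm_num) (by omega)
        _ = 2 ^ w * 2 ^ k := pow_add _ _ _
        _ ≤ _ := Nat.mul_le_mul_right _ hw2
    have hb1 : ∀ x : Q → Fin 2,
        |P.eval (a + val (List.ofFn g) x * gridStep n a b)| ≤ 1 := by
      intro x
      refine (hP1 _ ?_).le
      have hv := val_lt (List.ofFn g) x
      rw [List.length_ofFn] at hv
      have hv' : (val (List.ofFn g) x : ℝ) ≤ 2 ^ n - 1 := by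
        rw [le_sub_iff_add_le]
        exact_mod_cast hv
      have hs := gridStep_pos hn hab
      have hm := gridStep_mul hn a b
      have h0 : (0 : ℝ) ≤ val (List.ofFn g) x * gridStep n a b := by positivity
      have h1 := mul_le_mul_of_nonneg_right hv' hs.le
      constructor <;> linarith
    obtain ⟨G, hGc, hGo, hGm, hG⟩ := exists_direct_gadget (n := n) (a := a) (b := b) hsub P hb1
    refine ⟨G, hGc.mono ?_ ?_, hGo, hGm.mono fun t ht => Or.inl ht,
      fun ψ hψ => hG ψ fun x hx => ⟨(hψ x hx).1, (hψ x hx).2.1⟩⟩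
    · have := Nat.zero_le (q * (48 * n ^ 2 + 120 * n + 84))
      calc _ ≤ 2 * (2 * (n + 1) * 2 ^ k) + 2 := by omega
        _ = 4 * (n + 1) * 2 ^ k + 2 := by ring
        _ ≤ _ := by omega
    · have := Nat.zero_le (q * (96 * n ^ 2 + 216 * n + 132))
      calc _ ≤ 4 * (2 * (n + 1) * 2 ^ k) := by omega
        _ = 8 * (n + 1) * 2 ^ k := by ring
        _ ≤ _ := by omega

/-- The amplitudes of the shifts in the expansion of a power of the momentum matrix. -/
def shiftAmp (n : ℕ) (a b : ℝ) (m : ℕ) (Np : ℝ) (s : ℕ) : ℝ :=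
  (-1) ^ m * momentumCoeff n a b m (s : ZMod (2 ^ n)) / Real.sqrt (2 ^ logSparsity m * Np)

/-- Each coefficient is an entry of `p̂^m` up to a phase, so it is at most `√Np`; the remaining
`√(2^l)` in the denominator pays for the uniform superposition of `k ≤ l` qubits. -/
theorem abs_shiftAmp_mul_le {n : ℕ} {a b : ℝ} {m : ℕ} {Np : ℝ} (hpos : 0 < Np)
    (hNp : ∀ i j, ‖(pHat n a b ^ m) i j‖ ^ 2 ≤ Np) {k : ℕ} (hk : k ≤ logSparsity m) (s : ℕ) :
    |shiftAmp n a b m Np s| * Real.sqrt 2 ^ k ≤ 1 := by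
  have h1 : |momentumCoeff n a b m (s : ZMod (2 ^ n))| ≤ Real.sqrt Np := by
    rw [← Real.sqrt_sq_eq_abs]
    exact Real.sqrt_le_sqrt (momentumCoeff_sq_le hNp _)
  have h2 : Real.sqrt 2 ^ k ≤ Real.sqrt 2 ^ logSparsity m :=
    pow_le_pow_right₀ (Real.one_le_sqrt.2 (by norm_num)) hk
  have h3 : Real.sqrt (2 ^ logSparsity m * Np) = Real.sqrt 2 ^ logSparsity m * Real.sqrt Np := by
    rw [Real.sqrt_mul (by positivity), show (2 : ℝ) ^ logSparsity m =
      (Real.sqrt 2 ^ logSparsity m) ^ 2 by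
        rw [← pow_mul, mul_comm, pow_mul, Real.sq_sqrt (by norm_num)], Real.sqrt_sq (by positivity)]
  have h4 : 0 < Real.sqrt Np := Real.sqrt_pos.2 hpos
  rw [shiftAmp, h3, abs_div, abs_mul, abs_pow, abs_neg, abs_one, one_pow, one_mul,
    abs_of_nonneg (a := _ * _) (by positivity), div_mul_eq_mul_div, div_le_one (by positivity),
    mul_comm]
  exact mul_le_mul h2 h1 (abs_nonneg _) (by positivity)

/-- The qubits of the circuit of one term: the control, the carry, the flags, the row register and
the column register. -/
abbrev TermQubits (n : ℕ) : Type := Fin 2 ⊕ (Fin 3 ⊕ (Fin n ⊕ Fin n))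

/-- The qubits of the row register. -/
def rowQ (n : ℕ) : List (TermQubits n) := List.ofFn fun i => Sum.inr (Sum.inr (Sum.inl i))

/-- The qubits of the column register. -/
def colQ (n : ℕ) : List (TermQubits n) := List.ofFn fun i => Sum.inr (Sum.inr (Sum.inr i))

/-- The specification of the circuit of one term. -/
def TermSpec (n : ℕ) (w : ℕ → ℝ) (p : ℕ → ℕ → ℝ) (C : Circuit (TermQubits n)) : Prop :=
  BandSpec (Sum.inl 0) (Sum.inl 1) (Sum.inr (Sum.inl 0)) (Sum.inr (Sum.inl 1))
    (rowQ n) (colQ n) w p C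

theorem exists_termCircuits {n : ℕ} (hn : 2 ≤ n) {a b : ℝ} (ha : -1 ≤ a) (hab : a < b)
    (hb : b ≤ 1) {q m : ℕ} {P : Polynomial ℝ} (hP : IsAdmissible q P) {Np : ℝ}
    (hNp : ∀ i j, ‖(pHat n a b ^ m) i j‖ ^ 2 ≤ Np) :
    (∃ C : Circuit (TermQubits n),
      CostLE C (140 * n + (4 * n + 6) * 2 ^ logSparsity m + q * (48 * n ^ 2 + 120 * n + 84))
        (124 * n + (8 * n + 12) * 2 ^ logSparsity m + q * (96 * n ^ 2 + 216 * n + 132)) ∧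
      TermSpec n (shiftAmp n a b m Np) (fun _ j => P.eval (a + j * gridStep n a b)) C) ∧
    ∃ C : Circuit (TermQubits n),
      CostLE C (140 * n + (4 * n + 6) * 2 ^ logSparsity m + q * (48 * n ^ 2 + 120 * n + 84))
        (124 * n + (8 * n + 12) * 2 ^ logSparsity m + q * (96 * n ^ 2 + 216 * n + 132)) ∧
      TermSpec n (shiftAmp n a b m Np) (fun i _ => P.eval (a + i * gridStep n a b)) C := by
  obtain ⟨k, hk⟩ : ∃ k, k = min (logSparsity m) (n - 1) := ⟨_, rfl⟩
  have hrlen : (rowQ n).length = n := by simp [rowQ]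
  have hclen : (colQ n).length = n := by simp [colQ]
  -- Lowest row qubit for the parity, the next `k` for the pattern, the others for sign extension
  -- and, before that, as workspace.
  obtain ⟨r0, mid, top, hrow, hmid⟩ : ∃ r0 mid top, r0 :: (mid ++ top) = rowQ n ∧
      mid.length = k := by
    rcases hr : rowQ n with _ | ⟨r0, L⟩
    · rw [hr] at hrlen; simp at hrlen; omega
    · rw [hr, List.length_cons] at hrlen
      exact ⟨r0, L.take k, L.drop k, by simp, by simp; omega⟩
  have hnd : ((Sum.inl 0 : TermQubits n) :: Sum.inl 1 :: Sum.inr (Sum.inl 0) ::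
      Sum.inr (Sum.inl 1) :: (r0 :: (mid ++ top) ++ colQ n)).Nodup := by
    rw [hrow]
    simp only [rowQ, colQ, List.nodup_cons, List.mem_cons, List.mem_append, List.mem_ofFn,
      List.nodup_append, List.nodup_ofFn, not_or]
    refine ⟨by simp, by simp, by simp, by simp, ?_, ?_, ?_⟩
    · intro i j h; simpa using h
    · intro i j h; simpa using h
    · rintro _ ⟨i, rfl⟩ _ ⟨j, rfl⟩ h
      simp at h
  have hlen : (r0 :: (mid ++ top)).length = n := by rw [hrow, hrlen]
  have hlen' : k + top.length + 1 = n := by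
    rw [List.length_cons, List.length_append, hmid] at hlen
    exact hlen
  have hpos := normConst_pos hn hab hNp
  have hndG : ((Sum.inl 0 : TermQubits n) :: Sum.inr (Sum.inl 1) ::
      (top ++ List.ofFn fun i => Sum.inr (Sum.inr (Sum.inr i)))).Nodup := by
    refine hnd.sublist (List.Sublist.cons_cons _ (List.Sublist.cons _ (List.Sublist.cons _
      (List.Sublist.cons_cons _ ?_))))
    rw [List.cons_append, List.append_assoc]
    exact List.Sublist.cons _ (List.sublist_append_right _ _)
  obtain ⟨G, hGc, hGo, hGm, hG⟩ := exists_gadget (k := k) hndG (by omega) hlen' ha hab hb hP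
  have hk2 : 2 ^ k ≤ 2 ^ logSparsity m := Nat.pow_le_pow_right (by norm_num) (by omega)
  have hkn := Nat.mul_le_mul_left n hk2
  obtain ⟨⟨C, hC, hCs⟩, D, hD, hDs⟩ := exists_bandSpec hnd hn hlen hclen (hmid.trans hk)
    (w := shiftAmp n a b m Np)
    (abs_shiftAmp_mul_le hpos hNp (by omega))
    (fun s hs => by
      have : momentumCoeff n a b m (s : ZMod (2 ^ n)) ≠ 0 := by
        intro h
        rw [shiftAmp, h] at hs
        simp at hs
      obtain ⟨u, hu1, hu2, hu3⟩ := momentumCoeff_support this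
      refine ⟨u, hu1, hu2, ?_⟩
      rw [← ZMod.intCast_eq_intCast_iff, hu3, Int.cast_natCast])
    (d := fun j => P.eval (a + j * gridStep n a b)) hGc hGo hGm hG
  rw [hrow, hmid] at *
  refine ⟨⟨C, hC.mono ?_ ?_, hCs⟩, D, hD.mono ?_ ?_, hDs⟩
  all_goals
    generalize q * (48 * n ^ 2 + 120 * n + 84) = X
    generalize q * (96 * n ^ 2 + 216 * n + 132) = Y
    nlinarith

end TermCircuits

end QBlock

end

noncomputable section

namespace QBlock

/-! ### The unitaries of the terms -/

section TermMat

set_option linter.unusedSectionVars false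

variable {R : Type} [Fintype R] [DecidableEq R]

/-- The bit string with the control set and the carry cleared. -/
def withCtrl (y : R → Fin 2) : Fin 2 ⊕ R → Fin 2 := Sum.elim ![1, 0] y

/-- The state with the control set and the carry cleared. -/
def ctrlState (φ : (R → Fin 2) → ℂ) : (Fin 2 ⊕ R → Fin 2) → ℂ :=
  fun x => if x (Sum.inl 0) = 1 ∧ x (Sum.inl 1) = 0 then φ fun s => x (Sum.inr s) else 0

/-- The matrix of a circuit if the control is set and the carry cleared. -/
def ctrlMat (C : Circuit (Fin 2 ⊕ R)) : Matrix (R → Fin 2) (R → Fin 2) ℂ :=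
  (evalCircuit C).submatrix withCtrl withCtrl

theorem ctrlState_withCtrl (φ : (R → Fin 2) → ℂ) (y : R → Fin 2) :
    ctrlState φ (withCtrl y) = φ y := by
  simp [ctrlState, withCtrl]

theorem eq_withCtrl {x : Fin 2 ⊕ R → Fin 2} (h0 : x (Sum.inl 0) = 1) (h1 : x (Sum.inl 1) = 0) :
    x = withCtrl fun s => x (Sum.inr s) := by
  funext q
  rcases q with i | s
  · fin_cases i
    · simpa [withCtrl] using h0
    · simpa [withCtrl] using h1
  · rfl

theorem withCtrl_injective : Function.Injective (withCtrl (R := R)) := by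
  intro y y' h
  funext s
  exact congrFun h (Sum.inr s)

/-- The circuit preserves the values of control and carry, so it maps the sector with values 1 and 0
to itself. -/
theorem run_ctrlState {C : Circuit (Fin 2 ⊕ R)}
    (hC : Comm (fun q => q ≠ Sum.inl 0 ∧ q ≠ Sum.inl 1) C) (φ : (R → Fin 2) → ℂ) :
    run C (ctrlState φ) = ctrlState (ctrlMat C *ᵥ φ) := by
  funext x
  by_cases hx : x (Sum.inl 0) = 1 ∧ x (Sum.inl 1) = 0
  · rw [eq_withCtrl hx.1 hx.2, ctrlState_withCtrl, run, mulVec, mulVec, dotProduct, dotProduct]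
    symm
    apply Finset.sum_of_injOn withCtrl withCtrl_injective.injOn (by simp)
    · intro z _ hz
      have : ctrlState φ z = 0 := by
        rw [ctrlState, if_neg]
        rintro ⟨h0, h1⟩
        exact hz ⟨_, by simp, (eq_withCtrl h0 h1).symm⟩
      rw [this, mul_zero]
    · intro y _
      rw [ctrlState_withCtrl, ctrlMat, submatrix_apply]
  · rw [hC.support (p := fun x => x (Sum.inl 0) = 1 ∧ x (Sum.inl 1) = 0) ?_ ?_ x hx, ctrlState,
      if_neg hx]
    · intro t ht x b
      rw [Function.update_of_ne ht.1.symm, Function.update_of_ne ht.2.symm]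
    · intro x hx
      rw [ctrlState, if_neg hx]

/-- The inverse circuit preserves the same sector, and its block is the adjoint of the block. -/
theorem ctrlMat_mem_unitaryGroup {C : Circuit (Fin 2 ⊕ R)}
    (hC : Comm (fun q => q ≠ Sum.inl 0 ∧ q ≠ Sum.inl 1) C) :
    ctrlMat C ∈ unitaryGroup (R → Fin 2) ℂ := by
  have hs : ctrlMat (invC C) = star (ctrlMat C) := by
    rw [ctrlMat, evalCircuit_invC, ctrlMat]
    rfl
  rw [mem_unitaryGroup_iff', ← hs]
  apply Matrix.ext_of_mulVec_single
  intro i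
  have h := run_invC_run C (ctrlState (Pi.single i 1))
  rw [run_ctrlState hC, run_ctrlState hC.inv] at h
  rw [one_mulVec, ← mulVec_mulVec]
  funext y
  have := congrFun h (withCtrl y)
  rwa [ctrlState_withCtrl, ctrlState_withCtrl] at this

/-- Bit strings as contents of the flag register, the row register and the column register. -/
def termDecode (n : ℕ) : (Fin 3 ⊕ (Fin n ⊕ Fin n) → Fin 2) ≃ TermIdx n :=
  (Equiv.sumArrowEquivProdArrow _ _ _).trans
    (Equiv.prodCongr finFunctionFinEquiv
      ((Equiv.sumArrowEquivProdArrow _ _ _).trans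
        (Equiv.prodCongr finFunctionFinEquiv finFunctionFinEquiv)))

/-- The unitary of a circuit of one term. -/
def termMat {n : ℕ} (C : Circuit (TermQubits n)) : Matrix (TermIdx n) (TermIdx n) ℂ :=
  (ctrlMat C).submatrix (termDecode n).symm (termDecode n).symm

theorem submatrix_mem_unitaryGroup {ι κ : Type*} [Fintype ι] [DecidableEq ι] [Fintype κ]
    [DecidableEq κ] {U : Matrix ι ι ℂ} (hU : U ∈ unitaryGroup ι ℂ) (f : κ ≃ ι) :
    U.submatrix f f ∈ unitaryGroup κ ℂ := by
  rw [mem_unitaryGroup_iff'] at hU ⊢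
  have : star (U.submatrix f f) = (star U).submatrix f f := rfl
  rw [this, submatrix_mul_equiv, hU, submatrix_one_equiv]

theorem sum_smul_ket_apply {n : ℕ} {F : Type} [DecidableEq F] [Zero F] (σ : Fin (2 ^ n) → ℂ)
    (f : F) (i j : Fin (2 ^ n)) :
    (∑ j, σ j • ket ((0 : F), ((0 : Fin (2 ^ n)), j))) (f, (i, j)) =
      if f = 0 ∧ i = 0 then σ j else 0 := by
  rw [Finset.sum_apply, Finset.sum_eq_single j]
  · by_cases h : f = 0 ∧ i = 0
    · obtain ⟨rfl, rfl⟩ := h; simp [ket]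
    · rw [if_neg h, Pi.smul_apply, ket, Pi.single_apply, if_neg, smul_zero]
      simpa using h
  · intro j' _ hj
    rw [Pi.smul_apply, ket, Pi.single_apply, if_neg, smul_zero]
    simp [hj.symm]
  · simp

/-- The orthogonal remainder can always be defined as the difference, so only the amplitudes with
zero flags matter. -/
theorem encodesEntries_iff {n : ℕ} {F : Type} [Fintype F] [DecidableEq F] [Zero F] {c : ℂ}
    {M : Matrix (Fin (2 ^ n)) (Fin (2 ^ n)) ℂ}
    {A : Matrix (F × (Fin (2 ^ n) × Fin (2 ^ n))) (F × (Fin (2 ^ n) × Fin (2 ^ n))) ℂ} :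
    EncodesEntries c M A ↔ ∀ (σ : Fin (2 ^ n) → ℂ) (i j : Fin (2 ^ n)),
      (A *ᵥ (∑ j, σ j • ket (0, (0, j)))) (0, (i, j)) = c * (M i j * σ j) := by
  have key : ∀ (σ : Fin (2 ^ n) → ℂ) (i j : Fin (2 ^ n)),
      (∑ i, ∑ j, (M i j * σ j) • ket ((0 : F), (i, j))) (0, (i, j)) = M i j * σ j := by
    intro σ i j
    rw [Finset.sum_apply, Finset.sum_eq_single i]
    · rw [Finset.sum_apply, Finset.sum_eq_single j]
      · simp [ket]
      · intro j' _ hj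
        rw [Pi.smul_apply, ket, Pi.single_apply, if_neg, smul_zero]
        simp [hj.symm]
      · simp
    · intro i' _ hi
      rw [Finset.sum_apply]
      refine Finset.sum_eq_zero fun j' _ => ?_
      rw [Pi.smul_apply, ket, Pi.single_apply, if_neg, smul_zero]
      simp [hi.symm]
    · simp
  constructor
  · intro h σ i j
    obtain ⟨r, hr, h⟩ := h σ
    rw [h, Pi.add_apply, hr, Pi.smul_apply, key, add_zero, smul_eq_mul]
  · intro h σ
    refine ⟨A *ᵥ (∑ j, σ j • ket (0, (0, j))) -
      c • (∑ i, ∑ j, (M i j * σ j) • ket (0, (i, j))), fun i j => ?_, by abel⟩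
    rw [Pi.sub_apply, h, Pi.smul_apply, key, smul_eq_mul, sub_self]

theorem val_withCtrl_row {n : ℕ} (y : Fin 3 ⊕ (Fin n ⊕ Fin n) → Fin 2) :
    val (rowQ n) (withCtrl y) = (termDecode n y).2.1 := by
  rw [rowQ, val_ofFn]
  simp [termDecode, withCtrl]

theorem val_withCtrl_col {n : ℕ} (y : Fin 3 ⊕ (Fin n ⊕ Fin n) → Fin 2) :
    val (colQ n) (withCtrl y) = (termDecode n y).2.2 := by
  rw [colQ, val_ofFn]
  simp [termDecode, withCtrl]

theorem termDecode_fst_eq_zero {n : ℕ} {y : Fin 3 ⊕ (Fin n ⊕ Fin n) → Fin 2}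
    (h : (termDecode n y).1 = 0) (i : Fin 3) : y (Sum.inl i) = 0 := by
  have h0 : (finFunctionFinEquiv fun i : Fin 3 => y (Sum.inl i) : Fin (2 ^ 3)) =
      finFunctionFinEquiv fun _ : Fin 3 => (0 : Fin 2) := by
    refine h.trans ?_
    ext
    rw [finFunctionFinEquiv_apply]
    simp
  exact congrFun (finFunctionFinEquiv.injective h0) i

theorem encodesEntries_termMat {n : ℕ} {w : ℕ → ℝ} {p : ℕ → ℕ → ℝ} {C : Circuit (TermQubits n)}
    (hC : TermSpec n w p C) {c : ℂ} {M : Matrix (Fin (2 ^ n)) (Fin (2 ^ n)) ℂ}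
    (hM : ∀ i j : Fin (2 ^ n),
      ((w (((i : ℕ) + 2 ^ n - j) % 2 ^ n) * p i j : ℝ) : ℂ) = c * M i j) :
    EncodesEntries c M (termMat C) := by
  obtain ⟨-, hm, hs⟩ := hC
  rw [encodesEntries_iff]
  intro σ i j
  obtain ⟨v, hv⟩ : ∃ v : TermIdx n → ℂ, v = ∑ j, σ j • ket (0, (0, j)) := ⟨_, rfl⟩
  have hvz : ∀ f i j, v (f, (i, j)) = if f = 0 ∧ i = 0 then σ j else 0 := by
    intro f i j
    rw [hv, sum_smul_ket_apply]
  obtain ⟨y, hy⟩ : ∃ y, termDecode n y = (0, (i, j)) := (termDecode n).surjective _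
  have h1 : (termMat C *ᵥ v) (0, (i, j)) = run C (ctrlState fun y => v (termDecode n y))
      (withCtrl y) := by
    rw [run_ctrlState hm, ctrlState_withCtrl, termMat, submatrix_mulVec_equiv, ← hy]
    simp only [Function.comp_apply, Equiv.symm_apply_apply, Equiv.symm_symm]
    rfl
  have hf := termDecode_fst_eq_zero (n := n) (y := y) (by rw [hy])
  have hrl : (rowQ n).length = n := by simp [rowQ]
  rw [← hv, h1, hs _ _ _ (by simp [withCtrl]) (by simp [withCtrl]) (hf 0) (hf 1), hrl,
    val_withCtrl_row, val_withCtrl_col, hy, hM]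
  · have hz : zeroL (rowQ n) (withCtrl y) =
        withCtrl (Sum.elim (fun i => y (Sum.inl i)) (Sum.elim (fun _ => 0) fun j => y (Sum.inr (Sum.inr j)))) := by
      funext s
      rcases s with s | s | s | s <;> simp [zeroL, rowQ, withCtrl, List.mem_ofFn]
    have hd : termDecode n (Sum.elim (fun i => y (Sum.inl i))
        (Sum.elim (fun _ => 0) fun j => y (Sum.inr (Sum.inr j)))) = (0, (0, j)) := by
      have h3 : (finFunctionFinEquiv fun _ : Fin n => (0 : Fin 2)) = 0 := by
        ext
        rw [finFunctionFinEquiv_apply]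
        simp
      refine Prod.ext ?_ (Prod.ext h3 ?_)
      · exact (congrArg Prod.fst hy : (termDecode n y).1 = 0)
      · exact (congrArg (fun z => z.2.2) hy : (termDecode n y).2.2 = j)
    rw [hz, ctrlState_withCtrl, hd, hvz]
    simp [mul_assoc]
  · intro x hx
    rw [ctrlState] at hx
    by_cases h : x (Sum.inl 0) = 1 ∧ x (Sum.inl 1) = 0
    · rw [if_pos h] at hx
      obtain ⟨f, i', j', hfij⟩ : ∃ f i' j', termDecode n (fun s => x (Sum.inr s)) = (f, (i', j')) :=
        ⟨_, _, _, rfl⟩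
      have hfi : f = 0 ∧ i' = 0 := by
        by_contra h'
        rw [hfij, hvz, if_neg h'] at hx
        exact hx rfl
      obtain ⟨rfl, rfl⟩ := hfi
      have hf' := termDecode_fst_eq_zero (n := n) (y := fun s => x (Sum.inr s)) (by rw [hfij])
      refine ⟨h.1, h.2, hf' 0, hf' 1, ?_⟩
      rw [eq_withCtrl h.1 h.2, val_withCtrl_row, hfij]
      simp
    · rw [if_neg h] at hx
      exact absurd rfl hx

/-- The phase `(-i)^m` of the encoding factor and that of `p̂^m` combine to `(-1)^m`: the amplitudes
are real and accessible to real rotations. -/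
theorem shiftAmp_eq {n : ℕ} {a b : ℝ} {m : ℕ} {Np : ℝ} (i j : Fin (2 ^ n)) :
    (shiftAmp n a b m Np (((i : ℕ) + 2 ^ n - j) % 2 ^ n) : ℂ) =
      (-Complex.I) ^ m / (Real.sqrt (2 ^ logSparsity m * Np) : ℂ) * (pHat n a b ^ m) i j := by
  have h1 : (((((i : ℕ) + 2 ^ n - j) % 2 ^ n : ℕ)) : ZMod (2 ^ n)) = (i : ℕ) - (j : ℕ) := by
    have h0 : ((2 ^ n : ℕ) : ZMod (2 ^ n)) = 0 := ZMod.natCast_self _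
    rw [ZMod.natCast_mod, Nat.cast_sub (by omega), Nat.cast_add, h0, add_zero]
  have h2 : (-Complex.I) ^ m * (-Complex.I) ^ m = (-1) ^ m := by
    rw [← mul_pow]; simp
  rw [shiftAmp, h1, pHat_pow_apply]
  push_cast
  rw [← h2]
  ring

theorem isOneTermAux_termPX {n : ℕ} {a b : ℝ} {m : ℕ} {P : Polynomial ℝ} {Np : ℕ → ℝ}
    {C : Circuit (TermQubits n)} (hC : TermSpec n (shiftAmp n a b m (Np m))
      (fun i _ => P.eval (a + i * gridStep n a b)) C) :
    IsOneTermAux Np m (termPX n a b P m) (termMat C) := by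
  refine ⟨submatrix_mem_unitaryGroup (ctrlMat_mem_unitaryGroup hC.2.1) _,
    encodesEntries_termMat hC fun i j => ?_⟩
  rw [Complex.ofReal_mul, shiftAmp_eq, termPX, aeval_xHat, diagonal_mul, gridPoint]
  ring

theorem isOneTermAux_termXP {n : ℕ} {a b : ℝ} {m : ℕ} {P : Polynomial ℝ} {Np : ℕ → ℝ}
    {C : Circuit (TermQubits n)} (hC : TermSpec n (shiftAmp n a b m (Np m))
      (fun _ j => P.eval (a + j * gridStep n a b)) C) :
    IsOneTermAux Np m (termXP n a b P m) (termMat C) := by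
  refine ⟨submatrix_mem_unitaryGroup (ctrlMat_mem_unitaryGroup hC.2.1) _,
    encodesEntries_termMat hC fun i j => ?_⟩
  rw [Complex.ofReal_mul, shiftAmp_eq, termXP, aeval_xHat, mul_diagonal, gridPoint]
  ring

end TermMat

end QBlock

end

noncomputable section

namespace QBlock

/-! ### Multi-controlled circuits -/

section Control

set_option linter.unusedSectionVars false

section Chain

variable {Q : Type} [Fintype Q] [DecidableEq Q]

/-- A rotation by `π / 2` maps `|0⟩` to `|1⟩`; its sign on `|1⟩` does not matter since the target
starts at zero. -/
theorem run_muxY_set {L : List Q} {t : Q} (ht : t ∉ L) {p : (Q → Fin 2) → Prop} [DecidablePred p]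
    (hp : BitsIn L p) {ψ : (Q → Fin 2) → ℂ} (hψ : ∀ x, x t = 1 → ψ x = 0) (x : Q → Fin 2) :
    run (muxY L t fun x => if p x then Real.pi / 2 else 0) ψ x =
      if x t = (if p x then 1 else 0) then ψ (Function.update x t 0) else 0 := by
  have hθ : BitsIn L fun x => if p x then Real.pi / 2 else (0 : ℝ) := by
    intro x y h
    simp only [hp x y h]
  have h1 : ψ (Function.update x t 1) = 0 := hψ _ (by simp)
  rw [run_muxY ht hθ, h1]
  rcases fin2_cases (x t) with hx | hx <;> by_cases h : p x <;> simp [hx, h]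

/-- The ancillas `anc 0, …, anc i` are set to the conjunctions of the conditions
`ctrl k = b k`, `k ≤ j`. -/
def chainC (anc ctrl : ℕ → Q) (b : ℕ → Fin 2) : ℕ → Circuit Q
  | 0 => muxY [ctrl 0] (anc 0) fun x => if x (ctrl 0) = b 0 then Real.pi / 2 else 0
  | i + 1 => chainC anc ctrl b i ++ muxY [anc i, ctrl (i + 1)] (anc (i + 1)) fun x =>
      if x (anc i) = 1 ∧ x (ctrl (i + 1)) = b (i + 1) then Real.pi / 2 else 0

theorem cost_chainC (anc ctrl : ℕ → Q) (b : ℕ → Fin 2) (i : ℕ) :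
    CostLE (chainC anc ctrl b i) (6 * i + 4) (6 * i + 2) := by
  induction i with
  | zero => exact (cost_muxY _ _ _).mono (by simp) (by simp)
  | succ i ih =>
    refine (ih.append (cost_muxY _ _ _)).mono ?_ ?_ <;>
      simp only [List.length_cons, List.length_nil] <;> omega

/-- The ancillas `anc 0, …, anc i` are reset to zero. -/
def clearAnc (anc : ℕ → Q) (i : ℕ) (x : Q → Fin 2) : Q → Fin 2 :=
  zeroL ((List.range (i + 1)).map anc) x

theorem run_chainC {anc ctrl : ℕ → Q} {b : ℕ → Fin 2} {γ : ℕ}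
    (hanc : ∀ i ≤ γ, ∀ j ≤ γ, anc i = anc j → i = j) (hca : ∀ i j, ctrl i ≠ anc j)
    {ψ : (Q → Fin 2) → ℂ} (hψ : ∀ x, (∃ j ≤ γ, x (anc j) = 1) → ψ x = 0) {i : ℕ} (hi : i ≤ γ)
    (x : Q → Fin 2) :
    run (chainC anc ctrl b i) ψ x =
      if ∀ j ≤ i, x (anc j) = (if ∀ k ≤ j, x (ctrl k) = b k then 1 else 0)
      then ψ (clearAnc anc i x) else 0 := by
  induction i generalizing x with
  | zero =>
    rw [chainC, run_muxY_set (p := fun x => x (ctrl 0) = b 0) (by simpa using (hca 0 0).symm)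
      (fun x y h => by simp only [h (ctrl 0) (by simp)]) fun x hx => hψ x ⟨0, hi, hx⟩]
    have : Function.update x (anc 0) 0 = clearAnc anc 0 x := by
      funext q
      by_cases hq : q = anc 0
      · subst hq; simp [clearAnc, zeroL]
      · simp [clearAnc, zeroL, hq]
    rw [this]
    simp only [Nat.le_zero_eq, forall_eq]
  | succ i ih =>
    have ih' := fun x => ih (by omega) x
    have hne : ∀ j ≤ i, anc j ≠ anc (i + 1) := fun j hj h => by
      have := hanc j (by omega) (i + 1) hi h
      omega
    rw [chainC, run_append, run_muxY_set (p := fun x => x (anc i) = 1 ∧ x (ctrl (i + 1)) = b (i + 1))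
      (by
        simp only [List.mem_cons, List.not_mem_nil, or_false, not_or]
        exact ⟨(hne i le_rfl).symm, (hca _ _).symm⟩)
      (fun x y h => by simp only [h (anc i) (by simp), h (ctrl (i + 1)) (by simp)])]
    · rw [ih']
      have h1 : clearAnc anc i (Function.update x (anc (i + 1)) 0) = clearAnc anc (i + 1) x := by
        funext q
        by_cases hq : q = anc (i + 1)
        · subst hq
          simp only [clearAnc, zeroL, Function.update_self, ite_self, List.range_succ (n := i + 1),
            List.map_append, List.mem_append, List.map_cons, List.map_nil, List.mem_singleton,
            or_true, if_true]
        · simp only [clearAnc, zeroL, Function.update_of_ne hq, List.range_succ (n := i + 1),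
            List.map_append, List.mem_append, List.map_cons, List.map_nil, List.mem_singleton, hq,
            or_false]
      have h2 : (∀ j ≤ i, Function.update x (anc (i + 1)) 0 (anc j) =
          if ∀ k ≤ j, Function.update x (anc (i + 1)) 0 (ctrl k) = b k then 1 else 0) ↔
          ∀ j ≤ i, x (anc j) = if ∀ k ≤ j, x (ctrl k) = b k then 1 else 0 := by
        refine forall₂_congr fun j hj => ?_
        simp only [Function.update_of_ne (hne j hj), Function.update_of_ne (hca _ (i + 1))]
      rw [h1]
      simp only [h2]
      by_cases h3 : ∀ j ≤ i, x (anc j) = if ∀ k ≤ j, x (ctrl k) = b k then 1 else 0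
      · rw [if_pos h3]
        -- On the support of the state, `anc i` already holds the conjunction of the earlier
        -- conditions.
        have h4 : (x (anc i) = 1 ∧ x (ctrl (i + 1)) = b (i + 1)) ↔
            ∀ k ≤ i + 1, x (ctrl k) = b k := by
          rw [h3 i le_rfl]
          constructor
          · rintro ⟨h5, h6⟩ k hk
            have h7 : ∀ k ≤ i, x (ctrl k) = b k := by
              by_contra h8
              simp [h8] at h5
            rcases Nat.le_succ_iff.1 hk with hk | rfl
            · exact h7 k hk
            · exact h6
          · intro h
            refine ⟨if_pos fun k hk => h k (by omega), h _ le_rfl⟩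
        simp only [h4]
        congr 1
        apply propext
        constructor
        · intro h j hj
          rcases Nat.le_succ_iff.1 hj with hj | rfl
          · exact h3 j hj
          · exact h
        · intro h
          exact h _ le_rfl
      · rw [if_neg h3, ite_self, if_neg]
        exact fun h => h3 fun j hj => h j (by omega)
    · intro x hx
      rw [ih', hψ, ite_self]
      refine ⟨i + 1, hi, ?_⟩
      rw [clearAnc, zeroL, if_neg, hx]
      simp only [List.mem_map, List.mem_range, not_exists, not_and]
      exact fun j hj => hne j (by omega)

end Chain

/-- The operator is block diagonal in the control register. -/
theorem multiControl_mulVec {K ι : Type} [Fintype K] [DecidableEq K] [Fintype ι] [DecidableEq ι]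
    (b : K) (A : Matrix ι ι ℂ) (v : K × ι → ℂ) (k : K) (t : ι) :
    (multiControl b A *ᵥ v) (k, t) = if k = b then (A *ᵥ fun t => v (b, t)) t else v (k, t) := by
  have h : ∀ k', multiControl b A (k, t) k' =
      if k = k'.1 then (if k = b then A t k'.2 else (1 : Matrix ι ι ℂ) t k'.2) else 0 := by
    rintro ⟨k', t'⟩
    rw [multiControl, Matrix.add_apply, Matrix.sum_apply]
    simp only [kroneckerMap_apply, single_apply]
    rcases eq_or_ne k b with rfl | hk
    · rw [Finset.sum_eq_zero]
      · by_cases hk' : k = k' <;> simp [hk']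
      · intro i hi
        have : i ≠ k := (Finset.mem_erase.1 hi).1
        simp [this]
    · rw [Finset.sum_eq_single k]
      · by_cases hk' : k = k'
        · subst hk'
          simp only [if_neg hk, if_true, hk.symm, false_and, if_false, zero_mul, true_and, one_mul,
            zero_add]
        · simp [hk', hk.symm]
      · intro i _ hi
        simp [hi]
      · simp [hk]
  rw [mulVec, dotProduct, Fintype.sum_prod_type, Finset.sum_eq_single k]
  · simp only [h, if_true]
    split_ifs with hk
    · subst hk; rfl
    · simp [one_apply]
  · intro k' _ hk'
    refine Finset.sum_eq_zero fun t' _ => ?_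
    rw [h, if_neg hk'.symm, zero_mul]
  · simp

variable {n γ : ℕ}

/-- Bit strings as contents of the coefficient register and of the registers of a term. -/
def ctrlDecode (n γ : ℕ) : (AuxQubits n γ → Fin 2) ≃ Fin (2 ^ (γ + 1)) × TermIdx n :=
  (decode n γ).trans (Equiv.prodAssoc _ _ _)

/-- A bit string on the coefficient register, and one on the other registers. -/
def joinBits (u : Fin (γ + 1) → Fin 2) (t : Fin 3 ⊕ (Fin n ⊕ Fin n) → Fin 2) :
    AuxQubits n γ → Fin 2 :=
  Sum.elim (Sum.elim u fun i => t (Sum.inl i)) fun i => t (Sum.inr i)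

theorem ctrlDecode_joinBits (u : Fin (γ + 1) → Fin 2) (t : Fin 3 ⊕ (Fin n ⊕ Fin n) → Fin 2) :
    ctrlDecode n γ (joinBits u t) = (finFunctionFinEquiv u, termDecode n t) := rfl

theorem eq_joinBits (x : AuxQubits n γ → Fin 2) :
    x = joinBits (fun i => x (Sum.inl (Sum.inl i)))
      (Sum.elim (fun i => x (Sum.inl (Sum.inr i))) fun i => x (Sum.inr i)) := by
  funext s
  rcases s with (s | s) | s <;> rfl

theorem submatrix_ctrlDecode_mulVec
    (A : Matrix (Fin (2 ^ (γ + 1)) × TermIdx n) (Fin (2 ^ (γ + 1)) × TermIdx n) ℂ)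
    (φ : (AuxQubits n γ → Fin 2) → ℂ) (x : AuxQubits n γ → Fin 2) :
    ((A.submatrix (ctrlDecode n γ) (ctrlDecode n γ)) *ᵥ φ) x =
      (A *ᵥ fun z => φ ((ctrlDecode n γ).symm z)) (ctrlDecode n γ x) := by
  rw [submatrix_mulVec_equiv]
  rfl

theorem multiControl_submatrix_mulVec (κ : Fin (2 ^ (γ + 1))) (C : Circuit (TermQubits n))
    (φ : (AuxQubits n γ → Fin 2) → ℂ) (u : Fin (γ + 1) → Fin 2)
    (t : Fin 3 ⊕ (Fin n ⊕ Fin n) → Fin 2) :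
    (((multiControl κ (termMat C)).submatrix (ctrlDecode n γ) (ctrlDecode n γ)) *ᵥ φ)
        (joinBits u t) =
      if finFunctionFinEquiv u = κ then (ctrlMat C *ᵥ fun t => φ (joinBits u t)) t
      else φ (joinBits u t) := by
  rw [submatrix_ctrlDecode_mulVec, ctrlDecode_joinBits, multiControl_mulVec]
  have h : ∀ t, (ctrlDecode n γ).symm (finFunctionFinEquiv u, termDecode n t) = joinBits u t := by
    intro t
    rw [Equiv.symm_apply_eq, ctrlDecode_joinBits]
  split_ifs with hu
  · subst hu
    rw [termMat, submatrix_mulVec_equiv]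
    simp only [Function.comp_apply, Equiv.symm_apply_apply, Equiv.symm_symm]
    congr 1
    funext t
    simp only [Function.comp_apply, h]
  · rw [h]

/-- The qubits of a term among all qubits. -/
def termEmb (n γ : ℕ) : TermQubits n ↪ Fin (γ + 2) ⊕ AuxQubits n γ where
  toFun := Sum.elim (fun i => Sum.inl (if i = 0 then ⟨γ, by omega⟩ else ⟨γ + 1, by omega⟩))
    (Sum.elim (fun i => Sum.inr (Sum.inl (Sum.inr i))) fun i => Sum.inr (Sum.inr i))
  inj' := by
    rintro (i | i | i) (j | j | j) h
    · simp only [Sum.elim_inl, Sum.inl.injEq] at h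
      rcases fin2_cases i with rfl | rfl <;> rcases fin2_cases j with rfl | rfl <;> simp_all
    all_goals simp at h
    all_goals simp [h]

theorem termEmb_flag (i : Fin 3) :
    termEmb n γ (Sum.inr (Sum.inl i)) = Sum.inr (Sum.inl (Sum.inr i)) := rfl

theorem termEmb_data (i : Fin n ⊕ Fin n) :
    termEmb n γ (Sum.inr (Sum.inr i)) = Sum.inr (Sum.inr i) := rfl

theorem extend_comp_self {Q Q' : Type} (f : Q ↪ Q') (x : Q' → Fin 2) :
    Function.extend f (fun q => x (f q)) x = x := by
  funext q
  by_cases h : ∃ s, f s = q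
  · obtain ⟨s, rfl⟩ := h
    rw [f.injective.extend_apply]
  · rw [Function.extend_apply' _ _ _ h]

/-- The multi-controlled unitary of a term, with the chain of ancillas. -/
theorem exists_control (κ : Fin (2 ^ (γ + 1))) {C : Circuit (TermQubits n)}
    (hoff : IdOff (Sum.inl 0) C) (hcomm : Comm (fun q => q ≠ Sum.inl 0 ∧ q ≠ Sum.inl 1) C)
    {s c : ℕ} (hC : CostLE C s c) :
    ∃ D : Circuit (Fin (γ + 2) ⊕ AuxQubits n γ),
      CostLE D (s + 12 * γ + 8) (c + 12 * γ + 4) ∧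
      Implements D
        ((multiControl κ (termMat C)).submatrix (ctrlDecode n γ) (ctrlDecode n γ)) := by
  classical
  -- Indexing by `ℕ` with wrap-around suits the recursion of the chain; only indices up to `γ` are
  -- used. The ancilla `γ` becomes the control of the term and `γ + 1` its carry.
  obtain ⟨anc, hancd⟩ : ∃ anc : ℕ → Fin (γ + 2) ⊕ AuxQubits n γ,
    anc = fun i => Sum.inl (Fin.ofNat (γ + 2) i) := ⟨_, rfl⟩
  obtain ⟨ctrl, hctrld⟩ : ∃ ctrl : ℕ → Fin (γ + 2) ⊕ AuxQubits n γ,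
    ctrl = fun i => Sum.inr (Sum.inl (Sum.inl (Fin.ofNat (γ + 1) i))) := ⟨_, rfl⟩
  obtain ⟨b, hb⟩ : ∃ b : ℕ → Fin 2,
    b = fun i => finFunctionFinEquiv.symm κ (Fin.ofNat (γ + 1) i) := ⟨_, rfl⟩
  have hanc : ∀ i ≤ γ, ∀ j ≤ γ, anc i = anc j → i = j := by
    intro i hi j hj h
    rw [hancd] at h
    simp only [Sum.inl.injEq, Fin.ext_iff, Fin.val_ofNat] at h
    rwa [Nat.mod_eq_of_lt (by omega), Nat.mod_eq_of_lt (by omega)] at h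
  have hca : ∀ i j, ctrl i ≠ anc j := by
    intro i j
    rw [hancd, hctrld]
    simp
  obtain ⟨Ch, hCh⟩ : ∃ Ch, Ch = chainC anc ctrl b γ := ⟨_, rfl⟩
  have hChc : CostLE Ch (6 * γ + 4) (6 * γ + 2) := hCh ▸ cost_chainC _ _ _ _
  -- The lower ancillas of the chain, which the term circuit does not touch, hold their correct
  -- values.
  obtain ⟨ok, hok⟩ : ∃ ok : (Fin (γ + 2) ⊕ AuxQubits n γ → Fin 2) → Prop, ok = fun x =>
    ∀ j < γ, x (anc j) = if ∀ k ≤ j, x (ctrl k) = b k then 1 else 0 := ⟨_, rfl⟩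
  have hfull : ∀ x : Fin (γ + 2) ⊕ AuxQubits n γ → Fin 2, (∀ k ≤ γ, x (ctrl k) = b k) ↔
      finFunctionFinEquiv (fun i : Fin (γ + 1) => x (Sum.inr (Sum.inl (Sum.inl i)))) = κ := by
    intro x
    rw [← Equiv.eq_symm_apply, hctrld, hb]
    constructor
    · intro h
      funext i
      have := h i (by omega)
      simpa using this
    · intro h k _
      exact congrFun h _
  have hancγ : anc γ = Sum.inl ⟨γ, by omega⟩ := by
    rw [hancd]
    simp only [Sum.inl.injEq, Fin.ext_iff, Fin.val_ofNat]
    exact Nat.mod_eq_of_lt (by omega)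
  have hrunCh : ∀ (φ : (AuxQubits n γ → Fin 2) → ℂ) (x : Fin (γ + 2) ⊕ AuxQubits n γ → Fin 2),
      run Ch (withZeroAncillas (γ + 2) φ) x =
        if ok x ∧ x (Sum.inl ⟨γ, by omega⟩) = (if finFunctionFinEquiv
          (fun i : Fin (γ + 1) => x (Sum.inr (Sum.inl (Sum.inl i)))) = κ then 1 else 0) ∧
          x (Sum.inl ⟨γ + 1, by omega⟩) = 0
        then φ fun q => x (Sum.inr q) else 0 := by
    intro φ x
    rw [hCh, run_chainC hanc hca (fun x ⟨j, hj, hx⟩ => ?_) le_rfl]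
    · have h1 : (∀ j ≤ γ, x (anc j) = if ∀ k ≤ j, x (ctrl k) = b k then 1 else 0) ↔
          ok x ∧ x (Sum.inl ⟨γ, by omega⟩) = (if finFunctionFinEquiv
            (fun i : Fin (γ + 1) => x (Sum.inr (Sum.inl (Sum.inl i)))) = κ then 1 else 0) := by
        rw [hok, ← hancγ]
        simp only [← hfull]
        constructor
        · exact fun h => ⟨fun j hj => h j hj.le, h γ le_rfl⟩
        · rintro ⟨h, h'⟩ j hj
          rcases hj.lt_or_eq with hj | rfl
          · exact h j hj
          · exact h'
      have hmem : ∀ i : Fin (γ + 2), (Sum.inl i : Fin (γ + 2) ⊕ AuxQubits n γ) ∈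
          (List.range (γ + 1)).map anc ↔ (i : ℕ) ≤ γ := by
        intro i
        rw [List.mem_map, hancd]
        constructor
        · rintro ⟨j, hj, h⟩
          rw [List.mem_range] at hj
          simp only [Sum.inl.injEq, Fin.ext_iff, Fin.val_ofNat] at h
          rw [Nat.mod_eq_of_lt (by omega)] at h
          omega
        · intro h
          refine ⟨i, by rw [List.mem_range]; omega, ?_⟩
          simp
      have hmem' : ∀ q : AuxQubits n γ, (Sum.inr q : Fin (γ + 2) ⊕ AuxQubits n γ) ∉
          (List.range (γ + 1)).map anc := by
        intro q
        rw [List.mem_map, hancd]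
        simp
      have h2 : withZeroAncillas (γ + 2) φ (clearAnc anc γ x) =
          if x (Sum.inl ⟨γ + 1, by omega⟩) = 0 then φ fun q => x (Sum.inr q) else 0 := by
        have h3 : (∀ s : Fin (γ + 2), clearAnc anc γ x (Sum.inl s) = 0) ↔
            x (Sum.inl ⟨γ + 1, by omega⟩) = 0 := by
          simp only [clearAnc, zeroL, hmem]
          constructor
          · intro h
            have := h ⟨γ + 1, by omega⟩
            simpa using this
          · intro h s
            split_ifs with hs
            · rfl
            · rw [← h]
              congr 2
              ext
              have := s.2
              simp only
              omega
        rw [withZeroAncillas]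
        simp only [h3]
        simp only [clearAnc, zeroL, hmem', if_false]
      rw [h2]
      by_cases h4 : ok x ∧ x (Sum.inl ⟨γ, by omega⟩) = (if finFunctionFinEquiv
            (fun i : Fin (γ + 1) => x (Sum.inr (Sum.inl (Sum.inl i)))) = κ then 1 else 0)
      · rw [if_pos (h1.2 h4)]
        by_cases h5 : x (Sum.inl ⟨γ + 1, by omega⟩) = 0
        · rw [if_pos h5, if_pos ⟨h4.1, h4.2, h5⟩]
        · rw [if_neg h5, if_neg fun h => h5 h.2.2]
      · rw [if_neg fun h => h4 (h1.1 h), if_neg fun h => h4 ⟨h.1, h.2.1⟩]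
    · rw [withZeroAncillas, if_neg]
      intro h
      rw [hancd] at hx
      rw [h] at hx
      simp at hx
  refine ⟨Ch ++ (mapC (termEmb n γ) C ++ invC Ch),
    (hChc.append ((hC.map _).append hChc.inv)).mono (by omega) (by omega), fun φ => ?_⟩
  change run _ _ = _
  rw [run_append, run_append]
  obtain ⟨U, hU⟩ : ∃ U, U =
    (multiControl κ (termMat C)).submatrix (ctrlDecode n γ) (ctrlDecode n γ) := ⟨_, rfl⟩
  rw [← hU]
  -- Uncomputing the chain reduces the claim to an intertwining relation between the term circuit
  -- and the multi-controlled operator.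
  suffices h : run (mapC (termEmb n γ) C) (run Ch (withZeroAncillas (γ + 2) φ)) =
      run Ch (withZeroAncillas (γ + 2) (U *ᵥ φ)) by rw [h, run_invC_run]
  funext x
  obtain ⟨u, hu⟩ : ∃ u : Fin (γ + 1) → Fin 2,
    u = fun i => x (Sum.inr (Sum.inl (Sum.inl i))) := ⟨_, rfl⟩
  have hext : ∀ y : TermQubits n → Fin 2,
      run Ch (withZeroAncillas (γ + 2) φ) (Function.extend (termEmb n γ) y x) =
        if ok x ∧ y (Sum.inl 0) = (if finFunctionFinEquiv u = κ then 1 else 0) ∧ y (Sum.inl 1) = 0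
        then φ (joinBits u fun s => y (Sum.inr s)) else 0 := by
    intro y
    have e0 : Function.extend (termEmb n γ) y x (Sum.inl ⟨γ, by omega⟩) = y (Sum.inl 0) :=
      (termEmb n γ).injective.extend_apply y x (Sum.inl 0)
    have e1 : Function.extend (termEmb n γ) y x (Sum.inl ⟨γ + 1, by omega⟩) = y (Sum.inl 1) :=
      (termEmb n γ).injective.extend_apply y x (Sum.inl 1)
    have e2 : ∀ i, Function.extend (termEmb n γ) y x (Sum.inr (Sum.inl (Sum.inl i))) =
        x (Sum.inr (Sum.inl (Sum.inl i))) := fun i =>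
      Function.extend_apply' _ _ _ (by
        rintro ⟨(s | s | s), h⟩
        · exact absurd h Sum.inl_ne_inr
        · simp [termEmb_flag] at h
        · simp [termEmb_data] at h)
    have e3 : ∀ j < γ, Function.extend (termEmb n γ) y x (anc j) = x (anc j) := fun j hj =>
      Function.extend_apply' _ _ _ (by
        rintro ⟨(s | s | s), h⟩
        · rw [hancd] at h
          rcases fin2_cases s with rfl | rfl
          · have h' : (⟨γ, by omega⟩ : Fin (γ + 2)) = Fin.ofNat (γ + 2) j := Sum.inl.inj h
            rw [Fin.ext_iff, Fin.val_ofNat, Nat.mod_eq_of_lt (by omega)] at h'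
            simp only at h'
            omega
          · have h' : (⟨γ + 1, by omega⟩ : Fin (γ + 2)) = Fin.ofNat (γ + 2) j := Sum.inl.inj h
            rw [Fin.ext_iff, Fin.val_ofNat, Nat.mod_eq_of_lt (by omega)] at h'
            simp only at h'
            omega
        · rw [hancd] at h; simp [termEmb_flag] at h
        · rw [hancd] at h; simp [termEmb_data] at h)
    have e4 : ∀ k, Function.extend (termEmb n γ) y x (ctrl k) = x (ctrl k) := fun k => by
      rw [hctrld]; exact e2 _
    have e5 : ok (Function.extend (termEmb n γ) y x) ↔ ok x := by
      rw [hok]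
      refine forall₂_congr fun j hj => ?_
      simp only [e3 j hj, e4]
    have e6 : (fun q => Function.extend (termEmb n γ) y x (Sum.inr q)) =
        joinBits u fun s => y (Sum.inr s) := by
      funext q
      rcases q with (q | q) | q
      · rw [e2, hu]; rfl
      · exact (termEmb n γ).injective.extend_apply y x (Sum.inr (Sum.inl q))
      · exact (termEmb n γ).injective.extend_apply y x (Sum.inr (Sum.inr q))
    rw [hrunCh, e0, e1, e6]
    simp only [e5, e2, hu]
  have hx := extend_comp_self (termEmb n γ) x
  conv_lhs => rw [← hx]
  rw [run_mapC]
  simp only [hext]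
  have hright : run Ch (withZeroAncillas (γ + 2) (U *ᵥ φ)) x =
      if ok x ∧ x (termEmb n γ (Sum.inl 0)) = (if finFunctionFinEquiv u = κ then 1 else 0) ∧
        x (termEmb n γ (Sum.inl 1)) = 0
      then (U *ᵥ φ) (joinBits u fun s => x (termEmb n γ (Sum.inr s))) else 0 := by
    rw [hrunCh, eq_joinBits fun q => x (Sum.inr q), ← hu]
    have : (Sum.elim (fun i => x (Sum.inr (Sum.inl (Sum.inr i)))) fun i => x (Sum.inr (Sum.inr i))) =
        fun s => x (termEmb n γ (Sum.inr s)) := by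
      funext s
      rcases s with s | s <;> rfl
    rw [this]
    rfl
  rw [hright, hU, multiControl_submatrix_mulVec]
  by_cases hokx : ok x
  · by_cases hκ : finFunctionFinEquiv u = κ
    · have hg : (fun y : TermQubits n → Fin 2 =>
          if ok x ∧ y (Sum.inl 0) = (if finFunctionFinEquiv u = κ then 1 else 0) ∧
            y (Sum.inl 1) = 0
          then φ (joinBits u fun s => y (Sum.inr s)) else 0) =
          ctrlState fun t => φ (joinBits u t) := by
        funext y
        simp [ctrlState, hokx, hκ]
      rw [hg, run_ctrlState hcomm]
      simp [ctrlState, hokx, hκ]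
    · rw [hoff]
      · simp [hokx, hκ]
      · intro y hy
        simp [hκ, hy]
  · have hg : (fun y : TermQubits n → Fin 2 =>
        if ok x ∧ y (Sum.inl 0) = (if finFunctionFinEquiv u = κ then 1 else 0) ∧
          y (Sum.inl 1) = 0
        then φ (joinBits u fun s => y (Sum.inr s)) else 0) = 0 := by
      funext y
      simp [hokx]
    rw [hg, run_zero]
    simp [hokx]

end Control

end QBlock

end

noncomputable section

namespace QBlock

/-! ### Linear combinations of unitaries -/

section LCU

set_option linter.unusedSectionVars false

variable {K ι : Type} [Fintype K] [DecidableEq K] [Fintype ι] [DecidableEq ι]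

theorem kronecker_one_mulVec (A : Matrix K K ℂ) (v : K × ι → ℂ) (k : K) (t : ι) :
    ((A ⊗ₖ (1 : Matrix ι ι ℂ)) *ᵥ v) (k, t) = (A *ᵥ fun k' => v (k', t)) k := by
  rw [mulVec, mulVec, dotProduct, dotProduct, Fintype.sum_prod_type]
  refine Finset.sum_congr rfl fun k' _ => ?_
  rw [Finset.sum_eq_single t]
  · simp
  · intro t' _ ht
    simp [one_apply, ht.symm]
  · simp

theorem kronecker_one_mem_unitaryGroup {A : Matrix K K ℂ} (hA : A ∈ unitaryGroup K ℂ) :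
    A ⊗ₖ (1 : Matrix ι ι ℂ) ∈ unitaryGroup (K × ι) ℂ := by
  rw [mem_unitaryGroup_iff'] at hA ⊢
  rw [star_eq_conjTranspose, conjTranspose_kronecker, ← mul_kronecker_mul, conjTranspose_one,
    one_mul, ← star_eq_conjTranspose, hA, one_kronecker_one]

theorem star_multiControl (b : K) (A : Matrix ι ι ℂ) :
    star (multiControl b A) = multiControl b (star A) := by
  simp only [multiControl, star_eq_conjTranspose, conjTranspose_add, conjTranspose_kronecker,
    conjTranspose_sum, conjTranspose_single, star_one, conjTranspose_one]

theorem multiControl_mem_unitaryGroup (b : K) {A : Matrix ι ι ℂ} (hA : A ∈ unitaryGroup ι ℂ) :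
    multiControl b A ∈ unitaryGroup (K × ι) ℂ := by
  rw [mem_unitaryGroup_iff'] at hA ⊢
  rw [star_multiControl]
  apply Matrix.ext_of_mulVec_single
  intro i
  rw [one_mulVec, ← mulVec_mulVec]
  funext ⟨k, t⟩
  rw [multiControl_mulVec]
  split_ifs with hk
  · subst hk
    simp only [multiControl_mulVec, if_true]
    rw [mulVec_mulVec, hA, one_mulVec]
  · rw [multiControl_mulVec, if_neg hk]

/-- In the block `k` all factors with a different control index are the identity; injective indices
leave at most one factor. -/
theorem prod_multiControl_mulVec {J : Type} (L : List J) (b : J → K) (A : J → Matrix ι ι ℂ)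
    (v : K × ι → ℂ) (k : K) :
    (fun t => ((L.map fun j => multiControl (b j) (A j)).prod *ᵥ v) (k, t)) =
      (L.map fun j => if k = b j then A j else 1).prod *ᵥ fun t => v (k, t) := by
  induction L with
  | nil => simp
  | cons j L ih =>
    funext t
    rw [List.map_cons, List.prod_cons, ← mulVec_mulVec, multiControl_mulVec, List.map_cons,
      List.prod_cons, ← mulVec_mulVec, ← ih]
    split_ifs with h
    · subst h; rfl
    · rw [one_mulVec]

theorem prod_ofFn_eq {M : Type*} [Monoid M] {N : ℕ} (f : Fin N → M) (i : Fin N)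
    (h : ∀ j, j ≠ i → f j = 1) : (List.ofFn f).prod = f i := by
  induction N with
  | zero => exact i.elim0
  | succ N ih =>
    rw [List.ofFn_succ, List.prod_cons]
    refine Fin.cases (fun h => ?_) (fun i h => ?_) i h
    · have h0 : (List.ofFn fun j : Fin N => f j.succ) = List.ofFn fun _ => 1 :=
        congrArg List.ofFn (funext fun j => h _ (Fin.succ_ne_zero j))
      rw [h0]
      simp
    · rw [h 0 (Fin.succ_ne_zero i).symm, one_mul]
      exact ih (fun j => f j.succ) i fun j hj => h _ fun h' => hj (Fin.succ_injective _ h')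

theorem prod_ofFn_multiControl_mulVec {N : ℕ} {b : Fin N → K} (hb : Function.Injective b)
    (A : Fin N → Matrix ι ι ℂ) (v : K × ι → ℂ) (j : Fin N) (t : ι) :
    ((List.ofFn fun j => multiControl (b j) (A j)).prod *ᵥ v) (b j, t) =
      (A j *ᵥ fun t => v (b j, t)) t := by
  have h := congrFun (prod_multiControl_mulVec (List.ofFn id) b A v (b j)) t
  rw [List.map_ofFn, List.map_ofFn] at h
  refine h.trans ?_
  rw [prod_ofFn_eq _ j]
  · simp
  · intro i hi
    simp [hb.ne hi.symm]

theorem prod_ofFn_multiControl_mulVec_of_ne {N : ℕ} {b : Fin N → K}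
    (A : Fin N → Matrix ι ι ℂ) (v : K × ι → ℂ) {k : K} (hk : ∀ j, k ≠ b j) (t : ι) :
    ((List.ofFn fun j => multiControl (b j) (A j)).prod *ᵥ v) (k, t) = v (k, t) := by
  have h := congrFun (prod_multiControl_mulVec (List.ofFn id) b A v k) t
  rw [List.map_ofFn, List.map_ofFn] at h
  refine h.trans ?_
  have h0 : ((fun j => if k = b j then A j else 1) ∘ id : Fin N → Matrix ι ι ℂ) = fun _ => 1 := by
    funext j; simp [hk j]
  rw [h0]
  simp

theorem lowIdx_injective {γ : ℕ} : Function.Injective (lowIdx (γ := γ)) := by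
  intro k k' h
  simpa [lowIdx, Fin.ext_iff] using h

theorem highIdx_injective {γ : ℕ} : Function.Injective (highIdx (γ := γ)) := by
  intro k k' h
  simpa [highIdx, Fin.ext_iff] using h

theorem lowIdx_ne_highIdx {γ : ℕ} (k k' : Fin (2 ^ γ)) : lowIdx k ≠ highIdx k' := by
  intro h
  have := k.2
  simp only [lowIdx, highIdx, Fin.ext_iff] at h
  omega

theorem sum_low_high {γ : ℕ} {β : Type*} [AddCommMonoid β] (f : Fin (2 ^ (γ + 1)) → β) :
    ∑ κ, f κ = ∑ k, f (lowIdx k) + ∑ k, f (highIdx k) := by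
  have h : 2 ^ γ + 2 ^ γ = 2 ^ (γ + 1) := by rw [pow_succ]; omega
  rw [← Equiv.sum_comp (finCongr h), Fin.sum_univ_add]
  congr 1
  refine Finset.sum_congr rfl fun k _ => congrArg f (Fin.ext ?_)
  simp [highIdx]

variable {γ : ℕ} {Np : ℕ → ℝ} {α : Fin (2 ^ γ) → ℂ} {m : Fin (2 ^ γ) → ℕ}

/-- The vector of a coefficient-preparation unitary. -/
def coeffVec (γ : ℕ) (Np : ℕ → ℝ) (α : Fin (2 ^ γ) → ℂ) (m : Fin (2 ^ γ) → ℕ) :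
    Fin (2 ^ (γ + 1)) → ℂ :=
  ((1 / Real.sqrt (normH γ Np α m) : ℝ) : ℂ) •
    ∑ k, (((2 ^ logSparsity (m k) * Np (m k)) ^ (1 / 4 : ℝ) : ℝ) : ℂ) •
      (((Complex.I ^ m k * α k) ^ (1 / 2 : ℂ)) • ket (lowIdx k) +
        ((Complex.I ^ m k * (starRingEnd ℂ) (α k)) ^ (1 / 2 : ℂ)) • ket (highIdx k))

theorem coeffVec_low (k : Fin (2 ^ γ)) : coeffVec γ Np α m (lowIdx k) =
    ((1 / Real.sqrt (normH γ Np α m) : ℝ) : ℂ) *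
      ((((2 ^ logSparsity (m k) * Np (m k)) ^ (1 / 4 : ℝ) : ℝ) : ℂ) *
        (Complex.I ^ m k * α k) ^ (1 / 2 : ℂ)) := by
  rw [coeffVec, Pi.smul_apply, Finset.sum_apply, Finset.sum_eq_single k, smul_eq_mul]
  · simp [ket, lowIdx_ne_highIdx]
  · intro k' _ hk
    simp [ket, lowIdx_ne_highIdx, lowIdx_injective.ne hk.symm]
  · simp

theorem coeffVec_high (k : Fin (2 ^ γ)) : coeffVec γ Np α m (highIdx k) =
    ((1 / Real.sqrt (normH γ Np α m) : ℝ) : ℂ) *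
      ((((2 ^ logSparsity (m k) * Np (m k)) ^ (1 / 4 : ℝ) : ℝ) : ℂ) *
        (Complex.I ^ m k * (starRingEnd ℂ) (α k)) ^ (1 / 2 : ℂ)) := by
  rw [coeffVec, Pi.smul_apply, Finset.sum_apply, Finset.sum_eq_single k, smul_eq_mul]
  · simp [ket, (lowIdx_ne_highIdx _ _).symm]
  · intro k' _ hk
    simp [ket, (lowIdx_ne_highIdx _ _).symm, highIdx_injective.ne hk.symm]
  · simp

theorem cpow_half_sq (z : ℂ) : (z ^ (1 / 2 : ℂ)) ^ 2 = z := by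
  have := Complex.cpow_nat_inv_pow z (n := 2) (by norm_num)
  rw [one_div]
  exact_mod_cast this

theorem rpow_quarter_sq {x : ℝ} (hx : 0 ≤ x) : (x ^ (1 / 4 : ℝ)) ^ 2 = Real.sqrt x := by
  rw [← Real.rpow_natCast, ← Real.rpow_mul hx, Real.sqrt_eq_rpow]
  norm_num

theorem coeff_sq {N x : ℝ} (hN : 0 ≤ N) (hx : 0 ≤ x) (z : ℂ) :
    (((1 / Real.sqrt N : ℝ) : ℂ) * (((x ^ (1 / 4 : ℝ) : ℝ) : ℂ) * z ^ (1 / 2 : ℂ))) ^ 2 =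
      ((1 / N : ℝ) : ℂ) * ((Real.sqrt x : ℂ) * z) := by
  rw [mul_pow, mul_pow, cpow_half_sq, ← Complex.ofReal_pow, ← Complex.ofReal_pow,
    rpow_quarter_sq hx, div_pow, one_pow, Real.sq_sqrt hN]

theorem normH_pos (hNp : ∀ k, 0 < Np (m k)) (hα : ∃ k, α k ≠ 0) : 0 < normH γ Np α m := by
  rw [normH]
  obtain ⟨k, hk⟩ := hα
  refine mul_pos two_pos (Finset.sum_pos' (fun k _ => by positivity) ⟨k, Finset.mem_univ k, ?_⟩)
  have := hNp k
  have := norm_pos_iff.2 hk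
  positivity

/-- Conjugate coefficients have equal modulus, so both halves of the register contribute equally;
this is the factor 2 in `normH`. -/
theorem sum_norm_coeffVec (hNp : ∀ k, 0 < Np (m k)) (hα : ∃ k, α k ≠ 0) :
    ∑ κ, ‖coeffVec γ Np α m κ‖ ^ 2 = 1 := by
  have hN := normH_pos hNp hα
  have h : ∀ (k : Fin (2 ^ γ)) (z : ℂ), ‖((1 / Real.sqrt (normH γ Np α m) : ℝ) : ℂ) *
      ((((2 ^ logSparsity (m k) * Np (m k)) ^ (1 / 4 : ℝ) : ℝ) : ℂ) * z ^ (1 / 2 : ℂ))‖ ^ 2 =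
      1 / normH γ Np α m * (Real.sqrt (2 ^ logSparsity (m k) * Np (m k)) * ‖z‖) := by
    intro k z
    have := (hNp k).le
    rw [← norm_pow, coeff_sq hN.le (by positivity), norm_mul, norm_mul, Complex.norm_real,
      Complex.norm_real, Real.norm_of_nonneg (by positivity), Real.norm_of_nonneg (by positivity)]
  rw [sum_low_high]
  simp only [coeffVec_low, coeffVec_high, h]
  simp only [norm_mul, norm_pow, Complex.norm_I, one_pow, one_mul,
    RCLike.norm_conj]
  rw [← Finset.mul_sum, ← mul_add, div_mul_eq_mul_div, one_mul, div_eq_one_iff_eq hN.ne', normH,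
    two_mul]
  simp only [mul_comm]

/-- Squaring the amplitude restores `i^m z √(2^l Np)` whichever branch of the square root is taken,
and `i^m (-i)^m = 1`. -/
theorem coeff_mul (hNp : ∀ k, 0 < Np (m k)) (hα : ∃ k, α k ≠ 0) (k : Fin (2 ^ γ)) (z : ℂ) :
    (((1 / Real.sqrt (normH γ Np α m) : ℝ) : ℂ) *
      ((((2 ^ logSparsity (m k) * Np (m k)) ^ (1 / 4 : ℝ) : ℝ) : ℂ) *
        (Complex.I ^ m k * z) ^ (1 / 2 : ℂ))) ^ 2 *
      ((-Complex.I) ^ m k / (Real.sqrt (2 ^ logSparsity (m k) * Np (m k)) : ℂ)) =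
    ((1 / normH γ Np α m : ℝ) : ℂ) * z := by
  have h0 := hNp k
  have hs : (Real.sqrt (2 ^ logSparsity (m k) * Np (m k)) : ℂ) ≠ 0 := by
    have : 0 < Real.sqrt (2 ^ logSparsity (m k) * Np (m k)) := by positivity
    exact_mod_cast this.ne'
  have hI : Complex.I ^ m k * (-Complex.I) ^ m k = 1 := by
    rw [← mul_pow]; simp
  rw [coeff_sq (normH_pos hNp hα).le (by positivity)]
  generalize (Real.sqrt (2 ^ logSparsity (m k) * Np (m k)) : ℂ) = s at *
  field_simp
  linear_combination (((1 / normH γ Np α m : ℝ) : ℂ) * z) * hI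

variable {n : ℕ} {U : Matrix (Fin (2 ^ (γ + 1))) (Fin (2 ^ (γ + 1))) ℂ}
  {A B : Fin (2 ^ γ) → Matrix (TermIdx n) (TermIdx n) ℂ}

theorem lcuAux_mem_unitaryGroup (hU : U ∈ unitaryGroup _ ℂ)
    (hA : ∀ k, A k ∈ unitaryGroup _ ℂ) (hB : ∀ k, B k ∈ unitaryGroup _ ℂ) :
    lcuAux U A B ∈ unitaryGroup (AuxIdx n γ) ℂ := by
  refine submatrix_mem_unitaryGroup (mul_mem (mul_mem (mul_mem
    (kronecker_one_mem_unitaryGroup (transpose_mem_unitaryGroup hU)) ?_) ?_)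
    (kronecker_one_mem_unitaryGroup hU)) _
  · refine Submonoid.list_prod_mem _ fun M hM => ?_
    obtain ⟨k, rfl⟩ := List.mem_ofFn.1 hM
    exact multiControl_mem_unitaryGroup _ (hB k)
  · refine Submonoid.list_prod_mem _ fun M hM => ?_
    obtain ⟨k, rfl⟩ := List.mem_ofFn.1 hM
    exact multiControl_mem_unitaryGroup _ (hA k)

theorem encodesEntries_lcuAux {a b : ℝ} {P : Fin (2 ^ γ) → Polynomial ℝ}
    (hNp : ∀ k, 0 < Np (m k)) (hα : ∃ k, α k ≠ 0) (hU : IsCoeffPrep γ Np α m U)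
    (hA : ∀ k, IsOneTermAux Np (m k) (termPX n a b (P k) (m k)) (A k))
    (hB : ∀ k, IsOneTermAux Np (m k) (termXP n a b (P k) (m k)) (B k)) :
    EncodesEntries (((1 / normH γ Np α m : ℝ)) : ℂ) (hHat n γ a b α P m) (lcuAux U A B) := by
  rw [encodesEntries_iff]
  intro σ i j
  obtain ⟨v, hv⟩ : ∃ v : TermIdx n → ℂ, v = ∑ j, σ j • ket (0, (0, j)) := ⟨_, rfl⟩
  have hU0 : ∀ κ, U κ 0 = coeffVec γ Np α m κ := by
    intro κ
    have := congrFun hU.2 κ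
    rw [ket, mulVec_single_one] at this
    exact this
  have hA' : ∀ k, (A k *ᵥ v) (0, (i, j)) = _ := fun k => hv ▸ encodesEntries_iff.1 (hA k).2 σ i j
  have hB' : ∀ k, (B k *ᵥ v) (0, (i, j)) = _ := fun k => hv ▸ encodesEntries_iff.1 (hB k).2 σ i j
  have h1 : (fun z : Fin (2 ^ (γ + 1)) × TermIdx n => (∑ j, σ j • ket
        ((0 : Fin (2 ^ (γ + 1)) × Fin (2 ^ 3)), ((0 : Fin (2 ^ n)), j))) ((Equiv.prodAssoc _ _ _).symm z)) =
      fun z => Pi.single (M := fun _ => ℂ) 0 1 z.1 * v z.2 := by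
    funext ⟨κ, f, i, j⟩
    rw [Equiv.prodAssoc_symm_apply, sum_smul_ket_apply, hv, sum_smul_ket_apply, Pi.single_apply]
    by_cases hκ : κ = 0 <;> by_cases hf : f = 0 <;> simp [hκ, hf]
  have h2 : ∀ κ t, ((U ⊗ₖ (1 : Matrix (TermIdx n) (TermIdx n) ℂ)) *ᵥ fun z =>
      Pi.single (M := fun _ => ℂ) 0 1 z.1 * v z.2) (κ, t) = U κ 0 * v t := by
    intro κ t
    rw [kronecker_one_mulVec, mulVec, dotProduct, Finset.sum_eq_single 0]
    · simp
    · intro κ' _ hκ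
      simp [hκ]
    · simp
  obtain ⟨w, hw⟩ : ∃ w : Fin (2 ^ (γ + 1)) × TermIdx n → ℂ, w =
    (U ⊗ₖ (1 : Matrix (TermIdx n) (TermIdx n) ℂ)) *ᵥ fun z =>
      Pi.single (M := fun _ => ℂ) 0 1 z.1 * v z.2 := ⟨_, rfl⟩
  have hwa : ∀ κ, (fun t => w (κ, t)) = U κ 0 • v := by
    intro κ
    funext t
    rw [hw, h2]; rfl
  obtain ⟨PA, hPA⟩ : ∃ PA, PA = (List.ofFn fun k => multiControl (lowIdx k) (A k)).prod := ⟨_, rfl⟩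
  obtain ⟨PB, hPB⟩ : ∃ PB, PB = (List.ofFn fun k => multiControl (highIdx k) (B k)).prod :=
    ⟨_, rfl⟩
  -- The two products act on disjoint halves of the coefficient register, so each index sees exactly
  -- one auxiliary.
  have hlow : ∀ k t, (PB *ᵥ (PA *ᵥ w)) (lowIdx k, t) = U (lowIdx k) 0 * (A k *ᵥ v) t := by
    intro k t
    rw [hPB, prod_ofFn_multiControl_mulVec_of_ne _ _ (fun j => lowIdx_ne_highIdx k j), hPA,
      prod_ofFn_multiControl_mulVec lowIdx_injective, hwa, mulVec_smul]
    rfl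
  have hhigh : ∀ k t, (PB *ᵥ (PA *ᵥ w)) (highIdx k, t) = U (highIdx k) 0 * (B k *ᵥ v) t := by
    intro k t
    have : (fun t => (PA *ᵥ w) (highIdx k, t)) = fun t => w (highIdx k, t) := by
      funext t
      rw [hPA, prod_ofFn_multiControl_mulVec_of_ne _ _ (fun j => (lowIdx_ne_highIdx j k).symm)]
    rw [hPB, prod_ofFn_multiControl_mulVec highIdx_injective, this, hwa, mulVec_smul]
    rfl
  have h3 : (lcuAux U A B *ᵥ ∑ j, σ j • ket (0, (0, j))) (0, (i, j)) =
      ((Uᵀ ⊗ₖ (1 : Matrix (TermIdx n) (TermIdx n) ℂ)) *ᵥ (PB *ᵥ (PA *ᵥ w))) (0, (0, (i, j))) := by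
    rw [lcuAux, submatrix_mulVec_equiv, ← hPA, ← hPB]
    rw [hw, ← h1, mulVec_mulVec, mulVec_mulVec, mulVec_mulVec]
    rfl
  rw [h3, kronecker_one_mulVec, mulVec, dotProduct, sum_low_high]
  simp only [hlow, hhigh, transpose_apply, hU0, hA', hB']
  rw [hHat, Matrix.sum_apply, Finset.sum_mul, Finset.mul_sum, ← Finset.sum_add_distrib]
  refine Finset.sum_congr rfl fun k _ => ?_
  have c1 := coeff_mul hNp hα k (α k)
  have c2 := coeff_mul hNp hα k ((starRingEnd ℂ) (α k))
  rw [← coeffVec_low] at c1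
  rw [← coeffVec_high] at c2
  rw [Matrix.add_apply, Matrix.smul_apply, Matrix.smul_apply, smul_eq_mul, smul_eq_mul]
  linear_combination (termPX n a b (P k) (m k) i j * σ j) * c1 +
    (termXP n a b (P k) (m k) i j * σ j) * c2

end LCU

end QBlock

end

noncomputable section

namespace QBlock

/-! ### The circuit of the linear combination -/

section Assembly

set_option linter.unusedSectionVars false

/-- The moduli are prepared by rotations, the phases by a diagonal gate. The unitary is defined as
the matrix of this circuit, so its transpose is that of the transposed circuit. -/
theorem exists_prepare {g : ℕ} {v : Fin (2 ^ (g + 1)) → ℂ} (hv : ∑ κ, ‖v κ‖ ^ 2 = 1) :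
    ∃ C : Circuit (Fin (g + 1)),
      CostLE C (2 * 2 ^ (g + 1) + 2 * (g + 1)) (4 * 2 ^ (g + 1)) ∧
      (evalCircuit C).submatrix finFunctionFinEquiv.symm finFunctionFinEquiv.symm *ᵥ ket 0 = v := by
  obtain ⟨L, hL⟩ : ∃ L : List (Fin (g + 1)), L = List.ofFn id := ⟨_, rfl⟩
  have hlen : L.length = g + 1 := by rw [hL, List.length_ofFn]
  have hmem : ∀ q, q ∈ L := fun q => by rw [hL, List.mem_ofFn]; exact ⟨q, rfl⟩
  have hnd : L.Nodup := by rw [hL, List.nodup_ofFn]; exact Function.injective_id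
  have hbits : ∀ {β : Type} (f : (Fin (g + 1) → Fin 2) → β), BitsIn L f := fun f x y h => by
    rw [show x = y from funext fun q => h q (hmem q)]
  have hval : ∀ x, val L x = (finFunctionFinEquiv x : ℕ) := fun x => by
    rw [hL, val_ofFn, finFunctionFinEquiv_apply]
    rfl
  obtain ⟨ρ, hρ⟩ : ∃ ρ : (Fin (g + 1) → Fin 2) → ℝ,
    ρ = fun x => ‖v (finFunctionFinEquiv x)‖ := ⟨_, rfl⟩
  obtain ⟨φ, hφ⟩ : ∃ φ : (Fin (g + 1) → Fin 2) → ℝ,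
    φ = fun x => Complex.arg (v (finFunctionFinEquiv x)) := ⟨_, rfl⟩
  have h1 : ∀ x, sumL L (fun y => ρ y ^ 2) x = 1 := by
    intro x
    obtain ⟨h, hh⟩ : ∃ h : ℕ → ℝ, h = fun r =>
      if hr : r < 2 ^ (g + 1) then ‖v ⟨r, hr⟩‖ ^ 2 else 0 := ⟨_, rfl⟩
    have e : (fun y => ρ y ^ 2) = fun y => h (val L y) := by
      funext y
      rw [hρ, hh, hval]
      dsimp only
      rw [dif_pos (Fin.isLt _)]
    rw [e, sumL_val hnd h, hlen, Finset.sum_range, ← hv]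
    refine Finset.sum_congr rfl fun κ _ => ?_
    rw [hh]
    simp
  refine ⟨prepC L ρ ++ diagC 0 L φ, ((cost_prepC _ _).append (cost_diagC _ _ _)).mono ?_ ?_, ?_⟩
  · rw [hlen]; omega
  · rw [hlen, pow_succ _ (g + 1)]; omega
  · funext κ
    rw [submatrix_mulVec_equiv]
    have h0 : (ket (0 : Fin (2 ^ (g + 1)))) ∘ finFunctionFinEquiv.symm.symm =
        (Pi.single 0 1 : (Fin (g + 1) → Fin 2) → ℂ) := by
      funext x
      have hx : finFunctionFinEquiv x = 0 ↔ x = 0 := by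
        have hz : finFunctionFinEquiv (0 : Fin (g + 1) → Fin 2) = 0 := by
          ext; rw [finFunctionFinEquiv_apply]; simp
        rw [← hz, Equiv.apply_eq_iff_eq]
      simp only [ket, Function.comp_apply, Equiv.symm_symm, Pi.single_apply, hx]
    rw [h0]
    change run _ _ _ = _
    rw [run_append, run_diagC 0 hnd (hbits φ), run_prepC hnd (hbits ρ)
      (fun x => by rw [hρ]; exact norm_nonneg _) h1]
    · have hz : zeroL L (finFunctionFinEquiv.symm κ) = 0 := by
        funext q; simp [zeroL, hmem]
      rw [hz, hρ, hφ]
      simp only [Equiv.apply_symm_apply, Pi.single_eq_same, mul_one]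
      rw [mul_comm, Complex.norm_mul_exp_arg_mul_I]
    · rintro x ⟨q, -, hx⟩
      rw [Pi.single_apply, if_neg]
      rintro rfl
      exact hx rfl

theorem Implements.append {Q : Type} [Fintype Q] [DecidableEq Q] {r : ℕ}
    {C D : Circuit (Fin r ⊕ Q)} {U V : Matrix (Q → Fin 2) (Q → Fin 2) ℂ} (hC : Implements C U)
    (hD : Implements D V) : Implements (C ++ D) (V * U) := by
  intro ψ
  rw [evalCircuit_append, ← mulVec_mulVec, hC, hD, mulVec_mulVec]

variable {n γ : ℕ}

/-- The matrix is implemented by a circuit with bounded costs. -/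
def HasCircuit (A : Matrix (Fin (2 ^ (γ + 1)) × TermIdx n) (Fin (2 ^ (γ + 1)) × TermIdx n) ℂ)
    (s c : ℕ) : Prop :=
  ∃ D : Circuit (Fin (γ + 2) ⊕ AuxQubits n γ), CostLE D s c ∧
    Implements D (A.submatrix (ctrlDecode n γ) (ctrlDecode n γ))

theorem HasCircuit.mul
    {A B : Matrix (Fin (2 ^ (γ + 1)) × TermIdx n) (Fin (2 ^ (γ + 1)) × TermIdx n) ℂ}
    {s c s' c' : ℕ} (hA : HasCircuit A s c) (hB : HasCircuit B s' c') :
    HasCircuit (A * B) (s + s') (c + c') := by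
  obtain ⟨D, hD, hDA⟩ := hA
  obtain ⟨E, hE, hEB⟩ := hB
  refine ⟨E ++ D, (hE.append hD).mono (by omega) (by omega), ?_⟩
  rw [← submatrix_mul_equiv A B _ (ctrlDecode n γ)]
  exact hEB.append hDA

theorem HasCircuit.one :
    HasCircuit (1 : Matrix (Fin (2 ^ (γ + 1)) × TermIdx n) (Fin (2 ^ (γ + 1)) × TermIdx n) ℂ)
      0 0 := by
  refine ⟨[], CostLE.nil, fun ψ => ?_⟩
  rw [submatrix_one_equiv, one_mulVec, evalCircuit, one_mulVec]

theorem HasCircuit.prod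
    {L : List (Matrix (Fin (2 ^ (γ + 1)) × TermIdx n) (Fin (2 ^ (γ + 1)) × TermIdx n) ℂ)}
    {s c : ℕ} (hL : ∀ A ∈ L, HasCircuit A s c) :
    HasCircuit L.prod (L.length * s) (L.length * c) := by
  induction L with
  | nil => simpa using HasCircuit.one
  | cons A L ih =>
    rw [List.prod_cons, List.length_cons, Nat.succ_mul, Nat.succ_mul, add_comm _ s, add_comm _ c]
    exact (hL A (by simp)).mul (ih fun B hB => hL B (by simp [hB]))

theorem HasCircuit.coeff {C : Circuit (Fin (γ + 1))} {s c : ℕ} (hC : CostLE C s c) :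
    HasCircuit (n := n) ((evalCircuit C).submatrix finFunctionFinEquiv.symm
      finFunctionFinEquiv.symm ⊗ₖ (1 : Matrix (TermIdx n) (TermIdx n) ℂ)) s c := by
  obtain ⟨f, hf⟩ : ∃ f : Fin (γ + 1) ↪ Fin (γ + 2) ⊕ AuxQubits n γ,
    ∀ i, f i = Sum.inr (Sum.inl (Sum.inl i)) :=
      ⟨⟨fun i => Sum.inr (Sum.inl (Sum.inl i)), fun i j h => by simpa using h⟩, fun _ => rfl⟩
  refine ⟨mapC f C, hC.map f, fun φ => ?_⟩
  change run _ _ = _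
  funext x
  obtain ⟨u, hu⟩ : ∃ u : Fin (γ + 1) → Fin 2, u = fun q => x (f q) := ⟨_, rfl⟩
  obtain ⟨t, ht⟩ : ∃ t : Fin 3 ⊕ (Fin n ⊕ Fin n) → Fin 2, t =
    Sum.elim (fun i => x (Sum.inr (Sum.inl (Sum.inr i)))) fun i => x (Sum.inr (Sum.inr i)) :=
      ⟨_, rfl⟩
  have hne : ∀ q, (∀ i, q ≠ Sum.inr (Sum.inl (Sum.inl i))) → ∀ y : Fin (γ + 1) → Fin 2,
      Function.extend f y x q = x q := fun q hq y =>
    Function.extend_apply' _ _ _ (by rintro ⟨i, h⟩; exact hq i (h.symm.trans (hf i)))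
  have hw : ∀ y : Fin (γ + 1) → Fin 2,
      withZeroAncillas (γ + 2) φ (Function.extend f y x) =
        if ∀ s : Fin (γ + 2), x (Sum.inl s) = 0 then φ (joinBits y t) else 0 := by
    intro y
    have h1 : ∀ s : Fin (γ + 2), Function.extend f y x (Sum.inl s) = x (Sum.inl s) :=
      fun s => hne _ (by simp) y
    have h2 : (fun q => Function.extend f y x (Sum.inr q)) = joinBits y t := by
      funext q
      rcases q with (q | q) | q
      · rw [← hf, f.injective.extend_apply]; rfl
      · rw [hne _ (by simp), ht]; rfl
      · rw [hne _ (by simp), ht]; rfl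
    rw [withZeroAncillas, h2]
    simp only [h1]
  have hx := extend_comp_self f x
  have hxr : (fun q => x (Sum.inr q)) = joinBits u t := by
    rw [eq_joinBits fun q => x (Sum.inr q), hu, ht]
    simp only [hf]
  conv_lhs => rw [← hx]
  rw [run_mapC, withZeroAncillas, hxr, submatrix_ctrlDecode_mulVec, ctrlDecode_joinBits,
    kronecker_one_mulVec]
  simp only [hw]
  by_cases h0 : ∀ s : Fin (γ + 2), x (Sum.inl s) = 0
  · simp only [h0, implies_true, if_true]
    rw [submatrix_mulVec_equiv, run, ← hu, Function.comp_apply, Equiv.symm_apply_apply]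
    congr 2
    funext y
    simp only [Function.comp_apply, Equiv.symm_symm]
    congr 1
    rw [Equiv.eq_symm_apply, ctrlDecode_joinBits]
  · simp only [h0, if_false]
    exact congrFun (run_zero C) _

theorem exists_implements {v : Fin (2 ^ (γ + 1)) → ℂ} (hv : ∑ κ, ‖v κ‖ ^ 2 = 1)
    {C D : Fin (2 ^ γ) → Circuit (TermQubits n)} {s c : ℕ}
    (hCc : ∀ k, CostLE (C k) s c) (hDc : ∀ k, CostLE (D k) s c)
    (hCo : ∀ k, IdOff (Sum.inl 0) (C k)) (hDo : ∀ k, IdOff (Sum.inl 0) (D k))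
    (hCm : ∀ k, Comm (fun q => q ≠ Sum.inl 0 ∧ q ≠ Sum.inl 1) (C k))
    (hDm : ∀ k, Comm (fun q => q ≠ Sum.inl 0 ∧ q ≠ Sum.inl 1) (D k)) :
    ∃ U ∈ unitaryGroup (Fin (2 ^ (γ + 1))) ℂ, U *ᵥ ket 0 = v ∧
      ∃ E : Circuit (Fin (γ + 2) ⊕ AuxQubits n γ),
        Implements E ((lcuAux U (fun k => termMat (C k)) fun k => termMat (D k)).submatrix
          (decode n γ) (decode n γ)) ∧
        CostLE E (2 ^ (γ + 1) * (s + 12 * γ + 14)) (2 ^ (γ + 1) * (c + 12 * γ + 12)) := by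
  obtain ⟨P, hPc, hP⟩ := exists_prepare hv
  refine ⟨_, submatrix_mem_unitaryGroup (evalCircuit_mem_unitaryGroup P) _, hP, ?_⟩
  have hT : ((evalCircuit P).submatrix finFunctionFinEquiv.symm finFunctionFinEquiv.symm)ᵀ =
      (evalCircuit (trC P)).submatrix finFunctionFinEquiv.symm finFunctionFinEquiv.symm := by
    rw [evalCircuit_trC, transpose_submatrix]
  have hA : ∀ (E : Fin (2 ^ γ) → Circuit (TermQubits n)) (b : Fin (2 ^ γ) → Fin (2 ^ (γ + 1))),
      (∀ k, CostLE (E k) s c) → (∀ k, IdOff (Sum.inl 0) (E k)) →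
      (∀ k, Comm (fun q => q ≠ Sum.inl 0 ∧ q ≠ Sum.inl 1) (E k)) →
      HasCircuit (List.ofFn fun k => multiControl (b k) (termMat (E k))).prod
        (2 ^ γ * (s + 12 * γ + 8)) (2 ^ γ * (c + 12 * γ + 4)) := by
    intro E b h1 h2 h3
    have := HasCircuit.prod (L := List.ofFn fun k => multiControl (b k) (termMat (E k)))
      (s := s + 12 * γ + 8) (c := c + 12 * γ + 4) fun M hM => by
        obtain ⟨k, rfl⟩ := List.mem_ofFn.1 hM
        exact exists_control (b k) (h2 k) (h3 k) (h1 k)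
    rwa [List.length_ofFn] at this
  obtain ⟨E, hE, hEi⟩ := ((((hT ▸ HasCircuit.coeff (n := n) hPc.tr).mul
    (hA D highIdx hDc hDo hDm)).mul (hA C lowIdx hCc hCo hCm)).mul (HasCircuit.coeff (n := n) hPc))
  refine ⟨E, hEi, hE.mono ?_ ?_⟩
  -- Two preparations cost `4 · 2^(γ+1) + 4 (γ + 1)` one-qubit gates; this bound on the linear part
  -- makes them at most `6 · 2^(γ+1)`.
  · have h2 : 2 * (γ + 1) ≤ 2 ^ (γ + 1) := by
      have := Nat.lt_two_pow_self (n := γ)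
      rw [pow_succ]; omega
    have h3 : 2 ^ (γ + 1) * (s + 12 * γ + 14) =
      2 ^ γ * (s + 12 * γ + 8) + 2 ^ γ * (s + 12 * γ + 8) + 6 * 2 ^ (γ + 1) := by ring
    omega
  · have h3 : 2 ^ (γ + 1) * (c + 12 * γ + 12) =
      2 ^ γ * (c + 12 * γ + 4) + 2 ^ γ * (c + 12 * γ + 4) + 8 * 2 ^ (γ + 1) := by ring
    omega

end Assembly

end QBlock

end

theorem mainTheorem5
    (n γ : ℕ) (hn : 2 ≤ n)
    (a b : ℝ) (ha : -1 ≤ a) (hab : a < b) (hb : b ≤ 1)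
    (hgrid : ∑ κ : Fin (2 ^ n), QBlock.gridPoint n a b κ ^ 2 = 1)
    (α : Fin (2 ^ γ) → ℂ) (hα : ∃ k, α k ≠ 0)
    (q m : Fin (2 ^ γ) → ℕ) (P : Fin (2 ^ γ) → Polynomial ℝ)
    (hP : ∀ k, QBlock.IsAdmissible (q k) (P k))
    (Np : ℕ → ℝ)
    (hNp : ∀ k i j, ‖(QBlock.pHat n a b ^ m k) i j‖ ^ 2 ≤ Np (m k))
    (qmax lmax : ℕ) (hq : qmax = Finset.univ.sup q)
    (hl : lmax = Finset.univ.sup fun k => QBlock.logSparsity (m k)) :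
    -- every unitary built in this way from the one-term auxiliaries encodes the Hamiltonian
    (∀ (U : Matrix (Fin (2 ^ (γ + 1))) (Fin (2 ^ (γ + 1))) ℂ)
        (A B : Fin (2 ^ γ) → Matrix (QBlock.TermIdx n) (QBlock.TermIdx n) ℂ),
        QBlock.IsCoeffPrep γ Np α m U →
        (∀ k, QBlock.IsOneTermAux Np (m k) (QBlock.termPX n a b (P k) (m k)) (A k)) →
        (∀ k, QBlock.IsOneTermAux Np (m k) (QBlock.termXP n a b (P k) (m k)) (B k)) →
        QBlock.lcuAux U A B ∈ Matrix.unitaryGroup (QBlock.AuxIdx n γ) ℂ ∧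
        QBlock.EncodesEntries (((1 / QBlock.normH γ Np α m : ℝ)) : ℂ)
          (QBlock.hHat n γ a b α P m) (QBlock.lcuAux U A B)) ∧
    -- and the components can be chosen such that the unitary has an explicitly bounded cost
    (∃ (U : Matrix (Fin (2 ^ (γ + 1))) (Fin (2 ^ (γ + 1))) ℂ)
        (A B : Fin (2 ^ γ) → Matrix (QBlock.TermIdx n) (QBlock.TermIdx n) ℂ),
        QBlock.IsCoeffPrep γ Np α m U ∧
        (∀ k, QBlock.IsOneTermAux Np (m k) (QBlock.termPX n a b (P k) (m k)) (A k)) ∧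
        (∀ k, QBlock.IsOneTermAux Np (m k) (QBlock.termXP n a b (P k) (m k)) (B k)) ∧
        ∃ (r : ℕ) (C : QBlock.Circuit (Fin r ⊕ QBlock.AuxQubits n γ)),
          QBlock.Implements C
            ((QBlock.lcuAux U A B).submatrix (QBlock.decode n γ) (QBlock.decode n γ)) ∧
          (QBlock.oneQubitCount C : ℤ) ≤
            2 ^ (γ + 2) * (9760 * n ^ 2 * qmax + 33 * 2 ^ (lmax + 2) * n + 160 * n + 8 * γ
              - 4504 * n * qmax - 476 * qmax - 115 * 2 ^ lmax - 239) ∧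
          (QBlock.cnotCount C : ℤ) ≤
            2 ^ (γ + 1) * (15792 * n ^ 2 * qmax + 107 * 2 ^ (lmax + 1) * n + 256 * n + 12 * γ
              - 7288 * n * qmax - 768 * qmax - 49 * 2 ^ (lmax + 1) - 382) ∧
          (r : ℤ) ≤ 2 * n + γ - 1) := by
  have hNpos : ∀ k, 0 < Np (m k) := fun k => QBlock.normConst_pos hn hab (hNp k)
  refine ⟨fun U A B hU hA hB => ⟨QBlock.lcuAux_mem_unitaryGroup hU.1 (fun k => (hA k).1)
    fun k => (hB k).1, QBlock.encodesEntries_lcuAux hNpos hα hU hA hB⟩, ?_⟩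
  have hterm := fun k => QBlock.exists_termCircuits hn ha hab hb (hP k) (hNp k)
  choose D hDc hDs using fun k => (hterm k).1
  choose C hCc hCs using fun k => (hterm k).2
  have hmono : ∀ {E : QBlock.Circuit (QBlock.TermQubits n)} (k : Fin (2 ^ γ)),
      QBlock.CostLE E
        (140 * n + (4 * n + 6) * 2 ^ QBlock.logSparsity (m k) + q k * (48 * n ^ 2 + 120 * n + 84))
        (124 * n + (8 * n + 12) * 2 ^ QBlock.logSparsity (m k) +
          q k * (96 * n ^ 2 + 216 * n + 132)) →
      QBlock.CostLE E (140 * n + (4 * n + 6) * 2 ^ lmax + qmax * (48 * n ^ 2 + 120 * n + 84))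
        (124 * n + (8 * n + 12) * 2 ^ lmax + qmax * (96 * n ^ 2 + 216 * n + 132)) := by
    intro E k hE
    have h1 : 2 ^ QBlock.logSparsity (m k) ≤ 2 ^ lmax := Nat.pow_le_pow_right (by norm_num)
      (hl ▸ Finset.le_sup (f := fun k => QBlock.logSparsity (m k)) (Finset.mem_univ k))
    have h2 : q k ≤ qmax := hq ▸ Finset.le_sup (Finset.mem_univ k)
    refine hE.mono ?_ ?_ <;> gcongr
  obtain ⟨U, hU, hUv, E, hEi, hEc⟩ := QBlock.exists_implements
    (QBlock.sum_norm_coeffVec hNpos hα) (fun k => hmono k (hCc k)) (fun k => hmono k (hDc k))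
    (fun k => (hCs k).1) (fun k => (hDs k).1) (fun k => (hCs k).2.1) (fun k => (hDs k).2.1)
  refine ⟨U, _, _, ⟨hU, hUv⟩, fun k => QBlock.isOneTermAux_termPX (hCs k),
    -- The `γ + 2` ancillas are the `γ + 1` members of the comparison chain and one carry.
    fun k => QBlock.isOneTermAux_termXP (hDs k), γ + 2, E, hEi, ?_, ?_, by push_cast; omega⟩
  · have h := hEc.1
    zify at h
    refine h.trans ?_
    rw [pow_succ _ (γ + 1), mul_assoc]
    refine mul_le_mul_of_nonneg_left ?_ (by positivity)
    have hn' : (2 : ℤ) ≤ n := by exact_mod_cast hn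
    have hL : (1 : ℤ) ≤ 2 ^ lmax := one_le_pow₀ (by norm_num)
    have hγ : (0 : ℤ) ≤ γ := by positivity
    -- The bound exceeds the count by `h1 + h2 + 4γ + 440n - 728`, which is nonnegative for `n ≥ 2`.
    have h1 : (0 : ℤ) ≤ (2 ^ lmax - 1) * (260 * n - 236) := mul_nonneg (by linarith) (by linarith)
    have h2 : (0 : ℤ) ≤ qmax * (19472 * n ^ 2 - 9128 * n - 1036) :=
      mul_nonneg (by positivity) (by nlinarith)
    rw [pow_add]
    linarith
  · have h := hEc.2
    zify at h
    refine h.trans ?_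
    refine mul_le_mul_of_nonneg_left ?_ (by positivity)
    have hn' : (2 : ℤ) ≤ n := by exact_mod_cast hn
    have hL : (1 : ℤ) ≤ 2 ^ lmax := one_le_pow₀ (by norm_num)
    -- Here the excess is `h1 + h2 + 338n - 504`.
    have h1 : (0 : ℤ) ≤ (2 ^ lmax - 1) * (206 * n - 110) := mul_nonneg (by linarith) (by linarith)
    have h2 : (0 : ℤ) ≤ qmax * (15696 * n ^ 2 - 7504 * n - 900) :=
      mul_nonneg (by positivity) (by nlinarith)
    rw [pow_add]
    linarith
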